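/- Let $n\ge 2$. A domain is a nonempty connected open set $\Omega\subset\mathbb R^n$; assume $|\Omega|=1$ and write $f_\Omega=\frac1{|\Omega|}\int_\Omega f$. Let $W^{1,1}(\Omega)$ be the space of $f\in L^1(\Omega)$ with weak gradient $\nabla f\in L^1(\Omega)$. A rearrangement invariant (r.i.) space is understood in the sense of Bennett and Sharpley (a Banach function space whose norm has the Fatou property and takes equal values on equimeasurable functions). For an r.i. space $X(\Omega)$, $\hat X$ denotes its representation on $(0,1)$: $\|h\|_{\hat X}=\|f\|_{X(\Omega)}$ for any measurable $f$ on $\Omega$ such that $|f|$ is equimeasurable with $|h|$. For $p\ge1$ consider the Sobolev–Poincaré inequality $$\Big(\int_\Omega|f-f_\Omega|^p\,dx\Big)^{1/p}\le C\int_\Omega|\nabla f|\,dx\qquad\forall f\in W^{1,1}(\Omega),\tag{$P_p$}$$ and, for r.i. spaces $X(\Omega),Y(\Omega)$, the inequalities $$\Big\|\int_t^1u^{1-1/p}g(u)\,\frac{du}{u}\Big\|_{\hat Y}\le c\,\|g\|_{\hat X}\qquad\forall g\in\hat X,\tag{$H_p$}$$ $$\|f-f_\Omega\|_{Y(\Omega)}\le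 C\,\|\nabla f\|_{X(\Omega)}\qquad\forall f\in W^{1,1}(\Omega).\tag{$S$}$$ The constants do not depend on $f$ and $g$; $(S)$ has content when $|\nabla f|\in X(\Omega)$, and it includes the assertion that then $f-f_\Omega\in Y(\Omega)$. (i) Let $1\le p\le\frac n{n-1}$, let $\Omega$ be a domain with $|\Omega|=1$ that satisfies $(P_p)$, and let $X(\Omega),Y(\Omega)$ be r.i. spaces. If $(H_p)$ holds, then $(S)$ holds. (ii) If $p\ne\frac n{n-1}$, the converse fails in general: for every $1\le p<\frac n{n-1}$ there are a domain $\Omega$ with $|\Omega|=1$ that satisfies $(P_p)$ and r.i. spaces $X(\Omega),Y(\Omega)$ for which $(S)$ holds but $(H_p)$ does not. Moreover, counterexamples are provided by Lebesgue spaces on $s$-John domains. A bounded domain $\Omega$ is $s$-John if there are $x_0\in\Omega$ and $c>0$ such that every $x\in\Omega$ is joined to $x_0$ by a rectifiable curve $\gamma:[0,l]\to\Omega$ parametrized by arc length, with $\gamma(0)=x$, $\gamma(l)=x_0$ and $\operatorname{dist}(\gamma(\tau),\partial\Omega)\ge c\,\tau^s$ for all $\tau\in[0,l]$. Let $1<s<\frac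 n{n-1}$, let $t>1$ with $\frac{t-1}{n-1}<s$, and put $p=\frac n{(n-1)s}$, $r=\frac{nt}{(n-1)s+(1-t)}$. Then the Muckenhoupt-type condition $$\sup_{0<a<1}\Big(\int_0^a1\,du\Big)^{1/r}\Big(\int_a^1\big(u^{(n-1)st/n}\big)^{-1/(t-1)}du\Big)^{(t-1)/t}<\infty$$ fails, and there is an $s$-John domain $\Omega$ with $|\Omega|=1$ that satisfies $(P_p)$ and for which, with $X=L^t$ and $Y=L^r$, $(S)$ holds but $(H_p)$ does not. -/

import Mathlib

open MeasureTheory Set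
open scoped ENNReal NNReal

namespace SobPoin

/-- `ℝⁿ` with its Euclidean norm. -/
abbrev E (n : ℕ) := EuclideanSpace ℝ (Fin n)

/-- Lebesgue measure on the interval `(0,1)`. -/
noncomputable abbrev unitMeasure : Measure ℝ := volume.restrict (Ioo (0 : ℝ) 1)

/-- `f` and `g` have the same distribution function (equivalently, the same decreasing
rearrangement); the two functions may live on different measure spaces. -/
def Equimeasurable {α β : Type*} [MeasurableSpace α] [MeasurableSpace β]
    (μ : Measure α) (ν : Measure β) (f : α → ℝ≥0∞) (g : β → ℝ≥0∞) : Prop :=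
  ∀ a : ℝ≥0∞, μ {x | a < f x} = ν {x | a < g x}

/-- A rearrangement invariant (Banach function) space over the measure `μ`, given by its function
norm on nonnegative measurable functions, as in Bennett and Sharpley: a real function `u`
belongs to the space when `norm (fun x => ‖u x‖ₑ)` is finite, and this is then its norm. -/
structure RISpace {α : Type*} [MeasurableSpace α] (μ : Measure α) where
  norm : (α → ℝ≥0∞) → ℝ≥0∞
  norm_eq_zero_iff : ∀ f, AEMeasurable f μ → (norm f = 0 ↔ f =ᵐ[μ] 0)
  norm_const_mul : ∀ (c : ℝ≥0) f, AEMeasurable f μ →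
    norm (fun x => (c : ℝ≥0∞) * f x) = c * norm f
  norm_add_le : ∀ f g, AEMeasurable f μ → AEMeasurable g μ →
    norm (fun x => f x + g x) ≤ norm f + norm g
  norm_mono : ∀ f g, AEMeasurable f μ → AEMeasurable g μ → f ≤ᵐ[μ] g → norm f ≤ norm g
  /-- The Fatou property. -/
  norm_iSup : ∀ f : ℕ → α → ℝ≥0∞, (∀ k, AEMeasurable (f k) μ) →
    (∀ᵐ x ∂μ, Monotone fun k => f k x) → norm (fun x => ⨆ k, f k x) = ⨆ k, norm (f k)
  norm_indicator_lt_top : ∀ s, MeasurableSet s → μ s < ⊤ → norm (s.indicator 1) < ⊤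
  setLIntegral_le : ∀ s, MeasurableSet s → μ s < ⊤ →
    ∃ C : ℝ≥0, ∀ f, AEMeasurable f μ → ∫⁻ x in s, f x ∂μ ≤ C * norm f
  norm_eq_of_equimeasurable : ∀ f g, AEMeasurable f μ → AEMeasurable g μ →
    Equimeasurable μ μ f g → norm f = norm g

/-- The norm of the representation `X̂` of `X` as a function space on `(0,1)`: the norm of
`h` in `X̂` is the norm in `X` of any function equimeasurable with `h`. By rearrangement
invariance all these functions have the same norm, and they exist if `μ` is nonatomic of total
mass one, so that the supremum is over a nonempty set of equal values. -/
noncomputable def RISpace.hatNorm {α : Type*} [MeasurableSpace α] {μ : Measure α}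
    (X : RISpace μ) (h : ℝ → ℝ≥0∞) : ℝ≥0∞ :=
  ⨆ (f : α → ℝ≥0∞) (_ : AEMeasurable f μ ∧ Equimeasurable μ unitMeasure f h), X.norm f

/-- `X` is the Lebesgue space `L^q`. -/
def RISpace.IsLp {α : Type*} [MeasurableSpace α] {μ : Measure α} (X : RISpace μ) (q : ℝ) : Prop :=
  ∀ f : α → ℝ≥0∞, AEMeasurable f μ → X.norm f = (∫⁻ x, f x ^ q ∂μ) ^ (1 / q)

/-- `f ∈ W^{1,1}(Ω)` with weak gradient `G`. -/
structure MemW11 {n : ℕ} (Ω : Set (E n)) (f : E n → ℝ) (G : E n → E n) : Prop where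
  integrable : IntegrableOn f Ω
  integrable_grad : IntegrableOn G Ω
  weak_grad : ∀ φ : E n → ℝ, ContDiff ℝ (⊤ : ℕ∞) φ → HasCompactSupport φ → tsupport φ ⊆ Ω →
    ∀ i : Fin n, ∫ x in Ω, f x * fderiv ℝ φ x (EuclideanSpace.single i 1)
      = - ∫ x in Ω, G x i * φ x

/-- The Sobolev-Poincaré inequality `‖f - f_Ω‖_{L^p(Ω)} ≤ C ‖∇f‖_{L^1(Ω)}` for all
`f ∈ W^{1,1}(Ω)`. -/
def SobolevPoincare {n : ℕ} (Ω : Set (E n)) (p : ℝ) : Prop :=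
  ∃ C : ℝ≥0, ∀ f G, MemW11 Ω f G →
    (∫⁻ x in Ω, ‖f x - ⨍ y in Ω, f y‖ₑ ^ p) ^ (1 / p) ≤ C * ∫⁻ x in Ω, ‖G x‖ₑ

/-- The Sobolev-Poincaré inequality `‖f - f_Ω‖_Y ≤ C ‖∇f‖_X` for all `f ∈ W^{1,1}(Ω)`
(it has content when `∇f ∈ X`). -/
def SobolevPoincareRI {n : ℕ} (Ω : Set (E n)) (X Y : RISpace (volume.restrict Ω)) : Prop :=
  ∃ C : ℝ≥0, ∀ f G, MemW11 Ω f G →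
    Y.norm (fun x => ‖f x - ⨍ y in Ω, f y‖ₑ) ≤ C * X.norm (fun x => ‖G x‖ₑ)

/-- The Hardy operator `g ↦ ∫_t^1 u^{1-1/p} g(u) du/u` is bounded from `X̂` to `Ŷ`. -/
def HardyBounded {α : Type*} [MeasurableSpace α] {μ : Measure α} (p : ℝ) (X Y : RISpace μ) :
    Prop :=
  ∃ c : ℝ≥0, ∀ g : ℝ → ℝ, AEMeasurable g unitMeasure → X.hatNorm (fun u => ‖g u‖ₑ) < ⊤ →
    Y.hatNorm (fun t => ‖∫ u in t..1, u ^ (1 - 1 / p) * g u / u‖ₑ)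
      ≤ c * X.hatNorm (fun u => ‖g u‖ₑ)

/-- A domain of measure one. -/
structure IsUnitDomain {n : ℕ} (Ω : Set (E n)) : Prop where
  isOpen : IsOpen Ω
  isConnected : IsConnected Ω
  volume_eq_one : volume Ω = 1

/-- `Ω` is an `s`-John domain: it is a bounded domain with a centre `x₀` to which every `x ∈ Ω` can
be joined in `Ω` by a rectifiable curve `γ : [0,l] → Ω`, parametrized by arc length, with
`dist(γ(τ), ∂Ω) ≥ c τ^s`. -/
def IsJohnDomain {n : ℕ} (s : ℝ) (Ω : Set (E n)) : Prop :=
  IsOpen Ω ∧ IsConnected Ω ∧ Bornology.IsBounded Ω ∧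
  ∃ x₀ ∈ Ω, ∃ c : ℝ, 0 < c ∧ ∀ x ∈ Ω, ∃ (l : ℝ) (γ : ℝ → E n), 0 ≤ l ∧
    HasUnitSpeedOn γ (Icc 0 l) ∧ MapsTo γ (Icc 0 l) Ω ∧ γ 0 = x ∧ γ l = x₀ ∧
    ∀ τ ∈ Icc (0 : ℝ) l, c * τ ^ s ≤ Metric.infDist (γ τ) (frontier Ω)

/-- The Muckenhoupt-type condition for the weighted Hardy inequality
`‖∫_x^1 g‖_{L^r} ≤ c ‖g(x) x^b‖_{L^t}` on `(0,1)`: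
`sup_{0<a<1} (∫_0^a 1)^{1/r} (∫_a^1 (u^{bt})^{-1/(t-1)} du)^{(t-1)/t} < ∞`. -/
def MuckenhouptCondition (b t r : ℝ) : Prop :=
  ∃ K : ℝ, ∀ a ∈ Ioo (0 : ℝ) 1,
    (∫ _u in (0 : ℝ)..a, (1 : ℝ)) ^ (1 / r) *
      (∫ u in a..1, (u ^ (b * t)) ^ (-1 / (t - 1))) ^ ((t - 1) / t) ≤ K

end SobPoin

/-! Part (i) is a symmetrization by truncation. Put v = |f - f_Ω|, let v* be its decreasing
rearrangement and take the levels t_j = v*(2^{-(j+1)}). Where v lies strictly between t_j and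
t_{j+1}, call the set D_j. Both {v ≤ t_j} and {v ≥ t_{j+1}} have measure at least 2^{-(j+2)}, so
(P_p), applied to a truncation of |f - f_Ω| between these levels, bounds t_{j+1} - t_j by a constant
times 2^{j/p} ∫_{D_j} |∇f| (`level_gap_le`, `level_succ_le`). Let w be the step function equal to
2^{j+1} ∫_{D_j} |∇f| on (2^{-(j+1)}, 2^{-j}]. Summing over j gives v*(s) ≤ v*(1/2) + 12 C ∫_s^1
u^{1-1/p} w(u) du/u. The first term is controlled by the L^1 norm of v, hence by (P_p) and the
embedding of X in L^1; the second is the Hardy operator applied to w.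

It remains to see that ‖w‖ ≤ ‖∇f‖_X (`RISpace.norm_dyadGlue_average_le`). Since |D_j| ≤ 2^{-(j+1)},
the part of |∇f| living on D_j can be rearranged inside the j-th dyadic interval, and w averages
these rearrangements interval by interval. Such an average is dominated by means over finitely many
cyclic shifts within each interval. Every shifted function is equimeasurable with |∇f| on the union
of the D_j, so the triangle inequality bounds the means, and the Fatou property gives the limit.

The truncations are C¹, so the only calculus needed for weak gradients is the chain rule for bounded
C¹ functions, obtained by mollification (`MemW11.comp`).

All counterexamples live on one ball of measure one. There `sobolevPoincareRI_ball` gives (S) from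
L^t to L^q whenever 1 - n/t + n/q > 0: averages of f over balls shrinking to x telescope, the
Poincaré inequality bounds each difference by an integral of |∇f| over a small ball, and the
resulting series of operators from L^t to L^q is geometric. Testing the Hardy operator on indicators
of (0, a] shows that it is unbounded from L^t to L^r when 1 + 1/r - 1/p - 1/t < 0
(`not_hardyBounded_of_isLp`). For p below n/(n-1) both conditions can hold at once, because a ball
satisfies better inequalities than (P_p) records. A ball is s-John for every s ≥ 1, so it also
serves for the last claim. -/

open Filter Topology Metric
open scoped Convolution
set_option linter.unusedSectionVars false

/-! ### Mollification in L¹ and almost everywhere. -/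

section Mollification

variable {V F : Type*} [NormedAddCommGroup V] [InnerProductSpace ℝ V] [FiniteDimensional ℝ V]
  [MeasurableSpace V] [BorelSpace V] [NormedAddCommGroup F] [NormedSpace ℝ F] [CompleteSpace F]

/-- Continuity of translations in `L¹`. -/
theorem tendsto_lintegral_enorm_translate_sub {g : V → F} (hg : Integrable g) :
    Tendsto (fun y : V => ∫⁻ x, ‖g (x - y) - g x‖ₑ) (𝓝 0) (𝓝 0) := by
  have hm : MemLp g 1 volume := memLp_one_iff_integrable.2 hg
  let T : C(V, C(V, V)) := (ContinuousMap.mk (fun p : V × V => p.2 - p.1) (by fun_prop)).curry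
  have hT : ∀ y, MeasurePreserving (T y) (volume : Measure V) volume := fun y =>
    measurePreserving_sub_right volume y
  have h1 : Tendsto (fun y => Lp.compMeasurePreserving (T y) (hT y) (hm.toLp g)) (𝓝 0)
      (𝓝 (Lp.compMeasurePreserving (T 0) (hT 0) (hm.toLp g))) :=
    Tendsto.compMeasurePreservingLp tendsto_const_nhds (T.continuous.tendsto 0) hT (hT 0) (by simp)
  rw [Lp.tendsto_Lp_iff_tendsto_eLpNorm'] at h1
  refine h1.congr fun y => ?_
  rw [eLpNorm_one_eq_lintegral_enorm]
  refine lintegral_congr_ae ?_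
  have a1 := Lp.coeFn_compMeasurePreserving (hm.toLp g) (hT y)
  have a2 := Lp.coeFn_compMeasurePreserving (hm.toLp g) (hT 0)
  have b1 := (hT y).quasiMeasurePreserving.ae_eq_comp (hm.coeFn_toLp)
  have b2 := (hT 0).quasiMeasurePreserving.ae_eq_comp (hm.coeFn_toLp)
  filter_upwards [a1, a2, b1, b2] with x h1 h2 h3 h4
  simp only [Pi.sub_apply, h1, h2, h3, h4]
  simp [T, Function.comp]

/-- The mollification of `g` by a normed bump function. -/
noncomputable def mollify (φ : ContDiffBump (0 : V)) (g : V → F) (x : V) : F :=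
  ∫ t, φ.normed volume (x - t) • g t

theorem mollify_eq_convolution (φ : ContDiffBump (0 : V)) (g : V → F) :
    mollify φ g = (φ.normed volume ⋆[ContinuousLinearMap.lsmul ℝ ℝ, volume] g) := by
  ext x
  rw [convolution_lsmul_swap]
  rfl

theorem contDiff_mollify (φ : ContDiffBump (0 : V)) {g : V → F} (hg : Integrable g) :
    ContDiff ℝ 1 (mollify φ g) := by
  rw [mollify_eq_convolution]
  exact φ.hasCompactSupport_normed.contDiff_convolution_left (n := 1) _
    φ.contDiff_normed hg.locallyIntegrable

theorem mollify_eq_integral_sub (φ : ContDiffBump (0 : V)) (g : V → F) (x : V) :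
    mollify φ g x = ∫ t, φ.normed volume t • g (x - t) := by
  rw [mollify_eq_convolution, convolution_lsmul]

/-- The kernel has mass one and lives in a ball of radius `φ.rOut`, so the error is a mean of the
differences g(· - t) - g over small t; Tonelli turns this into a mean of their L¹ norms. -/
theorem lintegral_enorm_mollify_sub_le (φ : ContDiffBump (0 : V)) {g : V → F}
    (hg : Integrable g) {ε : ℝ≥0∞}
    (h : ∀ y ∈ ball (0 : V) φ.rOut, ∫⁻ x, ‖g (x - y) - g x‖ₑ ≤ ε) :
    ∫⁻ x, ‖mollify φ g x - g x‖ₑ ≤ ε := by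
  have hint : ∀ x, Integrable (fun t => φ.normed volume t • g (x - t)) := fun x =>
    ((φ.hasCompactSupport_normed (μ := volume)).convolutionExists_left
      (ContinuousLinearMap.lsmul ℝ ℝ) φ.continuous_normed hg.locallyIntegrable x).integrable
  have h1 : ∀ x, ‖mollify φ g x - g x‖ₑ
      ≤ ∫⁻ t, ‖φ.normed volume t‖ₑ * ‖g (x - t) - g x‖ₑ := by
    intro x
    have : mollify φ g x - g x = ∫ t, φ.normed volume t • (g (x - t) - g x) := by
      simp_rw [smul_sub]
      rw [integral_sub (hint x) (φ.integrable_normed.smul_const _), ← mollify_eq_integral_sub,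
        φ.integral_normed_smul]
    rw [this]
    refine (enorm_integral_le_lintegral_enorm _).trans_eq ?_
    simp_rw [enorm_smul]
  have hmeas : AEMeasurable (fun p : V × V => ‖φ.normed volume p.2‖ₑ * ‖g (p.1 - p.2) - g p.1‖ₑ)
      (volume.prod volume) := by
    have m1 : AEMeasurable (fun p : V × V => ‖φ.normed volume p.2‖ₑ)
        (volume.prod (volume : Measure V)) :=
      (φ.continuous_normed.comp continuous_snd).measurable.enorm.aemeasurable
    have := hg.aestronglyMeasurable.comp_quasiMeasurePreserving
      (quasiMeasurePreserving_sub_of_right_invariant (volume : Measure V) (volume : Measure V))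
    exact m1.mul (this.sub hg.aestronglyMeasurable.comp_fst).enorm
  calc ∫⁻ x, ‖mollify φ g x - g x‖ₑ
      ≤ ∫⁻ x, ∫⁻ t, ‖φ.normed volume t‖ₑ * ‖g (x - t) - g x‖ₑ := lintegral_mono h1
    _ = ∫⁻ t, ∫⁻ x, ‖φ.normed volume t‖ₑ * ‖g (x - t) - g x‖ₑ := lintegral_lintegral_swap hmeas
    _ = ∫⁻ t, ‖φ.normed volume t‖ₑ * ∫⁻ x, ‖g (x - t) - g x‖ₑ := by
        refine lintegral_congr fun t => ?_
        rw [lintegral_const_mul' _ _ enorm_ne_top]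
    _ ≤ ∫⁻ t, ‖φ.normed volume t‖ₑ * ε := by
        refine lintegral_mono fun t => ?_
        by_cases ht : t ∈ ball (0 : V) φ.rOut
        · exact mul_le_mul_right (h t ht) _
        · rw [← φ.support_normed_eq (μ := volume), Function.notMem_support] at ht
          simp [ht]
    _ = ε := by
        rw [lintegral_mul_const _ φ.continuous_normed.measurable.enorm,
          ← ofReal_integral_norm_eq_lintegral_enorm φ.integrable_normed]
        simp_rw [Real.norm_of_nonneg (φ.nonneg_normed _), φ.integral_normed]
        simp

/-- A sequence of bump functions shrinking to the origin. -/
noncomputable def bumpSeq (V : Type*) [NormedAddCommGroup V] (k : ℕ) : ContDiffBump (0 : V) where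
  rIn := 1 / (2 * (k + 1))
  rOut := 1 / (k + 1)
  rIn_pos := by positivity
  rIn_lt_rOut := by
    rw [one_div_lt_one_div (by positivity) (by positivity)]
    have : (0 : ℝ) ≤ k := k.cast_nonneg
    linarith

theorem tendsto_bumpSeq_rOut : Tendsto (fun k => (bumpSeq V k).rOut) atTop (𝓝 0) :=
  tendsto_one_div_add_atTop_nhds_zero_nat

theorem tendsto_lintegral_enorm_mollify_sub {g : V → F} (hg : Integrable g) :
    Tendsto (fun k => ∫⁻ x, ‖mollify (bumpSeq V k) g x - g x‖ₑ) atTop (𝓝 0) := by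
  rw [ENNReal.tendsto_nhds_zero]
  intro ε hε
  have h := (ENNReal.tendsto_nhds_zero.1 (tendsto_lintegral_enorm_translate_sub hg)) ε hε
  obtain ⟨δ, hδ, hb⟩ := Metric.eventually_nhds_iff_ball.1 h
  filter_upwards [(tendsto_bumpSeq_rOut (V := V)).eventually (gt_mem_nhds hδ)] with k hk
  exact lintegral_enorm_mollify_sub_le _ hg fun y hy => hb y (ball_subset_ball hk.le hy)

/-- Lebesgue differentiation applies because the outer radius is a fixed multiple, here 2, of the
inner one along `bumpSeq`. -/
theorem ae_tendsto_mollify {g : V → F} (hg : Integrable g) :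
    ∀ᵐ x, Tendsto (fun k => mollify (bumpSeq V k) g x) atTop (𝓝 (g x)) := by
  simp_rw [mollify_eq_convolution]
  refine ContDiffBump.ae_convolution_tendsto_right_of_locallyIntegrable (K := 2)
    tendsto_bumpSeq_rOut (Eventually.of_forall fun k => ?_) hg.locallyIntegrable
  simp only [bumpSeq]
  apply le_of_eq
  field_simp

theorem fderiv_mollify_apply (φ : ContDiffBump (0 : V)) {g : V → ℝ} (hg : Integrable g) (x v : V) :
    fderiv ℝ (mollify φ g) x v = ∫ t, fderiv ℝ (φ.normed volume) (x - t) v * g t := by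
  rw [mollify_eq_convolution]
  have hc := (φ.hasCompactSupport_normed (μ := volume)).hasFDerivAt_convolution_left
    (ContinuousLinearMap.lsmul ℝ ℝ) (φ.contDiff_normed (n := 1)) hg.locallyIntegrable x
  rw [hc.fderiv, convolution_eq_swap, ContinuousLinearMap.integral_apply]
  · rfl
  · have := ((φ.hasCompactSupport_normed (μ := volume)).fderiv (𝕜 := ℝ)).convolutionExists_left
      ((ContinuousLinearMap.lsmul ℝ ℝ).precompL V)
      ((φ.contDiff_normed (n := 1)).continuous_fderiv (by simp)) hg.locallyIntegrable x
    exact this.integrable_swap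

end Mollification

namespace SobPoin

/-! ### Weak gradients: mollification and the C¹ chain rule. -/

section WeakGradient

variable {n : ℕ} {Ω : Set (E n)} {f : E n → ℝ} {G : E n → E n}

theorem mollify_apply (φ : ContDiffBump (0 : E n)) (hG : Integrable G) (x : E n) (i : Fin n) :
    mollify φ G x i = ∫ t, φ.normed volume (x - t) * G t i := by
  have hint : Integrable (fun t => φ.normed volume (x - t) • G t) := by
    have := ((φ.hasCompactSupport_normed (μ := volume)).convolutionExists_left
      (ContinuousLinearMap.lsmul ℝ ℝ) φ.continuous_normed hG.locallyIntegrable x).integrable_swap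
    exact this
  have := (EuclideanSpace.proj i : E n →L[ℝ] ℝ).integral_comp_comm hint
  simpa [mollify] using this.symm

/-- The derivative falls on the kernel, and t ↦ ρ(x - t) is an admissible test function as its
support lies in the closed ball around x. Both sides are linear in v, so the basis vectors suffice.
-/
theorem MemW11.fderiv_mollify (hΩ : IsOpen Ω) (h : MemW11 Ω f G) (φ : ContDiffBump (0 : E n))
    {x : E n} (hx : closedBall x φ.rOut ⊆ Ω) (v : E n) :
    fderiv ℝ (mollify φ (Ω.indicator f)) x v = inner ℝ (mollify φ (Ω.indicator G) x) v := by
  have hf : Integrable (Ω.indicator f) := (integrable_indicator_iff hΩ.measurableSet).2 h.integrable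
  have hG : Integrable (Ω.indicator G) :=
    (integrable_indicator_iff hΩ.measurableSet).2 h.integrable_grad
  suffices hL : (fderiv ℝ (mollify φ (Ω.indicator f)) x : E n →ₗ[ℝ] ℝ)
      = (innerSL ℝ (mollify φ (Ω.indicator G) x) : E n →L[ℝ] ℝ) by
    simpa using LinearMap.congr_fun hL v
  refine (EuclideanSpace.basisFun (Fin n) ℝ).toBasis.ext fun i => ?_
  simp only [OrthonormalBasis.coe_toBasis, EuclideanSpace.basisFun_apply,
    ContinuousLinearMap.coe_coe, innerSL_apply_apply, EuclideanSpace.inner_single_right]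
  rw [fderiv_mollify_apply φ hf, mollify_apply φ hG]
  set ρ := φ.normed (volume : Measure (E n)) with hρ
  have hsm : ContDiff ℝ (⊤ : ℕ∞) (fun t => ρ (x - t)) :=
    φ.contDiff_normed.comp (contDiff_const.sub contDiff_id)
  have hts : tsupport (fun t => ρ (x - t)) ⊆ closedBall x φ.rOut := by
    refine closure_minimal (fun t ht => ?_) isClosed_closedBall
    have : x - t ∈ Function.support ρ := ht
    rw [φ.support_normed_eq, mem_ball_zero_iff] at this
    rw [mem_closedBall, dist_comm, dist_eq_norm]
    exact this.le
  have hcs : HasCompactSupport (fun t => ρ (x - t)) :=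
    (isCompact_closedBall x φ.rOut).of_isClosed_subset (isClosed_tsupport _) hts
  have hd : ∀ t, fderiv ℝ (fun t => ρ (x - t)) t (EuclideanSpace.single i 1)
      = - fderiv ℝ ρ (x - t) (EuclideanSpace.single i 1) := by
    intro t
    have h1 : HasFDerivAt ρ (fderiv ℝ ρ (x - t)) (x - t) :=
      ((φ.contDiff_normed (n := 1)).differentiable (by simp) _).hasFDerivAt
    have h2 : HasFDerivAt (fun t => x - t) (-ContinuousLinearMap.id ℝ (E n)) t :=
      (hasFDerivAt_id t).const_sub x
    rw [show (fun t => ρ (x - t)) = ρ ∘ (fun t => x - t) from rfl, (h1.comp t h2).fderiv]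
    simp
  have key := h.weak_grad _ hsm hcs (hts.trans hx) i
  simp_rw [hd] at key
  have e1 : ∫ t, fderiv ℝ ρ (x - t) (EuclideanSpace.single i 1) * Ω.indicator f t
      = ∫ t in Ω, f t * fderiv ℝ ρ (x - t) (EuclideanSpace.single i 1) := by
    rw [← integral_indicator hΩ.measurableSet]
    congr 1; ext t
    by_cases ht : t ∈ Ω <;> simp [ht, mul_comm]
  have e2 : ∫ t, ρ (x - t) * Ω.indicator G t i = ∫ t in Ω, G t i * ρ (x - t) := by
    rw [← integral_indicator hΩ.measurableSet]
    congr 1; ext t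
    by_cases ht : t ∈ Ω <;> simp [ht, mul_comm]
  rw [e1, e2]
  simp_rw [mul_neg] at key
  rw [integral_neg] at key
  simpa using key

theorem eventually_closedBall_bumpSeq_subset (hΩ : IsOpen Ω) {K : Set (E n)} (hK : IsCompact K)
    (hKΩ : K ⊆ Ω) : ∀ᶠ k in atTop, ∀ x ∈ K, closedBall x (bumpSeq (E n) k).rOut ⊆ Ω := by
  obtain ⟨δ, hδ, hd⟩ := hK.exists_cthickening_subset_open hΩ hKΩ
  filter_upwards [(tendsto_bumpSeq_rOut (V := E n)).eventually (gt_mem_nhds hδ)] with k hk x hx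
  exact (closedBall_subset_closedBall hk.le).trans
    ((closedBall_subset_cthickening hx δ).trans hd)

/-- Chain rule for bounded `C¹` functions with bounded derivative. -/
theorem MemW11.comp (hΩ : IsOpen Ω) (hfin : volume Ω ≠ ⊤) (h : MemW11 Ω f G) {ψ θ : ℝ → ℝ}
    {M : ℝ} (hψ : ∀ x, HasDerivAt ψ (θ x) x) (hθ : Continuous θ) (hψM : ∀ x, |ψ x| ≤ M)
    (hθM : ∀ x, |θ x| ≤ M) : MemW11 Ω (fun x => ψ (f x)) (fun x => θ (f x) • G x) := by
  have hψc : Continuous ψ := continuous_iff_continuousAt.2 fun x => (hψ x).continuousAt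
  have hψ1 : ContDiff ℝ 1 ψ := by
    rw [contDiff_one_iff_deriv]
    refine ⟨fun x => (hψ x).differentiableAt, ?_⟩
    rwa [show deriv ψ = θ from funext fun x => (hψ x).deriv]
  have hM : 0 ≤ M := (abs_nonneg _).trans (hψM 0)
  have : IsFiniteMeasure (volume.restrict Ω) := isFiniteMeasure_restrict.2 hfin
  refine ⟨?_, ?_, ?_⟩
  · exact Integrable.of_bound (hψc.comp_aestronglyMeasurable h.integrable.aestronglyMeasurable) M
      (Eventually.of_forall fun x => hψM _)
  · exact h.integrable_grad.bdd_smul M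
      (hθ.comp_aestronglyMeasurable h.integrable.aestronglyMeasurable)
      (Eventually.of_forall fun x => hθM _)
  intro η hη hηc hηΩ i
  have hf : Integrable (Ω.indicator f) := (integrable_indicator_iff hΩ.measurableSet).2 h.integrable
  have hG : Integrable (Ω.indicator G) :=
    (integrable_indicator_iff hΩ.measurableSet).2 h.integrable_grad
  set e : E n := EuclideanSpace.single i 1
  set F := Ω.indicator f
  set H := Ω.indicator G
  let fk : ℕ → E n → ℝ := fun k => mollify (bumpSeq (E n) k) F
  let Gk : ℕ → E n → E n := fun k => mollify (bumpSeq (E n) k) H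
  have hfk : ∀ k, ContDiff ℝ 1 (fk k) := fun k => contDiff_mollify _ hf
  have hGk : ∀ k, Continuous (Gk k) := fun k => (contDiff_mollify _ hG).continuous
  have hη1 : ContDiff ℝ 1 η := hη.of_le (by exact_mod_cast le_top)
  have hηcont : Continuous η := hη.continuous
  have hηd : Continuous fun x => fderiv ℝ η x e :=
    (hη1.continuous_fderiv (by simp)).clm_apply continuous_const
  have hηdc : HasCompactSupport fun x => fderiv ℝ η x e :=
    (hηc.fderiv (𝕜 := ℝ)).comp_left (g := fun L : E n →L[ℝ] ℝ => L e) (by simp)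
  have hηi : Integrable η := hηcont.integrable_of_hasCompactSupport hηc
  have hηdi : Integrable fun x => fderiv ℝ η x e := hηd.integrable_of_hasCompactSupport hηdc
  obtain ⟨N, hN⟩ := hηc.exists_bound_of_continuous hηcont
  have hN0 : 0 ≤ N := (norm_nonneg _).trans (hN 0)
  -- the identity for the mollified functions
  have step : ∀ᶠ k in atTop, ∫ x, ψ (fk k x) * fderiv ℝ η x e
      = - ∫ x, θ (fk k x) * Gk k x i * η x := by
    filter_upwards [eventually_closedBall_bumpSeq_subset hΩ hηc.isCompact hηΩ] with k hk
    have hc : ContDiff ℝ 1 (fun x => ψ (fk k x)) := hψ1.comp (hfk k)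
    have hder : ∀ x, fderiv ℝ (fun x => ψ (fk k x)) x e = θ (fk k x) * fderiv ℝ (fk k) x e := by
      intro x
      have h1 := (hψ (fk k x)).hasFDerivAt.comp x
        ((hfk k).differentiable (by simp) x).hasFDerivAt
      rw [show (fun x => ψ (fk k x)) = ψ ∘ fk k from rfl, h1.fderiv]
      simp [mul_comm]
    have hce : Continuous fun x => fderiv ℝ (fun x => ψ (fk k x)) x e :=
      (hc.continuous_fderiv (by simp)).clm_apply continuous_const
    -- Classical integration by parts. The gradient of the mollified function is identified only on
    -- the support of η; elsewhere the factor η vanishes.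
    rw [integral_mul_fderiv_eq_neg_fderiv_mul_of_integrable]
    · congr 1
      refine integral_congr_ae (Eventually.of_forall fun x => ?_)
      simp only [hder]
      by_cases hx : x ∈ tsupport η
      · have := h.fderiv_mollify hΩ (bumpSeq (E n) k) (hk x hx) e
        simp only [fk, Gk, F, H] at *
        rw [this]
        simp [e, EuclideanSpace.inner_single_right]
      · simp [image_eq_zero_of_notMem_tsupport hx]
    · exact (hce.mul hηcont).integrable_of_hasCompactSupport hηc.mul_left
    · exact (hc.continuous.mul hηd).integrable_of_hasCompactSupport hηdc.mul_left
    · exact (hc.continuous.mul hηcont).integrable_of_hasCompactSupport hηc.mul_left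
    · exact fun x _ => hc.differentiable (by simp) x
    · exact fun x _ => hη1.differentiable (by simp) x
  have haef := ae_tendsto_mollify hf
  have lim1 : Tendsto (fun k => ∫ x, ψ (fk k x) * fderiv ℝ η x e) atTop
      (𝓝 (∫ x, ψ (F x) * fderiv ℝ η x e)) := by
    refine tendsto_integral_of_dominated_convergence (fun x => M * ‖fderiv ℝ η x e‖)
      (fun k => ((hψc.comp (hfk k).continuous).mul hηd).aestronglyMeasurable)
      (hηdi.norm.const_mul M) (fun k => Eventually.of_forall fun x => ?_) ?_
    · rw [norm_mul]
      exact mul_le_mul_of_nonneg_right (hψM _) (norm_nonneg _)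
    · filter_upwards [haef] with x hx
      exact ((hψc.tendsto _).comp hx).mul_const _
  have hHi : Integrable fun x => H x i :=
    (EuclideanSpace.proj i : E n →L[ℝ] ℝ).integrable_comp hG
  have lim2 : Tendsto (fun k => ∫ x, θ (fk k x) * H x i * η x) atTop
      (𝓝 (∫ x, θ (F x) * H x i * η x)) := by
    refine tendsto_integral_of_dominated_convergence (fun x => M * ‖H x i‖ * N)
      (fun k => ((hθ.comp (hfk k).continuous).aestronglyMeasurable.mul
        hHi.aestronglyMeasurable).mul hηcont.aestronglyMeasurable)
      ((hHi.norm.const_mul M).mul_const N) (fun k => Eventually.of_forall fun x => ?_) ?_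
    · rw [norm_mul, norm_mul]
      gcongr
      · exact hθM _
      · exact hN x
    · filter_upwards [haef] with x hx
      exact (((hθ.tendsto _).comp hx).mul_const _).mul_const _
  have hGki : ∀ k, Continuous fun x => Gk k x i := fun k =>
    (EuclideanSpace.proj i : E n →L[ℝ] ℝ).continuous.comp (hGk k)
  -- No common dominating function for `Gk` is at hand, so the limit is split: this part uses L¹
  -- convergence against bounded factors, while `lim2` has the fixed H and uses dominated
  -- convergence.
  have lim3 : Tendsto (fun k => ∫ x, θ (fk k x) * (Gk k x i - H x i) * η x) atTop (𝓝 0) := by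
    rw [tendsto_iff_enorm_sub_tendsto_zero]
    have hb := ENNReal.Tendsto.const_mul (a := ENNReal.ofReal (M * N))
      (tendsto_lintegral_enorm_mollify_sub hG) (Or.inr ENNReal.ofReal_ne_top)
    rw [mul_zero] at hb
    refine tendsto_of_tendsto_of_tendsto_of_le_of_le tendsto_const_nhds hb (fun _ => zero_le)
      fun k => ?_
    simp only [sub_zero]
    refine (enorm_integral_le_lintegral_enorm _).trans ?_
    rw [← lintegral_const_mul' _ _ ENNReal.ofReal_ne_top]
    refine lintegral_mono fun x => ?_
    rw [← ofReal_norm, ← ofReal_norm, ← ENNReal.ofReal_mul (by positivity)]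
    refine ENNReal.ofReal_le_ofReal ?_
    rw [norm_mul, norm_mul]
    have : ‖Gk k x i - H x i‖ ≤ ‖Gk k x - H x‖ := PiLp.norm_apply_le (Gk k x - H x) i
    calc ‖θ (fk k x)‖ * ‖Gk k x i - H x i‖ * ‖η x‖
        ≤ M * ‖Gk k x - H x‖ * N := by
          gcongr
          · exact hθM _
          · exact hN x
      _ = M * N * ‖Gk k x - H x‖ := by ring
  have lim4 : Tendsto (fun k => ∫ x, θ (fk k x) * Gk k x i * η x) atTop
      (𝓝 (∫ x, θ (F x) * H x i * η x)) := by
    have := lim3.add lim2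
    rw [zero_add] at this
    refine this.congr fun k => ?_
    have i2 : Integrable fun x => θ (fk k x) * H x i * η x := by
      refine Integrable.mono' ((hHi.norm.const_mul M).mul_const N)
        (((hθ.comp (hfk k).continuous).aestronglyMeasurable.mul
        hHi.aestronglyMeasurable).mul hηcont.aestronglyMeasurable)
        (Eventually.of_forall fun x => ?_)
      rw [norm_mul, norm_mul]
      gcongr
      · exact hθM _
      · exact hN x
    have i1 : Integrable fun x => θ (fk k x) * Gk k x i * η x :=
      (((hθ.comp (hfk k).continuous).mul (hGki k)).mul
        hηcont).integrable_of_hasCompactSupport hηc.mul_left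
    rw [eq_comm, ← sub_eq_iff_eq_add, ← integral_sub i1 i2]
    congr 1; ext x; ring
  have fin := tendsto_nhds_unique_of_eventuallyEq lim1 lim4.neg step
  have r1 : ∫ x in Ω, ψ (f x) * fderiv ℝ η x e = ∫ x, ψ (F x) * fderiv ℝ η x e := by
    rw [← integral_indicator hΩ.measurableSet]
    congr 1; ext x
    by_cases hx : x ∈ Ω
    · simp [hx, F]
    · have : fderiv ℝ η x = 0 := image_eq_zero_of_notMem_tsupport
        fun hc => hx (hηΩ (tsupport_fderiv_subset ℝ hc))
      simp [this, hx]
  have r2 : ∫ x in Ω, (θ (f x) • G x) i * η x = ∫ x, θ (F x) * H x i * η x := by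
    rw [← integral_indicator hΩ.measurableSet]
    congr 1; ext x
    by_cases hx : x ∈ Ω
    · simp [hx, F, H]
    · simp [hx, image_eq_zero_of_notMem_tsupport fun hc => hx (hηΩ hc)]
  rw [r1, r2, fin]

end WeakGradient


/-! ### Elementary properties of r.i. norms. -/

section RISpaceBasic

variable {α : Type*} [MeasurableSpace α] {μ : Measure α} (X : RISpace μ)

theorem RISpace.norm_congr {f g : α → ℝ≥0∞} (hf : AEMeasurable f μ) (h : f =ᵐ[μ] g) :
    X.norm f = X.norm g :=
  le_antisymm (X.norm_mono _ _ hf (hf.congr h) h.le) (X.norm_mono _ _ (hf.congr h) hf h.symm.le)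

theorem RISpace.norm_zero : X.norm (fun _ => 0) = 0 :=
  (X.norm_eq_zero_iff _ aemeasurable_const).2 (Eventually.of_forall fun _ => rfl)

theorem RISpace.norm_sum_le {ι : Type*} (s : Finset ι) {f : ι → α → ℝ≥0∞}
    (hf : ∀ i, AEMeasurable (f i) μ) :
    X.norm (fun x => ∑ i ∈ s, f i x) ≤ ∑ i ∈ s, X.norm (f i) := by
  classical
  induction s using Finset.induction_on with
  | empty => simp [X.norm_zero]
  | insert a s ha ih =>
    simp only [Finset.sum_insert ha]
    exact (X.norm_add_le _ _ (hf a) (Finset.aemeasurable_fun_sum _ fun i _ => hf i)).trans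
      (add_le_add le_rfl ih)

/-- Countable subadditivity is finite subadditivity followed by the Fatou property for partial sums.
-/
theorem RISpace.norm_tsum_le {f : ℕ → α → ℝ≥0∞} (hf : ∀ i, AEMeasurable (f i) μ) :
    X.norm (fun x => ∑' i, f i x) ≤ ∑' i, X.norm (f i) := by
  simp_rw [ENNReal.tsum_eq_iSup_nat]
  rw [X.norm_iSup]
  · refine iSup_le fun k => le_iSup_of_le k ?_
    exact X.norm_sum_le _ hf
  · exact fun k => Finset.aemeasurable_fun_sum _ fun i _ => hf i
  · exact Eventually.of_forall fun x => fun a b hab =>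
      Finset.sum_le_sum_of_subset (Finset.range_subset_range.2 hab)

end RISpaceBasic

/-! ### Equimeasurability and the decreasing rearrangement. -/

section Equimeasurable

variable {α β : Type*} [MeasurableSpace α] [MeasurableSpace β] {μ : Measure α} {ν : Measure β}

/-- The rays (a, ∞] form a generating π-system, so equal distribution functions mean equal laws on
[0, ∞]. -/
theorem Equimeasurable.lintegral_comp_eq [IsProbabilityMeasure μ] [IsProbabilityMeasure ν]
    {f : α → ℝ≥0∞} {g : β → ℝ≥0∞} (h : Equimeasurable μ ν f g) (hf : AEMeasurable f μ)
    (hg : AEMeasurable g ν) {Φ : ℝ≥0∞ → ℝ≥0∞} (hΦ : Measurable Φ) :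
    ∫⁻ x, Φ (f x) ∂μ = ∫⁻ y, Φ (g y) ∂ν := by
  have hmap : μ.map f = ν.map g := by
    have := Measure.isProbabilityMeasure_map hf
    have := Measure.isProbabilityMeasure_map hg
    refine ext_of_generate_finite (range Ioi) ?_ isPiSystem_Ioi ?_ (by simp)
    · rw [← borel_eq_generateFrom_Ioi]
      exact BorelSpace.measurable_eq
    · rintro _ ⟨a, rfl⟩
      rw [Measure.map_apply_of_aemeasurable hf measurableSet_Ioi,
        Measure.map_apply_of_aemeasurable hg measurableSet_Ioi]
      exact h a
  rw [← lintegral_map' hΦ.aemeasurable hf, ← lintegral_map' hΦ.aemeasurable hg, hmap]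

theorem nullMeasurableSet_superlevel {f : α → ℝ≥0∞} (hf : AEMeasurable f μ) (a : ℝ≥0∞) :
    NullMeasurableSet {x | a < f x} μ :=
  hf.nullMeasurableSet_preimage measurableSet_Ioi

instance : IsProbabilityMeasure unitMeasure := ⟨by simp⟩

theorem Equimeasurable.comp_measurePreserving {τ : β → α} (hτ : MeasurePreserving τ ν μ)
    {w : α → ℝ≥0∞} (hw : AEMeasurable w μ) : Equimeasurable ν μ (fun x => w (τ x)) w := fun a =>
  hτ.measure_preimage (nullMeasurableSet_superlevel hw a)

/-- The norm of the representation space is the norm of the composition with any measure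
preserving map onto the interval. -/
theorem RISpace.hatNorm_eq (X : RISpace μ) {τ : α → ℝ} (hτ : MeasurePreserving τ μ unitMeasure)
    {w : ℝ → ℝ≥0∞} (hw : AEMeasurable w unitMeasure) :
    X.hatNorm w = X.norm (fun x => w (τ x)) := by
  have hwτ : AEMeasurable (fun x => w (τ x)) μ :=
    hw.comp_quasiMeasurePreserving hτ.quasiMeasurePreserving
  have he := Equimeasurable.comp_measurePreserving hτ hw
  refine le_antisymm ?_ ?_
  · refine iSup₂_le fun f hf => ?_
    exact (X.norm_eq_of_equimeasurable _ _ hf.1 hwτ fun a => (hf.2 a).trans (he a).symm).le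
  · exact le_iSup₂_of_le (fun x => w (τ x)) ⟨hwτ, he⟩ le_rfl

/-- The decreasing rearrangement. -/
noncomputable def rearr (μ : Measure α) (f : α → ℝ≥0∞) (s : ℝ) : ℝ≥0∞ :=
  sInf {a | μ {x | a < f x} ≤ ENNReal.ofReal s}

/-- Right continuity of the distribution function: the superlevel set at a is the increasing union
of those at levels decreasing to a. Everything about the rearrangement follows from this
equivalence. -/
theorem lt_rearr_iff {f : α → ℝ≥0∞} {s : ℝ} {a : ℝ≥0∞} :
    a < rearr μ f s ↔ ENNReal.ofReal s < μ {x | a < f x} := by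
  constructor
  · intro h
    by_contra! hc
    exact absurd h (not_lt.2 (sInf_le hc))
  · intro h
    have ha : a ≠ ⊤ := by
      rintro rfl
      simp at h
    obtain ⟨u, hu, hua, hut⟩ := exists_seq_strictAnti_tendsto' (lt_top_iff_ne_top.2 ha)
    have hU : {x | a < f x} = ⋃ k, {x | u k < f x} := by
      ext x
      simp only [mem_ofPred_eq, mem_iUnion]
      exact ⟨fun hx => (hut.eventually (gt_mem_nhds hx)).exists,
        fun ⟨k, hk⟩ => (hua k).1.trans hk⟩
    have hmono : Monotone fun k => {x | u k < f x} := fun i j hij x hx =>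
      (hu.antitone hij).trans_lt hx
    rw [hU, hmono.measure_iUnion] at h
    obtain ⟨k, hk⟩ := lt_iSup_iff.1 h
    refine (hua k).1.trans_le (le_sInf fun c hc => ?_)
    by_contra! hck
    have : μ {x | u k < f x} ≤ μ {x | c < f x} := measure_mono fun x hx => hck.trans hx
    exact absurd hk (not_lt.2 (this.trans hc))

theorem rearr_antitone (f : α → ℝ≥0∞) : Antitone (rearr μ f) := fun s t hst => by
  refine le_of_forall_lt fun a ha => ?_
  rw [lt_rearr_iff] at ha ⊢
  exact (ENNReal.ofReal_le_ofReal hst).trans_lt ha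

theorem measurable_rearr (f : α → ℝ≥0∞) : Measurable (rearr μ f) := (rearr_antitone f).measurable

/-- On (0, L] the superlevel set of the rearrangement is the interval (0, m), with m the value of
the distribution function. General L is needed to place pieces supported on small sets in dyadic
intervals. -/
theorem volume_Ioc_inter_lt_rearr (f : α → ℝ≥0∞) {L : ℝ} (hL : 0 ≤ L) (a : ℝ≥0∞)
    (ha : μ {x | a < f x} ≤ ENNReal.ofReal L) :
    volume (Ioc 0 L ∩ {s | a < rearr μ f s}) = μ {x | a < f x} := by
  have hne : μ {x | a < f x} ≠ ⊤ := ne_top_of_le_ne_top ENNReal.ofReal_ne_top ha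
  have hm := ENNReal.toReal_le_of_le_ofReal hL ha
  set m := (μ {x | a < f x}).toReal with hmdef
  have hmm : μ {x | a < f x} = ENNReal.ofReal m := (ENNReal.ofReal_toReal hne).symm
  have h0 : 0 ≤ m := ENNReal.toReal_nonneg
  have : Ioc 0 L ∩ {s | a < rearr μ f s} = Ioo 0 m := by
    ext s
    simp only [mem_inter_iff, mem_Ioc, mem_ofPred_eq, mem_Ioo, lt_rearr_iff, hmm]
    constructor
    · rintro ⟨⟨h1, -⟩, h2⟩
      exact ⟨h1, (ENNReal.ofReal_lt_ofReal_iff_of_nonneg h1.le).1 h2⟩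
    · rintro ⟨h1, h2⟩
      exact ⟨⟨h1, h2.le.trans hm⟩, (ENNReal.ofReal_lt_ofReal_iff_of_nonneg h1.le).2 h2⟩
  rw [this, Real.volume_Ioo, hmm, sub_zero]

theorem equimeasurable_rearr [IsProbabilityMeasure μ] (f : α → ℝ≥0∞) :
    Equimeasurable unitMeasure μ (rearr μ f) f := fun a => by
  have h := volume_Ioc_inter_lt_rearr (μ := μ) f zero_le_one a (by simpa using prob_le_one)
  rw [← h, Measure.restrict_apply' measurableSet_Ioo, inter_comm]
  exact measure_congr (Ioo_ae_eq_Ioc.inter (ae_eq_refl _))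

theorem rearr_le_of_measure_le {f : α → ℝ≥0∞} {s : ℝ} {a : ℝ≥0∞}
    (h : μ {x | a < f x} ≤ ENNReal.ofReal s) : rearr μ f s ≤ a := sInf_le h

theorem measure_rearr_lt_le (f : α → ℝ≥0∞) (s : ℝ) :
    μ {x | rearr μ f s < f x} ≤ ENNReal.ofReal s := by
  by_contra! hc
  exact lt_irrefl _ (lt_rearr_iff.2 hc)

/-- Continuity from above along levels increasing to the rearrangement, each of whose superlevel
sets has measure above s. The hypothesis on s serves the case of value 0, where no such levels
exist. -/
theorem le_measure_rearr_le [IsFiniteMeasure μ] {f : α → ℝ≥0∞} (hf : AEMeasurable f μ) {s : ℝ}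
    (hs : ENNReal.ofReal s ≤ μ univ) :
    ENNReal.ofReal s ≤ μ {x | rearr μ f s ≤ f x} := by
  rcases eq_or_ne (rearr μ f s) 0 with h0 | h0
  · simpa [h0] using hs
  obtain ⟨u, hu, hua, hut⟩ := exists_seq_strictMono_tendsto' (pos_iff_ne_zero.2 h0)
  have hU : {x | rearr μ f s ≤ f x} = ⋂ k, {x | u k < f x} := by
    ext x
    simp only [mem_ofPred_eq, mem_iInter]
    exact ⟨fun hx k => (hua k).2.trans_le hx, fun hk => le_of_tendsto' hut fun k => (hk k).le⟩
  have hanti : Antitone fun k => {x | u k < f x} := fun i j hij x hx =>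
      (hu.monotone hij).trans_lt hx
  rw [hU, hanti.measure_iInter (fun k => nullMeasurableSet_superlevel hf _)
    ⟨0, measure_ne_top _ _⟩]
  exact le_iInf fun k => (lt_rearr_iff.1 (hua k).2).le

end Equimeasurable

/-! ### Measure preserving maps onto (0,1). -/

section Transform

/-- An atomless probability measure on the line is mapped to the uniform distribution by its
distribution function. -/
theorem measurePreserving_cdf (ν : Measure ℝ) [IsProbabilityMeasure ν] [NullSingletonClass ν] :
    MeasurePreserving (ProbabilityTheory.cdf ν) ν unitMeasure := by
  set F := ProbabilityTheory.cdf ν with hF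
  have hmono : Monotone F := ProbabilityTheory.monotone_cdf ν
  have hmeas : Measurable F := hmono.measurable
  have hcont : Continuous F := by
    refine continuous_iff_continuousAt.2 fun x => hmono.continuousAt_iff_leftLim_eq_rightLim.2 ?_
    have h0 : F.measure {x} = 0 := by
      rw [hF, ProbabilityTheory.measure_cdf]
      exact measure_singleton x
    rw [StieltjesFunction.measure_singleton, ENNReal.ofReal_eq_zero, sub_nonpos] at h0
    rw [F.rightLim_eq]
    exact le_antisymm (hmono.leftLim_le le_rfl) h0
  -- Continuity makes every value attained. With F c = u, the set {F < u} lies in (-∞, c], which has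
  -- measure u, and (-∞, c] lies in {F ≤ u}; letting u decrease to t gives the exact measure.
  have hlow : ∀ t ∈ Ioo (0 : ℝ) 1, ∃ c, F c = t := by
    intro t ht
    have h0 := ProbabilityTheory.tendsto_cdf_atBot ν
    have h1 := ProbabilityTheory.tendsto_cdf_atTop ν
    obtain ⟨a, ha⟩ := (h0.eventually (gt_mem_nhds ht.1)).exists
    obtain ⟨b, hb⟩ := (h1.eventually (lt_mem_nhds ht.2)).exists
    exact mem_range_of_exists_le_of_exists_ge hcont ⟨a, ha.le⟩ ⟨b, hb.le⟩
  have hIic : ∀ c, ν (Iic c) = ENNReal.ofReal (F c) := fun c => by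
    rw [hF, ProbabilityTheory.ofReal_cdf]
  refine ⟨hmeas, ?_⟩
  have := Measure.isProbabilityMeasure_map (μ := ν) hmeas.aemeasurable
  refine Measure.ext_of_Iic _ _ fun t => ?_
  rw [Measure.map_apply hmeas measurableSet_Iic, Measure.restrict_apply' measurableSet_Ioo]
  rcases le_or_gt 1 t with h1 | h1
  · rw [show F ⁻¹' Iic t = univ from eq_univ_of_forall fun x =>
      (ProbabilityTheory.cdf_le_one ν x).trans h1, measure_univ, inter_eq_right.2]
    · simp
    · exact fun x hx => hx.2.le.trans h1
  have hlt : ∀ u ∈ Ioo (0 : ℝ) 1, ν (F ⁻¹' Iio u) ≤ ENNReal.ofReal u := by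
    intro u hu
    obtain ⟨c, hc⟩ := hlow u hu
    rw [← hc, ← hIic]
    exact measure_mono fun x hx => (hmono.reflect_lt hx).le
  have hle : ν (F ⁻¹' Iic t) ≤ ENNReal.ofReal t := by
    rcases lt_or_ge t 0 with h0 | h0
    · rw [show F ⁻¹' Iic t = ∅ from eq_empty_of_forall_notMem fun x hx =>
        absurd (h0.trans_le (ProbabilityTheory.cdf_nonneg ν x)) (not_lt.2 hx)]
      simp
    have ht : Tendsto (fun u => ENNReal.ofReal u) (𝓝[>] t) (𝓝 (ENNReal.ofReal t)) :=
      (ENNReal.continuous_ofReal.tendsto t).mono_left nhdsWithin_le_nhds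
    refine ge_of_tendsto ht ?_
    filter_upwards [Ioo_mem_nhdsGT h1] with u hu
    exact (measure_mono fun x hx => lt_of_le_of_lt hx hu.1).trans (hlt u ⟨h0.trans_lt hu.1, hu.2⟩)
  have hv : volume (Iic t ∩ Ioo 0 1) = ENNReal.ofReal t := by
    rw [show Iic t ∩ Ioo 0 1 = Ioc 0 t by
      ext x; simp only [mem_inter_iff, mem_Iic, mem_Ioo, mem_Ioc]; grind]
    simp
  rw [hv]
  refine le_antisymm hle ?_
  rcases le_or_gt t 0 with h0 | h0
  · simp [ENNReal.ofReal_of_nonpos h0]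
  · obtain ⟨c, hc⟩ := hlow t ⟨h0, h1⟩
    rw [← hc, ← hIic]
    exact measure_mono fun x hx => hmono hx

/-- Hyperplanes are null, so the law of one coordinate has no atoms, and its distribution function
makes it uniform. Composition with this map realizes the representation norm on Ω itself. -/
theorem exists_measurePreserving_unitMeasure {n : ℕ} (hn : 0 < n) {Ω : Set (E n)}
    (hΩ : volume Ω = 1) : ∃ τ : E n → ℝ, MeasurePreserving τ (volume.restrict Ω) unitMeasure := by
  have : IsProbabilityMeasure (volume.restrict Ω) := ⟨by simpa using hΩ⟩
  let i : Fin n := ⟨0, hn⟩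
  have hm : Measurable fun x : E n => x i := (EuclideanSpace.proj i : E n →L[ℝ] ℝ).measurable
  let ν : Measure ℝ := (volume.restrict Ω).map fun x : E n => x i
  have : IsProbabilityMeasure ν := Measure.isProbabilityMeasure_map hm.aemeasurable
  have : NullSingletonClass ν := ⟨fun c => by
    rw [Measure.map_apply hm (measurableSet_singleton c)]
    refine le_antisymm ((Measure.restrict_apply_le _ _).trans ?_) zero_le
    have h0 : volume (Function.eval i ⁻¹' {c} : Set (Fin n → ℝ)) = 0 :=
      Measure.pi_hyperplane (fun _ => (volume : Measure ℝ)) i c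
    rw [← (PiLp.volume_preserving_ofLp (Fin n)).measure_preimage
      ((measurable_pi_apply i) (measurableSet_singleton c)).nullMeasurableSet] at h0
    exact h0.le⟩
  exact ⟨_, (measurePreserving_cdf ν).comp (hm.measurePreserving _)⟩

end Transform


/-! ### Gluing functions along dyadic intervals. -/

section Dyadic

/-- The length `2^{-(j+1)}` of the `j`-th dyadic interval. -/
noncomputable def dyadLen (j : ℕ) : ℝ := (1 / 2) ^ (j + 1)

/-- The dyadic interval `(2^{-(j+1)}, 2^{-j}]`. -/
def dyadIoc (j : ℕ) : Set ℝ := Ioc (dyadLen j) (dyadLen j + dyadLen j)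

theorem dyadLen_pos (j : ℕ) : 0 < dyadLen j := by unfold dyadLen; positivity

theorem dyadLen_add_self (j : ℕ) : dyadLen j + dyadLen j = (1 / 2) ^ j := by
  unfold dyadLen; ring

theorem dyadLen_antitone : Antitone dyadLen := fun i j hij =>
  pow_le_pow_of_le_one (by norm_num) (by norm_num) (by lia)

theorem dyadLen_le_half (j : ℕ) : dyadLen j ≤ 1 / 2 := by
  simpa [dyadLen] using dyadLen_antitone (Nat.zero_le j)

theorem dyadIoc_eq_of_mem {s : ℝ} {i j : ℕ} (hi : s ∈ dyadIoc i) (hj : s ∈ dyadIoc j) : i = j := by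
  have key : ∀ {i j : ℕ}, s ∈ dyadIoc i → s ∈ dyadIoc j → ¬ i < j := by
    intro i j hi hj hij
    have h1 : s ≤ (1 / 2) ^ j := dyadLen_add_self j ▸ hj.2
    have h2 : (1 / 2 : ℝ) ^ j ≤ (1 / 2) ^ (i + 1) :=
      pow_le_pow_of_le_one (by norm_num) (by norm_num) hij
    exact absurd hi.1 (not_lt.2 (h1.trans h2))
  exact le_antisymm (not_lt.1 (key hj hi)) (not_lt.1 (key hi hj))

theorem exists_mem_dyadIoc {s : ℝ} (hs : s ∈ Ioc (0 : ℝ) 1) : ∃ j, s ∈ dyadIoc j := by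
  obtain ⟨j, h1, h2⟩ := exists_nat_pow_near_of_lt_one hs.1 hs.2 (by norm_num : (0 : ℝ) < 1 / 2)
    (by norm_num)
  exact ⟨j, h1, (dyadLen_add_self j).symm ▸ h2⟩

theorem dyadIoc_subset (j : ℕ) : dyadIoc j ⊆ Ioc (0 : ℝ) 1 := fun s hs =>
  ⟨(dyadLen_pos j).trans hs.1, hs.2.trans (by linarith [dyadLen_le_half j])⟩

/-- The function equal to `w j` on the `j`-th dyadic interval. -/
noncomputable def dyadGlue (w : ℕ → ℝ → ℝ≥0∞) (s : ℝ) : ℝ≥0∞ :=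
  ∑' j, (dyadIoc j).indicator (w j) s

theorem dyadGlue_of_mem (w : ℕ → ℝ → ℝ≥0∞) {s : ℝ} {j : ℕ} (hs : s ∈ dyadIoc j) :
    dyadGlue w s = w j s := by
  rw [dyadGlue, tsum_eq_single j, indicator_of_mem hs]
  exact fun i hi => indicator_of_notMem (fun h => hi (dyadIoc_eq_of_mem h hs)) _

theorem dyadGlue_of_notMem (w : ℕ → ℝ → ℝ≥0∞) {s : ℝ} (hs : ∀ j, s ∉ dyadIoc j) :
    dyadGlue w s = 0 := by
  simp [dyadGlue, hs]

theorem measurable_dyadGlue {w : ℕ → ℝ → ℝ≥0∞} (hw : ∀ j, Measurable (w j)) :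
    Measurable (dyadGlue w) :=
  Measurable.tsum fun j => (hw j).indicator measurableSet_Ioc

theorem unitMeasure_lt_dyadGlue {w : ℕ → ℝ → ℝ≥0∞} (hw : ∀ j, Measurable (w j)) (a : ℝ≥0∞) :
    unitMeasure {s | a < dyadGlue w s} = ∑' j, volume (dyadIoc j ∩ {s | a < w j s}) := by
  rw [Measure.restrict_apply' measurableSet_Ioo,
    measure_congr ((ae_eq_refl {s | a < dyadGlue w s}).inter Ioo_ae_eq_Ioc), ← measure_iUnion]
  · congr 1
    ext s
    simp only [mem_inter_iff, mem_iUnion, mem_ofPred_eq]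
    constructor
    · rintro ⟨h1, h2⟩
      obtain ⟨j, hj⟩ := exists_mem_dyadIoc h2
      exact ⟨j, hj, by rwa [dyadGlue_of_mem w hj] at h1⟩
    · rintro ⟨j, hj, h1⟩
      exact ⟨by rwa [dyadGlue_of_mem w hj], dyadIoc_subset j hj⟩
  · exact fun i j hij => Set.disjoint_left.2 fun s hi hj => hij (dyadIoc_eq_of_mem hi.1 hj.1)
  · exact fun j => measurableSet_Ioc.inter (measurableSet_lt measurable_const (hw j))

end Dyadic

/-! ### Cyclic shifts of a decreasing function. -/

section Periodize

/-- The periodic extension of the restriction of `r` to `(0, L]`. -/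
noncomputable def periodize (L : ℝ) (r : ℝ → ℝ≥0∞) (s : ℝ) : ℝ≥0∞ := r (s - (⌈s / L⌉ - 1) * L)

variable {L : ℝ} {r : ℝ → ℝ≥0∞}

theorem periodize_periodic (hL : 0 < L) : Function.Periodic (periodize L r) L := fun s => by
  have : ⌈(s + L) / L⌉ = ⌈s / L⌉ + 1 := by
    rw [add_div, div_self hL.ne']
    exact Int.ceil_add_one _
  simp only [periodize, this]
  congr 1
  push_cast
  ring

theorem periodize_of_mem (hL : 0 < L) {s : ℝ} (hs : s ∈ Ioc 0 L) : periodize L r s = r s := by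
  have : ⌈s / L⌉ = 1 := by
    rw [Int.ceil_eq_iff]
    simp only [Int.cast_one, sub_self]
    exact ⟨div_pos hs.1 hL, (div_le_one hL).2 hs.2⟩
  simp [periodize, this]

theorem measurable_periodize (hr : Measurable r) : Measurable (periodize L r) := by
  refine hr.comp (measurable_id.sub (Measurable.mul_const (Measurable.sub_const ?_ 1) L))
  have h1 : Measurable fun s : ℝ => ⌈s / L⌉ := Int.measurable_ceil.comp (measurable_id.div_const L)
  exact (measurable_of_countable (fun k : ℤ => (k : ℝ))).comp h1

/-- Any half-open interval of length L is a fundamental domain for translation by L, so neither the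
shift nor the change of interval alters the distribution. The interval (L, 2L] is the shape of
`dyadIoc`. -/
theorem volume_lt_periodize_shift (hL : 0 < L) (hr : Measurable r) (a : ℝ≥0∞) (c : ℝ) :
    volume (Ioc L (L + L) ∩ {s | a < periodize L r (s + c)})
      = volume (Ioc 0 L ∩ {s | a < r s}) := by
  have h1 : Ioc L (L + L) ∩ {s | a < periodize L r (s + c)}
      = (fun s => s + c) ⁻¹' ({s | a < periodize L r s} ∩ Ioc (L + c) (L + c + L)) := by
    ext s
    simp only [mem_inter_iff, mem_Ioc, mem_ofPred_eq, mem_preimage]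
    constructor
    · rintro ⟨⟨h1, h2⟩, h3⟩; exact ⟨h3, by linarith, by linarith⟩
    · rintro ⟨h3, h1, h2⟩; exact ⟨⟨by linarith, by linarith⟩, h3⟩
  have h2 : Ioc 0 L ∩ {s | a < r s} = {s | a < periodize L r s} ∩ Ioc 0 (0 + L) := by
    ext s
    simp only [mem_inter_iff, mem_ofPred_eq, zero_add]
    constructor
    · rintro ⟨h1, h2⟩; exact ⟨by rwa [periodize_of_mem hL h1], h1⟩
    · rintro ⟨h1, h2⟩; exact ⟨h2, by rwa [periodize_of_mem hL h2] at h1⟩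
  rw [h1, h2, measure_preimage_add_right]
  have : VAddInvariantMeasure (AddSubgroup.zmultiples L) ℝ volume :=
    ⟨fun c s _ => measure_preimage_add _ _ _⟩
  refine (isAddFundamentalDomain_Ioc hL (L + c)).measure_set_eq (isAddFundamentalDomain_Ioc hL 0)
    (measurableSet_lt measurable_const (measurable_periodize hr)) fun g => ?_
  ext s
  simp only [mem_preimage, mem_ofPred_eq, (periodize_periodic hL).map_vadd_zmultiples g s]

/-- On each cell a decreasing function is at most its value at the left endpoint. The first cell is
left out, since its left endpoint is 0, where r is not controlled. -/
theorem setLIntegral_Ioc_le_sum (hr : Antitone r) (δ : ℝ) (m : ℕ) :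
    ∫⁻ s in Ioc δ ((m + 1) * δ), r s
      ≤ ENNReal.ofReal δ * ∑ i ∈ Finset.range m, r ((i + 1) * δ) := by
  induction m with
  | zero => simp
  | succ m ih =>
    rw [Finset.sum_range_succ, mul_add]
    have hsub : Ioc δ ((((m + 1 : ℕ) : ℝ) + 1) * δ)
        ⊆ Ioc δ ((m + 1) * δ) ∪ Ioc ((m + 1) * δ) ((m + 1) * δ + δ) := by
      intro s hs
      simp only [mem_union, mem_Ioc] at hs ⊢
      push_cast at hs
      rcases le_or_gt s ((m + 1) * δ) with h | h
      · exact Or.inl ⟨hs.1, h⟩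
      · exact Or.inr ⟨h, by linarith [hs.2]⟩
    refine (lintegral_mono_set hsub).trans ((lintegral_union_le _ _ _).trans (add_le_add ih ?_))
    calc ∫⁻ s in Ioc ((m + 1) * δ) ((m + 1) * δ + δ), r s
        ≤ ∫⁻ _ in Ioc ((m + 1) * δ) ((m + 1) * δ + δ), r ((m + 1) * δ) :=
          setLIntegral_mono' measurableSet_Ioc fun s hs => hr hs.1.le
      _ = ENNReal.ofReal δ * r ((m + 1) * δ) := by
          rw [setLIntegral_const, Real.volume_Ioc, mul_comm]
          simp

/-- The average over the cyclic shifts of a decreasing function dominates, up to the first cell,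
its mean value. -/
theorem setLIntegral_le_sum_periodize (hL : 0 < L) (hr : Antitone r) (m : ℕ) (s : ℝ) :
    ∫⁻ u in Ioc (L / (m + 1)) L, r u ≤ ENNReal.ofReal (L / (m + 1)) *
      ∑ i ∈ Finset.range (m + 1), periodize L r (s + i * (L / (m + 1))) := by
  set δ := L / (m + 1) with hδ
  have hm : (0 : ℝ) < m + 1 := by positivity
  have hδ0 : 0 < δ := div_pos hL hm
  have hLδ : (m + 1) * δ = L := by rw [hδ]; field_simp
  -- A shift by one cell permutes the summands cyclically, so s may be taken in (0, δ]. Then s + iδ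
  -- ≤ (i+1)δ stays in (0, L], and monotonicity compares the sum with the left endpoint values; one
  -- of the m + 1 summands is spare.
  have hper : Function.Periodic
      (fun s => ∑ i ∈ Finset.range (m + 1), periodize L r (s + i * δ)) δ := by
    intro s
    simp only
    rw [Finset.sum_range_succ, Finset.sum_range_succ' (fun i => periodize L r (s + i * δ))]
    have h1 : s + δ + m * δ = s + L := by rw [← hLδ]; ring
    rw [h1, periodize_periodic hL s]
    congr 1
    · refine Finset.sum_congr rfl fun i _ => ?_
      congr 1
      push_cast
      ring
    · simp
  obtain ⟨y, hy, hsy⟩ := hper.exists_mem_Ioc hδ0 s 0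
  rw [hsy, ← hLδ]
  refine (setLIntegral_Ioc_le_sum hr δ m).trans (mul_le_mul_right ?_ _)
  refine (Finset.sum_le_sum_of_subset (Finset.range_subset_range.2 m.le_succ)).trans
    (Finset.sum_le_sum fun i hi => ?_)
  rw [zero_add] at hy
  have him : (i : ℝ) + 1 ≤ m + 1 := by
    have := Finset.mem_range.1 hi
    exact_mod_cast this
  have hle : y + i * δ ≤ (i + 1) * δ := by linarith [hy.2]
  have hmem : y + i * δ ∈ Ioc 0 L := by
    refine ⟨by have := hy.1; positivity, hle.trans ?_⟩
    rw [← hLδ]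
    gcongr
  rw [hLδ, periodize_of_mem hL hmem]
  exact hr hle

end Periodize

/-! ### Averaging does not increase an r.i. norm. -/

section Majorization

variable {α : Type*} [MeasurableSpace α] {μ : Measure α} [IsProbabilityMeasure μ]

theorem lintegral_le_setLIntegral_rearr {f : α → ℝ≥0∞} (hf : AEMeasurable f μ) {L : ℝ}
    (hL : μ {x | 0 < f x} ≤ ENNReal.ofReal L) :
    ∫⁻ x, f x ∂μ ≤ ∫⁻ s in Ioc 0 L, rearr μ f s := by
  have h := (equimeasurable_rearr (μ := μ) f).lintegral_comp_eq
    (measurable_rearr f).aemeasurable hf measurable_id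
  simp only [id] at h
  rw [← h, ← lintegral_indicator measurableSet_Ioo, ← lintegral_indicator measurableSet_Ioc]
  refine lintegral_mono fun s => ?_
  by_cases hs : s ∈ Ioo (0 : ℝ) 1
  · rcases le_or_gt s L with hsL | hsL
    · rw [indicator_of_mem hs, indicator_of_mem (show s ∈ Ioc 0 L from ⟨hs.1, hsL⟩)]
    · have : rearr μ f s ≤ 0 := rearr_le_of_measure_le (hL.trans (ENNReal.ofReal_le_ofReal hsL.le))
      rw [indicator_of_mem hs]
      exact this.trans zero_le
  · simp [indicator_of_notMem hs]

/-- Averages of `h` over disjoint sets `D j`, spread over dyadic intervals, are majorized by `h`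
in every rearrangement invariant norm. -/
theorem RISpace.norm_dyadGlue_average_le (X : RISpace μ) {τ : α → ℝ}
    (hτ : MeasurePreserving τ μ unitMeasure) {h : α → ℝ≥0∞} (hh : AEMeasurable h μ)
    {D : ℕ → Set α} (hD : ∀ j, NullMeasurableSet (D j) μ) (hdisj : Pairwise (Function.onFun Disjoint D))
    (hDL : ∀ j, μ (D j) ≤ ENNReal.ofReal (dyadLen j)) :
    X.norm (fun x => dyadGlue (fun j _ => ENNReal.ofReal (1 / dyadLen j) * ∫⁻ y in D j, h y ∂μ)
      (τ x)) ≤ X.norm h := by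
  let r : ℕ → ℝ → ℝ≥0∞ := fun j => rearr μ ((D j).indicator h)
  have hr : ∀ j, Measurable (r j) := fun j => measurable_rearr _
  have hra : ∀ j, Antitone (r j) := fun j => rearr_antitone _
  have hpos : ∀ j a, μ {x | a < (D j).indicator h x} ≤ ENNReal.ofReal (dyadLen j) := fun j a =>
    (measure_mono fun x hx => by
      by_contra hc
      simp [indicator_of_notMem hc] at hx).trans (hDL j)
  have hhD : ∀ j, AEMeasurable ((D j).indicator h) μ := fun j => hh.indicator₀ (hD j)
  let H : α → ℝ≥0∞ := (⋃ j, D j).indicator h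
  have hH : AEMeasurable H μ := hh.indicator₀ (NullMeasurableSet.iUnion hD)
  have hHlevel : ∀ a, μ {x | a < H x} = ∑' j, μ {x | a < (D j).indicator h x} := by
    intro a
    rw [← measure_iUnion₀]
    · congr 1
      ext x
      simp only [mem_ofPred_eq, mem_iUnion, H]
      by_cases hx : ∃ j, x ∈ D j
      · obtain ⟨j, hj⟩ := hx
        rw [indicator_of_mem (mem_iUnion.2 ⟨j, hj⟩)]
        constructor
        · exact fun ha => ⟨j, by rwa [indicator_of_mem hj]⟩
        · rintro ⟨k, hk⟩
          exact hk.trans_le (indicator_le_self _ _ _)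
      · simp only [not_exists] at hx
        simp [hx]
    · intro i j hij
      refine Disjoint.aedisjoint (Set.disjoint_left.2 fun x hi hj => ?_)
      have hmem : ∀ k, x ∈ {x | a < (D k).indicator h x} → x ∈ D k := fun k hk => by
        by_contra hc
        simp [indicator_of_notMem hc] at hk
      exact Set.disjoint_left.1 (hdisj hij) (hmem _ hi) (hmem _ hj)
    · exact fun j => nullMeasurableSet_superlevel (hhD j) a
  -- On each dyadic interval the rearrangement of the j-th piece is rotated by the fraction i/(m+1)
  -- of the length. All these functions are equimeasurable with `H`, so they share its norm.
  let v : ℕ → ℕ → ℝ → ℝ≥0∞ := fun m i =>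
    dyadGlue fun j s => periodize (dyadLen j) (r j) (s + i * (dyadLen j / (m + 1)))
  have hwm : ∀ (m i j : ℕ), Measurable fun s : ℝ =>
      periodize (dyadLen j) (r j) (s + i * (dyadLen j / (m + 1))) := fun m i j =>
    (measurable_periodize (hr j)).comp (measurable_id.add_const _)
  have hvm : ∀ m i, Measurable (v m i) := fun m i => measurable_dyadGlue (hwm m i)
  have hvτ : ∀ m i, AEMeasurable (fun x => v m i (τ x)) μ := fun m i =>
    ((hvm m i).comp hτ.measurable).aemeasurable
  have hvnorm : ∀ m i, X.norm (fun x => v m i (τ x)) = X.norm H := by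
    intro m i
    refine X.norm_eq_of_equimeasurable _ _ (hvτ m i) hH fun a => ?_
    rw [Equimeasurable.comp_measurePreserving hτ (hvm m i).aemeasurable a, hHlevel,
      unitMeasure_lt_dyadGlue (hwm m i)]
    refine tsum_congr fun j => ?_
    rw [← volume_Ioc_inter_lt_rearr _ (dyadLen_pos j).le a (hpos j a)]
    exact volume_lt_periodize_shift (dyadLen_pos j) (hr j) a _
  -- The dyadic averages without the first cell (0, L/(m+1)]. They are bounded by the mean of the m
  -- + 1 rotations and increase to at least the required averages, so the Fatou property finishes.
  let g : ℕ → ℝ → ℝ≥0∞ := fun m => dyadGlue fun j _ =>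
    ENNReal.ofReal (1 / dyadLen j) * ∫⁻ u in Ioc (dyadLen j / (m + 1)) (dyadLen j), r j u
  have hgm : ∀ m, Measurable (g m) := fun m => measurable_dyadGlue fun j => measurable_const
  have hgτ : ∀ m, AEMeasurable (fun x => g m (τ x)) μ := fun m =>
    ((hgm m).comp hτ.measurable).aemeasurable
  have hgle : ∀ m s, g m s ≤ ((m + 1 : ℝ≥0)⁻¹ : ℝ≥0) * ∑ i ∈ Finset.range (m + 1), v m i s := by
    intro m s
    by_cases hs : ∃ j, s ∈ dyadIoc j
    · obtain ⟨j, hj⟩ := hs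
      simp only [g, v, dyadGlue_of_mem _ hj]
      have hL := dyadLen_pos j
      have h1 := setLIntegral_le_sum_periodize hL (hra j) m s
      refine (mul_le_mul_right h1 _).trans_eq ?_
      rw [← mul_assoc, ← ENNReal.ofReal_mul (by positivity)]
      congr 1
      rw [show 1 / dyadLen j * (dyadLen j / (m + 1)) = ((m : ℝ) + 1)⁻¹ by field_simp,
        ENNReal.ofReal]
      congr 1
      ext
      simp only [Real.coe_toNNReal', NNReal.coe_inv, NNReal.coe_add, NNReal.coe_natCast,
        NNReal.coe_one]
      exact max_eq_left (by positivity)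
    · push Not at hs
      simp [g, dyadGlue_of_notMem _ hs]
  have hgnorm : ∀ m, X.norm (fun x => g m (τ x)) ≤ X.norm h := by
    intro m
    have hsm : AEMeasurable (fun x => ∑ i ∈ Finset.range (m + 1), v m i (τ x)) μ :=
      Finset.aemeasurable_fun_sum _ fun i _ => hvτ m i
    calc X.norm (fun x => g m (τ x))
        ≤ X.norm (fun x => ((m + 1 : ℝ≥0)⁻¹ : ℝ≥0) * ∑ i ∈ Finset.range (m + 1), v m i (τ x)) :=
          X.norm_mono _ _ (hgτ m) (hsm.const_mul _) (Eventually.of_forall fun x => hgle m (τ x))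
      _ = ((m + 1 : ℝ≥0)⁻¹ : ℝ≥0) * X.norm (fun x => ∑ i ∈ Finset.range (m + 1), v m i (τ x)) :=
          X.norm_const_mul _ _ hsm
      _ ≤ ((m + 1 : ℝ≥0)⁻¹ : ℝ≥0) * ∑ i ∈ Finset.range (m + 1), X.norm (fun x => v m i (τ x)) :=
          mul_le_mul_right (X.norm_sum_le _ (hvτ m)) _
      _ = X.norm H := by
          simp only [hvnorm, Finset.sum_const, Finset.card_range, nsmul_eq_mul]
          rw [← mul_assoc]
          have : (((m + 1 : ℝ≥0)⁻¹ : ℝ≥0) : ℝ≥0∞) * ((m + 1 : ℕ) : ℝ≥0∞) = 1 := by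
            have h0 : (m + 1 : ℝ≥0) ≠ 0 := by positivity
            rw [← ENNReal.coe_natCast, ← ENNReal.coe_mul, Nat.cast_add, Nat.cast_one,
              inv_mul_cancel₀ h0, ENNReal.coe_one]
          rw [this, one_mul]
      _ ≤ X.norm h := X.norm_mono _ _ hH hh (Eventually.of_forall fun x => indicator_le_self _ _ _)
  have hmono : ∀ s, Monotone fun m => g m s := by
    intro s m m' hmm
    by_cases hs : ∃ j, s ∈ dyadIoc j
    · obtain ⟨j, hj⟩ := hs
      simp only [g, dyadGlue_of_mem _ hj]
      have hL := dyadLen_pos j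
      gcongr
    · push Not at hs
      simp [g, dyadGlue_of_notMem _ hs]
  have hsup : ∀ s, dyadGlue (fun j _ => ENNReal.ofReal (1 / dyadLen j) * ∫⁻ y in D j, h y ∂μ) s
      ≤ ⨆ m, g m s := by
    intro s
    by_cases hs : ∃ j, s ∈ dyadIoc j
    · obtain ⟨j, hj⟩ := hs
      simp only [g, dyadGlue_of_mem _ hj]
      rw [← ENNReal.mul_iSup]
      refine mul_le_mul_right ?_ _
      have hL := dyadLen_pos j
      rw [← lintegral_indicator₀ (hD j)]
      refine (lintegral_le_setLIntegral_rearr (hhD j) (hpos j 0)).trans ?_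
      have hU : Ioc 0 (dyadLen j) ⊆ ⋃ m : ℕ, Ioc (dyadLen j / (m + 1)) (dyadLen j) := by
        intro u hu
        obtain ⟨m, hm⟩ := exists_nat_gt (dyadLen j / u)
        refine mem_iUnion.2 ⟨m, ?_, hu.2⟩
        rw [div_lt_iff₀ hu.1] at hm
        rw [div_lt_iff₀ (by positivity)]
        nlinarith [hu.1]
      refine (lintegral_mono_set hU).trans ?_
      rw [setLIntegral_iUnion_of_directed]
      refine Monotone.directed_le fun m m' hmm => Ioc_subset_Ioc_left ?_
      gcongr
    · push Not at hs
      simp [dyadGlue_of_notMem _ hs]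
  calc _ ≤ X.norm (fun x => ⨆ m, g m (τ x)) :=
        X.norm_mono _ _
          ((measurable_dyadGlue fun j => measurable_const).comp hτ.measurable).aemeasurable
          (AEMeasurable.iSup hgτ) (Eventually.of_forall fun x => hsup (τ x))
    _ = ⨆ m, X.norm (fun x => g m (τ x)) :=
        X.norm_iSup _ hgτ (Eventually.of_forall fun x => hmono (τ x))
    _ ≤ X.norm h := iSup_le hgnorm

end Majorization


/-! ### A C¹ truncation. -/

section Truncation

/-- The derivative of a `C¹` truncation of `|x|` between the levels `a` and `b`. -/
noncomputable def truncDeriv (a b x : ℝ) : ℝ :=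
  max 0 ((x - a) * (b - x)) - max 0 ((-x - a) * (b - -x))

/-- A `C¹` truncation of `|x|` between the levels `a` and `b`. -/
noncomputable def trunc (a b x : ℝ) : ℝ := ∫ u in (0 : ℝ)..x, truncDeriv a b u

variable {a b : ℝ}

theorem continuous_truncDeriv : Continuous (truncDeriv a b) := by
  unfold truncDeriv; fun_prop

theorem hasDerivAt_trunc (x : ℝ) : HasDerivAt (trunc a b) (truncDeriv a b x) x :=
  intervalIntegral.integral_hasDerivAt_right (continuous_truncDeriv.intervalIntegrable _ _)
    (continuous_truncDeriv.stronglyMeasurableAtFilter _ _) continuous_truncDeriv.continuousAt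

theorem truncDeriv_neg (x : ℝ) : truncDeriv a b (-x) = - truncDeriv a b x := by
  unfold truncDeriv
  rw [neg_neg]
  ring

theorem trunc_neg (x : ℝ) : trunc a b (-x) = trunc a b x := by
  have h := intervalIntegral.integral_comp_neg (a := 0) (b := x) (truncDeriv a b)
  simp only [truncDeriv_neg, intervalIntegral.integral_neg, neg_zero] at h
  rw [trunc, trunc, intervalIntegral.integral_symm, ← h, neg_neg]

theorem truncDeriv_of_nonneg (ha : 0 ≤ a) (hab : a ≤ b) {x : ℝ} (hx : 0 ≤ x) :
    truncDeriv a b x = max 0 ((x - a) * (b - x)) := by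
  rw [truncDeriv, max_eq_left (a := (0 : ℝ)) (b := (-x - a) * (b - -x)), sub_zero]
  nlinarith

theorem truncDeriv_eq_zero (ha : 0 ≤ a) (hab : a ≤ b) {x : ℝ} (hx : |x| ≤ a ∨ b ≤ |x|) :
    truncDeriv a b x = 0 := by
  have key : ∀ y : ℝ, 0 ≤ y → (y ≤ a ∨ b ≤ y) → truncDeriv a b y = 0 := by
    intro y hy h
    rw [truncDeriv_of_nonneg ha hab hy, max_eq_left]
    rcases h with h | h <;> nlinarith
  rcases le_total 0 x with h0 | h0
  · rw [abs_of_nonneg h0] at hx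
    exact key x h0 hx
  · rw [abs_of_nonpos h0] at hx
    have := key (-x) (by linarith) hx
    rwa [truncDeriv_neg, neg_eq_zero] at this

theorem abs_truncDeriv_le (ha : 0 ≤ a) (hab : a ≤ b) (x : ℝ) :
    |truncDeriv a b x| ≤ (b - a) ^ 2 / 4 := by
  have key : ∀ y : ℝ, 0 ≤ y → |truncDeriv a b y| ≤ (b - a) ^ 2 / 4 := by
    intro y hy
    rw [truncDeriv_of_nonneg ha hab hy, abs_of_nonneg (le_max_left _ _)]
    exact max_le (by positivity) (by nlinarith [sq_nonneg (2 * y - a - b)])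
  rcases le_total 0 x with h0 | h0
  · exact key x h0
  · have := key (-x) (by linarith)
    rwa [truncDeriv_neg, abs_neg] at this

theorem trunc_abs (x : ℝ) : trunc a b |x| = trunc a b x := by
  rcases abs_choice x with h | h <;> rw [h]
  exact trunc_neg x

theorem trunc_eq_zero (ha : 0 ≤ a) (hab : a ≤ b) {x : ℝ} (hx : |x| ≤ a) : trunc a b x = 0 := by
  rw [← trunc_abs, trunc]
  refine intervalIntegral.integral_zero_ae (Eventually.of_forall fun u hu => ?_)
  rw [uIoc_of_le (abs_nonneg x)] at hu
  exact truncDeriv_eq_zero ha hab (Or.inl (by rw [abs_of_pos hu.1]; exact hu.2.trans hx))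

/-- The plateau height is the integral of (u - a)(b - u) over [a, b]; it is compared below with the
maximal slope (b - a)²/4. -/
theorem trunc_eq_of_le (ha : 0 ≤ a) (hab : a ≤ b) {x : ℝ} (hx : b ≤ |x|) :
    trunc a b x = (b - a) ^ 3 / 6 := by
  have hi : ∀ s t, IntervalIntegrable (truncDeriv a b) volume s t := fun s t =>
    continuous_truncDeriv.intervalIntegrable _ _
  rw [← trunc_abs, trunc, ← intervalIntegral.integral_add_adjacent_intervals (hi 0 a) (hi a |x|),
    ← intervalIntegral.integral_add_adjacent_intervals (hi a b) (hi b |x|)]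
  have h1 : ∫ u in (0 : ℝ)..a, truncDeriv a b u = 0 := by
    have := trunc_eq_zero ha hab (x := a) (abs_of_nonneg ha).le
    exact this
  have h3 : ∫ u in b..|x|, truncDeriv a b u = 0 := by
    refine intervalIntegral.integral_zero_ae (Eventually.of_forall fun u hu => ?_)
    rw [uIoc_of_le hx] at hu
    exact truncDeriv_eq_zero ha hab (Or.inr (hu.1.le.trans (le_abs_self u)))
  have h2 : ∫ u in a..b, truncDeriv a b u = (b - a) ^ 3 / 6 := by
    have e : ∫ u in a..b, truncDeriv a b u = ∫ u in a..b, (u - a) * (b - u) := by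
      refine intervalIntegral.integral_congr fun u hu => ?_
      rw [uIcc_of_le hab] at hu
      rw [truncDeriv_of_nonneg ha hab (ha.trans hu.1), max_eq_right]
      exact mul_nonneg (sub_nonneg.2 hu.1) (sub_nonneg.2 hu.2)
    rw [e, intervalIntegral.integral_eq_sub_of_hasDerivAt
      (f := fun u => -u ^ 3 / 3 + (a + b) * u ^ 2 / 2 - a * b * u)]
    · ring
    · intro u _
      have := (((hasDerivAt_pow 3 u).neg.div_const 3).add
        (((hasDerivAt_pow 2 u).const_mul (a + b)).div_const 2)).sub
          ((hasDerivAt_id u).const_mul (a * b))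
      refine HasDerivAt.congr_deriv this ?_
      push_cast
      ring
    · exact Continuous.intervalIntegrable (by fun_prop) _ _
  rw [h1, h2, h3]
  ring

theorem exists_abs_trunc_le (ha : 0 ≤ a) (hab : a ≤ b) : ∃ M, ∀ x, |trunc a b x| ≤ M := by
  have hc : Continuous (trunc a b) :=
    continuous_iff_continuousAt.2 fun x => (hasDerivAt_trunc x).continuousAt
  obtain ⟨M, hM⟩ := (isCompact_Icc (a := -b) (b := b)).exists_bound_of_continuousOn hc.continuousOn
  refine ⟨max M |(b - a) ^ 3 / 6|, fun x => ?_⟩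
  rcases le_total b |x| with h | h
  · rw [trunc_eq_of_le ha hab h]
    exact le_max_right _ _
  · exact (hM x (abs_le.1 h)).trans (le_max_left _ _)

end Truncation

/-! ### Gaps between levels. -/

section LevelSets

variable {n : ℕ} {Ω : Set (E n)} {f : E n → ℝ} {G : E n → E n}

/-- The Sobolev-Poincaré inequality, applied to a truncation, bounds the gap between two levels. -/
theorem level_gap_le (hΩ : IsUnitDomain Ω) {p : ℝ} (hp : 1 ≤ p) {C : ℝ≥0}
    (hC : ∀ f G, MemW11 Ω f G →
      (∫⁻ x in Ω, ‖f x - ⨍ y in Ω, f y‖ₑ ^ p) ^ (1 / p) ≤ C * ∫⁻ x in Ω, ‖G x‖ₑ)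
    (h : MemW11 Ω f G) (c : ℝ) {a b : ℝ} (ha : 0 ≤ a) (hab : a < b) {κ : ℝ≥0∞}
    (h1 : κ ≤ volume.restrict Ω {x | |f x - c| ≤ a}) (h2 : κ ≤ volume.restrict Ω {x | b ≤ |f x - c|}) :
    ENNReal.ofReal (b - a) * κ ^ (1 / p)
      ≤ 3 * C * ∫⁻ x in {x | a < |f x - c| ∧ |f x - c| < b}, ‖G x‖ₑ ∂(volume.restrict Ω) := by
  set μ := volume.restrict Ω with hμ
  have hp0 : 0 < p := zero_lt_one.trans_le hp
  obtain ⟨M, hM⟩ := exists_abs_trunc_le ha hab.le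
  have hW : MemW11 Ω (fun x => trunc a b (f x - c)) (fun x => truncDeriv a b (f x - c) • G x) := by
    refine h.comp hΩ.isOpen (by simp [hΩ.volume_eq_one]) (ψ := fun y => trunc a b (y - c))
      (θ := fun y => truncDeriv a b (y - c)) (M := max M ((b - a) ^ 2 / 4))
      (fun y => (hasDerivAt_trunc (y - c)).comp_sub_const y c)
      (continuous_truncDeriv.comp (continuous_id.sub continuous_const))
      (fun y => (hM _).trans (le_max_left _ _))
      (fun y => (abs_truncDeriv_le ha hab.le _).trans (le_max_right _ _))
  have hP := hC _ _ hW
  set m := ⨍ y in Ω, trunc a b (f y - c) with hm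
  set T := (b - a) ^ 3 / 6 with hT
  have hba : 0 < b - a := sub_pos.2 hab
  have hT0 : 0 < T := by positivity
  have hlow : ENNReal.ofReal (T / 2) * κ ^ (1 / p)
      ≤ (∫⁻ x, ‖trunc a b (f x - c) - m‖ₑ ^ p ∂μ) ^ (1 / p) := by
    -- The truncation is 0 on one of the two sets and T on the other, so its mean m is at distance
    -- at least T/2 from one of these values. Chebyshev's inequality then applies on that set.
    have hsub : κ ≤ μ {x | ENNReal.ofReal (T / 2) ^ p ≤ ‖trunc a b (f x - c) - m‖ₑ ^ p} := by
      rcases le_total (T / 2) |m| with hmT | hmT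
      · refine h1.trans (measure_mono fun x hx => ?_)
        refine ENNReal.rpow_le_rpow ?_ hp0.le
        rw [trunc_eq_zero ha hab.le hx, zero_sub, enorm_neg, ← ofReal_norm, Real.norm_eq_abs]
        exact ENNReal.ofReal_le_ofReal hmT
      · refine h2.trans (measure_mono fun x hx => ?_)
        refine ENNReal.rpow_le_rpow ?_ hp0.le
        rw [trunc_eq_of_le ha hab.le hx, ← ofReal_norm, Real.norm_eq_abs]
        refine ENNReal.ofReal_le_ofReal ?_
        rw [← hT]
        have := le_abs_self (T - m)
        have := le_abs_self m
        linarith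
    have hmeas : AEMeasurable (fun x => ‖trunc a b (f x - c) - m‖ₑ ^ p) μ :=
      ((hW.integrable.aestronglyMeasurable.aemeasurable.sub_const m).enorm).pow_const p
    have hmk := mul_meas_ge_le_lintegral₀ hmeas (ENNReal.ofReal (T / 2) ^ p)
    have h3 := (mul_le_mul_right hsub _).trans hmk
    have h4 := ENNReal.rpow_le_rpow h3 (by positivity : 0 ≤ 1 / p)
    rwa [ENNReal.mul_rpow_of_nonneg _ _ (by positivity), ← ENNReal.rpow_mul,
      mul_one_div_cancel hp0.ne', ENNReal.rpow_one] at h4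
  have hup : ∫⁻ x in Ω, ‖truncDeriv a b (f x - c) • G x‖ₑ
      ≤ ENNReal.ofReal ((b - a) ^ 2 / 4)
        * ∫⁻ x in {x | a < |f x - c| ∧ |f x - c| < b}, ‖G x‖ₑ ∂μ := by
    have hv : AEMeasurable (fun x => |f x - c|) μ :=
      (h.integrable.aestronglyMeasurable.aemeasurable.sub_const c).norm
    have hD : NullMeasurableSet {x | a < |f x - c| ∧ |f x - c| < b} μ :=
      hv.nullMeasurableSet_preimage measurableSet_Ioo
    rw [← lintegral_indicator₀ hD, ← lintegral_const_mul' _ _ ENNReal.ofReal_ne_top]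
    refine lintegral_mono fun x => ?_
    by_cases hx : x ∈ {x | a < |f x - c| ∧ |f x - c| < b}
    · rw [indicator_of_mem hx, enorm_smul]
      refine mul_le_mul_left ?_ _
      rw [← ofReal_norm, Real.norm_eq_abs]
      exact ENNReal.ofReal_le_ofReal (abs_truncDeriv_le ha hab.le _)
    · have h0 : truncDeriv a b (f x - c) = 0 := by
        refine truncDeriv_eq_zero ha hab.le ?_
        by_contra! hc
        exact hx hc
      simp [h0]
  have hfin := (hlow.trans hP).trans (mul_le_mul_right hup _)
  set I := ∫⁻ x in {x | a < |f x - c| ∧ |f x - c| < b}, ‖G x‖ₑ ∂μ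
  -- In units of (b - a)²/12, the half height is b - a and the maximal slope is 3. Cancelling the
  -- unit produces the constant 3.
  have e1 : ENNReal.ofReal (T / 2)
      = ENNReal.ofReal ((b - a) ^ 2 / 12) * ENNReal.ofReal (b - a) := by
    rw [← ENNReal.ofReal_mul (by positivity)]
    congr 1
    rw [hT]; ring
  have e2 : ENNReal.ofReal ((b - a) ^ 2 / 4) = ENNReal.ofReal ((b - a) ^ 2 / 12) * 3 := by
    rw [← ENNReal.ofReal_ofNat 3, ← ENNReal.ofReal_mul (by positivity)]
    congr 1
    ring
  rw [e1, e2] at hfin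
  have hk0 : ENNReal.ofReal ((b - a) ^ 2 / 12) ≠ 0 := by
    rw [Ne, ENNReal.ofReal_eq_zero, not_le]
    positivity
  refine (ENNReal.mul_le_mul_iff_right hk0 ENNReal.ofReal_ne_top).1 ?_
  calc _ = _ := by ring
    _ ≤ _ := hfin
    _ = _ := by ring

end LevelSets

/-! ### The Hardy operator on nonnegative functions. -/

section Hardy

/-- A Bochner integral is 0 by default when it diverges, so integrability must be checked: for s > 0
the kernel is at most 1/s on (s, 1]. -/
theorem enorm_hardy_eq {p : ℝ} (hp : 1 ≤ p) {w : ℝ → ℝ≥0∞} (hw : Measurable w)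
    (hwt : ∀ s, w s ≠ ⊤) (hint : ∫⁻ s, w s ∂unitMeasure ≠ ⊤) {s : ℝ} (hs : s ∈ Ioo (0 : ℝ) 1) :
    ‖∫ u in s..1, u ^ (1 - 1 / p) * (w u).toReal / u‖ₑ
      = ∫⁻ u in Ioc s 1, ENNReal.ofReal (u ^ (1 - 1 / p) / u) * w u := by
  have hp0 : 0 < p := zero_lt_one.trans_le hp
  have he : ∀ u ∈ Ioc s 1, ENNReal.ofReal (u ^ (1 - 1 / p) * (w u).toReal / u)
      = ENNReal.ofReal (u ^ (1 - 1 / p) / u) * w u := by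
    intro u hu
    have hu0 : 0 < u := hs.1.trans hu.1
    rw [mul_div_right_comm, ENNReal.ofReal_mul (by positivity), ENNReal.ofReal_toReal (hwt u)]
  have hnn : 0 ≤ᵐ[volume.restrict (Ioc s 1)] fun u => u ^ (1 - 1 / p) * (w u).toReal / u := by
    filter_upwards [ae_restrict_mem measurableSet_Ioc] with u hu
    have hu0 : 0 < u := hs.1.trans hu.1
    simp only [Pi.zero_apply]
    positivity
  have hmeas : AEStronglyMeasurable (fun u => u ^ (1 - 1 / p) * (w u).toReal / u)
      (volume.restrict (Ioc s 1)) :=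
    (((measurable_id.pow_const _).mul hw.ennreal_toReal).div measurable_id).aestronglyMeasurable
  have hlt : ∫⁻ u in Ioc s 1, ENNReal.ofReal (u ^ (1 - 1 / p) * (w u).toReal / u) ≠ ⊤ := by
    refine ne_top_of_le_ne_top (ENNReal.mul_ne_top (ENNReal.ofReal_ne_top (r := 1 / s)) hint) ?_
    have hI : ∫⁻ u, w u ∂unitMeasure = ∫⁻ u in Ioc 0 1, w u :=
      setLIntegral_congr Ioo_ae_eq_Ioc
    rw [hI]
    refine le_trans ?_ (mul_le_mul_right (lintegral_mono_set (Ioc_subset_Ioc_left hs.1.le)) _)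
    rw [← lintegral_const_mul' _ _ ENNReal.ofReal_ne_top]
    refine setLIntegral_mono' measurableSet_Ioc fun u hu => ?_
    rw [he u hu]
    refine mul_le_mul_left (ENNReal.ofReal_le_ofReal ?_) _
    have hu0 : 0 < u := hs.1.trans hu.1
    have h1 : u ^ (1 - 1 / p) ≤ 1 := by
      refine Real.rpow_le_one hu0.le hu.2 ?_
      rw [sub_nonneg]
      exact (div_le_one hp0).2 hp
    exact div_le_div₀ zero_le_one h1 hs.1 hu.1.le
  rw [intervalIntegral.integral_of_le hs.2.le, integral_eq_lintegral_of_nonneg_ae hnn hmeas,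
    ← ofReal_norm, Real.norm_of_nonneg ENNReal.toReal_nonneg, ENNReal.ofReal_toReal hlt]
  exact setLIntegral_congr_fun measurableSet_Ioc he

theorem measurable_hardy (p : ℝ) (w : ℝ → ℝ≥0∞) :
    Measurable fun s => ∫⁻ u in Ioc s 1, ENNReal.ofReal (u ^ (1 - 1 / p) / u) * w u :=
  Antitone.measurable fun _ _ hst => lintegral_mono_set (Ioc_subset_Ioc_left hst)

theorem HardyBounded.norm_le {α : Type*} [MeasurableSpace α] {μ : Measure α} {X Y : RISpace μ}
    {p : ℝ} (hp : 1 ≤ p) {c : ℝ≥0} {τ : α → ℝ} (hτ : MeasurePreserving τ μ unitMeasure)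
    (hc : ∀ g : ℝ → ℝ, AEMeasurable g unitMeasure → X.hatNorm (fun u => ‖g u‖ₑ) < ⊤ →
      Y.hatNorm (fun t => ‖∫ u in t..1, u ^ (1 - 1 / p) * g u / u‖ₑ)
        ≤ c * X.hatNorm (fun u => ‖g u‖ₑ))
    {w : ℝ → ℝ≥0∞} (hw : Measurable w) (hwt : ∀ s, w s ≠ ⊤)
    (hint : ∫⁻ s, w s ∂unitMeasure ≠ ⊤) (hX : X.norm (fun x => w (τ x)) < ⊤) :
    Y.norm (fun x => ∫⁻ u in Ioc (τ x) 1, ENNReal.ofReal (u ^ (1 - 1 / p) / u) * w u)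
      ≤ c * X.norm (fun x => w (τ x)) := by
  have hg : (fun u => ‖(w u).toReal‖ₑ) = w := by
    ext u
    rw [← ofReal_norm, Real.norm_of_nonneg ENNReal.toReal_nonneg, ENNReal.ofReal_toReal (hwt u)]
  have hae : (fun t => ‖∫ u in t..1, u ^ (1 - 1 / p) * (w u).toReal / u‖ₑ) =ᵐ[unitMeasure]
      fun s => ∫⁻ u in Ioc s 1, ENNReal.ofReal (u ^ (1 - 1 / p) / u) * w u := by
    filter_upwards [ae_restrict_mem measurableSet_Ioo] with s hs
    exact enorm_hardy_eq hp hw hwt hint hs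
  have hm := (measurable_hardy p w).aemeasurable (μ := unitMeasure)
  have h := hc (fun u => (w u).toReal) hw.ennreal_toReal.aemeasurable
  rw [hg, X.hatNorm_eq hτ hw.aemeasurable, Y.hatNorm_eq hτ (hm.congr hae.symm)] at h
  have hY := Y.norm_congr ((measurable_hardy p w).comp hτ.measurable).aemeasurable
    (hτ.quasiMeasurePreserving.ae_eq_comp hae).symm
  exact hY.trans_le (h hX)

end Hardy


/-! ### From the Hardy inequality to the Sobolev–Poincaré inequality. -/

section Symmetrization

variable {n : ℕ} {Ω : Set (E n)} {f : E n → ℝ} {G : E n → E n}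

/-- The kernel u^{-1/p} is smallest at the right endpoint, and the step function has integral `d j`
over the interval. -/
theorem setLIntegral_dyadIoc_kernel_ge {p : ℝ} (hp : 1 ≤ p) (d : ℕ → ℝ≥0∞) (j : ℕ) :
    ENNReal.ofReal ((dyadLen j + dyadLen j) ^ (-(1 / p))) * d j
      ≤ ∫⁻ u in dyadIoc j, ENNReal.ofReal (u ^ (1 - 1 / p) / u)
        * dyadGlue (fun j _ => ENNReal.ofReal (1 / dyadLen j) * d j) u := by
  have hL := dyadLen_pos j
  calc _ = ∫⁻ _ in dyadIoc j, ENNReal.ofReal ((dyadLen j + dyadLen j) ^ (-(1 / p)))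
        * (ENNReal.ofReal (1 / dyadLen j) * d j) := by
        rw [setLIntegral_const, dyadIoc, Real.volume_Ioc, add_sub_cancel_right, mul_assoc, mul_assoc,
          mul_comm (d j), ← mul_assoc (ENNReal.ofReal (1 / dyadLen j)),
          ← ENNReal.ofReal_mul (by positivity), one_div_mul_cancel hL.ne', ENNReal.ofReal_one,
          one_mul]
    _ ≤ _ := by
        refine setLIntegral_mono' measurableSet_Ioc fun u hu => ?_
        rw [dyadGlue_of_mem _ hu]
        refine mul_le_mul_left (ENNReal.ofReal_le_ofReal ?_) _
        have hu0 : 0 < u := hL.trans hu.1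
        have : u ^ (1 - 1 / p) / u = u ^ (-(1 / p)) := by
          rw [← Real.rpow_sub_one hu0.ne']
          congr 1
          ring
        rw [this]
        exact Real.rpow_le_rpow_of_nonpos hu0 hu.2 (by
          rw [neg_nonpos]
          positivity)

/-- `level_gap_le` with κ the length of the next dyadic interval: the lower set has measure at least
1/2, the upper one at least κ. As κ is a quarter of `dyadLen j + dyadLen j` and 4^{1/p} ≤ 4, the
constant is 3 · 4. -/
theorem level_succ_le (hΩ : IsUnitDomain Ω) {p : ℝ} (hp : 1 ≤ p) {C : ℝ≥0}
    (hC : ∀ f G, MemW11 Ω f G →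
      (∫⁻ x in Ω, ‖f x - ⨍ y in Ω, f y‖ₑ ^ p) ^ (1 / p) ≤ C * ∫⁻ x in Ω, ‖G x‖ₑ)
    (h : MemW11 Ω f G) (c : ℝ) {t : ℕ → ℝ} (ht0 : ∀ j, 0 ≤ t j)
    (ht1 : ∀ j, volume.restrict Ω {x | t j < |f x - c|} ≤ ENNReal.ofReal (dyadLen j))
    (ht2 : ∀ j, ENNReal.ofReal (dyadLen j) ≤ volume.restrict Ω {x | t j ≤ |f x - c|}) (j : ℕ) :
    ENNReal.ofReal (t (j + 1) - t j) ≤ 12 * C *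
      (ENNReal.ofReal ((dyadLen j + dyadLen j) ^ (-(1 / p))) *
        ∫⁻ x in {x | t j < |f x - c| ∧ |f x - c| < t (j + 1)}, ‖G x‖ₑ ∂(volume.restrict Ω)) := by
  rcases le_or_gt (t (j + 1)) (t j) with hle | hlt
  · simp [ENNReal.ofReal_of_nonpos (sub_nonpos.2 hle)]
  have hprob : IsProbabilityMeasure (volume.restrict Ω) := ⟨by simpa using hΩ.volume_eq_one⟩
  have hv : AEMeasurable (fun x => |f x - c|) (volume.restrict Ω) :=
    (h.integrable.aestronglyMeasurable.aemeasurable.sub_const c).norm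
  have hp0 : 0 < p := zero_lt_one.trans_le hp
  have hκ : ENNReal.ofReal (dyadLen (j + 1)) ≤ volume.restrict Ω {x | |f x - c| ≤ t j} := by
    have hnull : NullMeasurableSet {x | t j < |f x - c|} (volume.restrict Ω) :=
      hv.nullMeasurableSet_preimage measurableSet_Ioi
    have hcompl := prob_compl_eq_one_sub₀ hnull
    have hset : {x | t j < |f x - c|}ᶜ = {x | |f x - c| ≤ t j} := by
      ext x
      simp
    rw [← hset, hcompl]
    have h1 := (ht1 j).trans (ENNReal.ofReal_le_ofReal (dyadLen_le_half j))
    refine le_trans ?_ (tsub_le_tsub_left h1 1)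
    rw [← ENNReal.ofReal_one, ← ENNReal.ofReal_sub _ (by norm_num)]
    refine ENNReal.ofReal_le_ofReal ?_
    linarith [dyadLen_le_half (j + 1)]
  have key := level_gap_le hΩ hp hC h c (ht0 j) hlt hκ (ht2 (j + 1))
  set I := ∫⁻ x in {x | t j < |f x - c| ∧ |f x - c| < t (j + 1)}, ‖G x‖ₑ ∂(volume.restrict Ω)
  have hL := dyadLen_pos j
  set l := dyadLen j + dyadLen j with hl
  have hl0 : 0 < l := by positivity
  have hl4 : dyadLen (j + 1) = l / 4 := by
    rw [hl]; unfold dyadLen; ring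
  have hone : 1 ≤ ENNReal.ofReal (dyadLen (j + 1)) ^ (1 / p)
      * ENNReal.ofReal (4 * l ^ (-(1 / p))) := by
    rw [hl4, ENNReal.ofReal_rpow_of_pos (by positivity), ← ENNReal.ofReal_mul (by positivity),
      ← ENNReal.ofReal_one]
    refine ENNReal.ofReal_le_ofReal ?_
    rw [Real.div_rpow hl0.le (by norm_num), Real.rpow_neg hl0.le]
    have h4 : (4 : ℝ) ^ (1 / p) ≤ 4 := by
      calc (4 : ℝ) ^ (1 / p) ≤ 4 ^ (1 : ℝ) :=
            Real.rpow_le_rpow_of_exponent_le (by norm_num) ((div_le_one hp0).2 hp)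
        _ = 4 := Real.rpow_one 4
    have h5 : 0 < (4 : ℝ) ^ (1 / p) := by positivity
    have h6 : 0 < l ^ (1 / p) := by positivity
    rw [show l ^ (1 / p) / 4 ^ (1 / p) * (4 * (l ^ (1 / p))⁻¹) = 4 / 4 ^ (1 / p) by field_simp]
    exact (one_le_div h5).2 h4
  calc ENNReal.ofReal (t (j + 1) - t j)
      ≤ ENNReal.ofReal (t (j + 1) - t j) * (ENNReal.ofReal (dyadLen (j + 1)) ^ (1 / p)
          * ENNReal.ofReal (4 * l ^ (-(1 / p)))) := le_mul_of_one_le_right' hone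
    _ = (ENNReal.ofReal (t (j + 1) - t j) * ENNReal.ofReal (dyadLen (j + 1)) ^ (1 / p))
          * ENNReal.ofReal (4 * l ^ (-(1 / p))) := by ring
    _ ≤ (3 * C * I) * ENNReal.ofReal (4 * l ^ (-(1 / p))) := mul_le_mul_left key _
    _ = _ := by
        rw [ENNReal.ofReal_mul (by norm_num), ENNReal.ofReal_ofNat]
        ring

/-- Chebyshev's inequality at the level of the rearrangement; it makes the dyadic levels finite and
bounds the first of them. -/
theorem rearr_mul_le_lintegral {α : Type*} [MeasurableSpace α] {μ : Measure α}
    [IsProbabilityMeasure μ] {v : α → ℝ≥0∞} (hv : AEMeasurable v μ) {s : ℝ} (hs : s ≤ 1) :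
    rearr μ v s * ENNReal.ofReal s ≤ ∫⁻ x, v x ∂μ := by
  have h1 : ENNReal.ofReal s ≤ μ univ := by
    rw [measure_univ]
    exact ENNReal.ofReal_le_one.2 hs
  exact (mul_le_mul_right (le_measure_rearr_le hv h1) _).trans (mul_meas_ge_le_lintegral₀ hv _)

theorem le_add_sum_of_succ_le {a b : ℕ → ℝ≥0∞} (h : ∀ j, a (j + 1) ≤ a j + b j) (k : ℕ) :
    a k ≤ a 0 + ∑ j ∈ Finset.range k, b j := by
  induction k with
  | zero => simp
  | succ k ih =>
    rw [Finset.sum_range_succ, ← add_assoc]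
    exact (h k).trans (add_le_add_left ih _)

/-- If the Hardy operator is bounded from `X̂` to `Ŷ`, then the Sobolev-Poincaré inequality in
`L^p` self-improves to the one between `X` and `Y`. -/
theorem sobolevPoincareRI_of_hardyBounded (hn : 0 < n) {p : ℝ} (hp : 1 ≤ p) (hΩ : IsUnitDomain Ω)
    (hP : SobolevPoincare Ω p) (X Y : RISpace (volume.restrict Ω)) (hH : HardyBounded p X Y) :
    SobolevPoincareRI Ω X Y := by
  obtain ⟨C, hC⟩ := hP
  obtain ⟨τ, hτ⟩ := exists_measurePreserving_unitMeasure hn hΩ.volume_eq_one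
  revert X Y
  set μ := volume.restrict Ω with hμ
  rintro X Y ⟨cH, hcH⟩
  have hprob : IsProbabilityMeasure μ := ⟨by simpa [hμ] using hΩ.volume_eq_one⟩
  obtain ⟨CX, hCX⟩ := X.setLIntegral_le univ MeasurableSet.univ (measure_lt_top _ _)
  simp only [Measure.restrict_univ] at hCX
  have hY1 : Y.norm (fun _ => 1) ≠ ⊤ := by
    have := Y.norm_indicator_lt_top univ MeasurableSet.univ (measure_lt_top _ _)
    rw [indicator_univ] at this
    exact this.ne
  -- The summand 1 keeps the constant nonzero, so that the bound is infinite when the norm of the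
  -- gradient is.
  refine ⟨2 * C * CX * (Y.norm fun _ => 1).toNNReal + 12 * C * cH + 1, fun f G h => ?_⟩
  have hp0 : 0 < p := zero_lt_one.trans_le hp
  have hGm : AEMeasurable (fun x => ‖G x‖ₑ) μ := h.integrable_grad.aestronglyMeasurable.enorm
  rcases eq_or_ne (X.norm fun x => ‖G x‖ₑ) ⊤ with htop | htop
  · rw [htop, ENNReal.mul_top (by simp)]
    exact le_top
  set c := ⨍ y in Ω, f y with hc
  set v : E n → ℝ≥0∞ := fun x => ‖f x - c‖ₑ with hv
  have hfm : AEStronglyMeasurable (fun x => f x - c) μ :=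
    h.integrable.aestronglyMeasurable.sub aestronglyMeasurable_const
  have hvm : AEMeasurable v μ := hfm.enorm
  have hvabs : ∀ x, v x = ENNReal.ofReal |f x - c| := fun x => by
    rw [hv, ← Real.norm_eq_abs, ofReal_norm]
  -- the integral of `v`
  have hvint : ∫⁻ x, v x ∂μ ≤ C * (CX * X.norm fun x => ‖G x‖ₑ) := by
    have h1 := eLpNorm'_le_eLpNorm'_of_exponent_le zero_lt_one hp μ hfm
    simp only [eLpNorm', ENNReal.rpow_one, div_one] at h1
    exact h1.trans ((hC f G h).trans (mul_le_mul_right (hCX _ hGm) _))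
  have hGint : ∫⁻ x, ‖G x‖ₑ ∂μ ≠ ⊤ := h.integrable_grad.2.ne
  have hvtop : ∫⁻ x, v x ∂μ ≠ ⊤ := ne_top_of_le_ne_top
    (ENNReal.mul_ne_top ENNReal.coe_ne_top (ENNReal.mul_ne_top ENNReal.coe_ne_top htop)) hvint
  have hrt : ∀ j, rearr μ v (dyadLen j) ≠ ⊤ := by
    intro j hj
    have := rearr_mul_le_lintegral hvm ((dyadLen_le_half j).trans (by norm_num))
    rw [hj, ENNReal.top_mul (by simpa using dyadLen_pos j)] at this
    exact hvtop (top_le_iff.1 this)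
  -- levels
  let t : ℕ → ℝ := fun j => (rearr μ v (dyadLen j)).toReal
  have htr : ∀ j, ENNReal.ofReal (t j) = rearr μ v (dyadLen j) := fun j =>
    ENNReal.ofReal_toReal (hrt j)
  have ht0 : ∀ j, 0 ≤ t j := fun j => ENNReal.toReal_nonneg
  have htmono : Monotone t := fun i j hij => by
    exact ENNReal.toReal_mono (hrt j) (rearr_antitone v (dyadLen_antitone hij))
  have hset1 : ∀ j, {x | t j < |f x - c|} = {x | rearr μ v (dyadLen j) < v x} := fun j => by
    ext x
    simp only [mem_ofPred_eq, hvabs, ← htr]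
    rw [ENNReal.ofReal_lt_ofReal_iff_of_nonneg (ht0 j)]
  have hset2 : ∀ j, {x | t j ≤ |f x - c|} = {x | rearr μ v (dyadLen j) ≤ v x} := fun j => by
    ext x
    simp only [mem_ofPred_eq, hvabs, ← htr]
    rw [ENNReal.ofReal_le_ofReal_iff (abs_nonneg _)]
  have ht1 : ∀ j, μ {x | t j < |f x - c|} ≤ ENNReal.ofReal (dyadLen j) := fun j => by
    rw [hset1]
    exact measure_rearr_lt_le v _
  have ht2 : ∀ j, ENNReal.ofReal (dyadLen j) ≤ μ {x | t j ≤ |f x - c|} := fun j => by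
    rw [hset2]
    refine le_measure_rearr_le hvm ?_
    rw [measure_univ]
    exact ENNReal.ofReal_le_one.2 ((dyadLen_le_half j).trans (by norm_num))
  let D : ℕ → Set (E n) := fun j => {x | t j < |f x - c| ∧ |f x - c| < t (j + 1)}
  let d : ℕ → ℝ≥0∞ := fun j => ∫⁻ x in D j, ‖G x‖ₑ ∂μ
  let w : ℝ → ℝ≥0∞ := dyadGlue fun j _ => ENNReal.ofReal (1 / dyadLen j) * d j
  have hD : ∀ j, NullMeasurableSet (D j) μ := fun j =>
    (show AEMeasurable (fun x => |f x - c|) μ from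
      hfm.aemeasurable.norm).nullMeasurableSet_preimage measurableSet_Ioo
  have hdisj : Pairwise (Function.onFun Disjoint D) := by
    have key : ∀ {i j : ℕ}, i < j → Disjoint (D i) (D j) := fun {i j} hij =>
      Set.disjoint_left.2 fun x hi hj => by
        have h1 : |f x - c| < t (i + 1) := hi.2
        have h2 : t j < |f x - c| := hj.1
        exact absurd (h1.trans_le (htmono hij)) (not_lt.2 h2.le)
    exact fun i j hij => (lt_or_gt_of_ne hij).elim key fun h => (key h).symm
  have hDL : ∀ j, μ (D j) ≤ ENNReal.ofReal (dyadLen j) := fun j =>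
    (measure_mono fun x hx => hx.1).trans (ht1 j)
  have hw : Measurable w := measurable_dyadGlue fun j => measurable_const
  have hwt : ∀ s, w s ≠ ⊤ := by
    intro s
    by_cases hs : ∃ j, s ∈ dyadIoc j
    · obtain ⟨j, hj⟩ := hs
      simp only [w, dyadGlue_of_mem _ hj]
      exact ENNReal.mul_ne_top ENNReal.ofReal_ne_top
        (ne_top_of_le_ne_top hGint (setLIntegral_le_lintegral _ _))
    · push Not at hs
      simp [w, dyadGlue_of_notMem _ hs]
  have hwX : X.norm (fun x => w (τ x)) ≤ X.norm fun x => ‖G x‖ₑ :=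
    X.norm_dyadGlue_average_le hτ hGm hD hdisj hDL
  have hwint : ∫⁻ s, w s ∂unitMeasure ≠ ⊤ := by
    rw [← hτ.lintegral_comp hw]
    exact ne_top_of_le_ne_top (ENNReal.mul_ne_top ENNReal.coe_ne_top
      (ne_top_of_le_ne_top htop hwX)) (hCX _ (hw.comp hτ.measurable).aemeasurable)
  let Φ : ℝ → ℝ≥0∞ := fun s => ∫⁻ u in Ioc s 1, ENNReal.ofReal (u ^ (1 - 1 / p) / u) * w u
  have hΦm : Measurable Φ := measurable_hardy p w
  have hΦY : Y.norm (fun x => Φ (τ x)) ≤ cH * X.norm fun x => ‖G x‖ₑ :=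
    (HardyBounded.norm_le hp hτ hcH hw hwt hwint (hwX.trans_lt (lt_top_iff_ne_top.2 htop))).trans
      (mul_le_mul_right hwX _)
  -- pointwise estimate of the rearrangement
  have hpt : ∀ s ∈ Ioo (0 : ℝ) 1,
      rearr μ v s ≤ rearr μ v (dyadLen 0) + 12 * C * Φ s := by
    intro s hs
    obtain ⟨k, hk⟩ := exists_mem_dyadIoc ⟨hs.1, hs.2.le⟩
    refine (rearr_antitone v hk.1.le).trans ?_
    have hstep : ∀ j, rearr μ v (dyadLen (j + 1)) ≤ rearr μ v (dyadLen j)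
        + 12 * C * ∫⁻ u in dyadIoc j, ENNReal.ofReal (u ^ (1 - 1 / p) / u) * w u := by
      intro j
      rw [← htr, ← htr]
      calc ENNReal.ofReal (t (j + 1))
          = ENNReal.ofReal (t j) + ENNReal.ofReal (t (j + 1) - t j) := by
            rw [← ENNReal.ofReal_add (ht0 j) (sub_nonneg.2 (htmono j.le_succ)), add_sub_cancel]
        _ ≤ _ := by
            refine add_le_add_right ((level_succ_le hΩ hp hC h c ht0 ht1 ht2 j).trans ?_) _
            exact mul_le_mul_right (setLIntegral_dyadIoc_kernel_ge hp d j) _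
    refine (le_add_sum_of_succ_le hstep k).trans (add_le_add_right ?_ _)
    -- The dyadic intervals with index j < k are disjoint and lie in (s, 1], because s ≤ 2^{-k} ≤
    -- 2^{-(j+1)}.
    rw [← Finset.mul_sum, ← lintegral_biUnion_finset]
    · refine mul_le_mul_right (lintegral_mono_set ?_) _
      refine iUnion₂_subset fun j hj u hu => ⟨?_, (dyadIoc_subset j hu).2⟩
      have hjk : j + 1 ≤ k := Finset.mem_range.1 hj
      refine lt_of_le_of_lt (hk.2.trans ?_) hu.1
      rw [dyadLen_add_self]
      exact pow_le_pow_of_le_one (by norm_num) (by norm_num) hjk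
    · exact fun i _ j _ hij => Set.disjoint_left.2 fun u hi hj => hij (dyadIoc_eq_of_mem hi hj)
    · exact fun j _ => measurableSet_Ioc
  have hst0 : rearr μ v (dyadLen 0) ≤ 2 * (C * (CX * X.norm fun x => ‖G x‖ₑ)) := by
    have h1 := rearr_mul_le_lintegral hvm (s := dyadLen 0) (by norm_num [dyadLen])
    have h2 : ENNReal.ofReal (dyadLen 0) * 2 = 1 := by
      rw [← ENNReal.ofReal_ofNat 2, ← ENNReal.ofReal_mul (dyadLen_pos 0).le, ← ENNReal.ofReal_one]
      congr 1
      norm_num [dyadLen]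
    calc rearr μ v (dyadLen 0) = rearr μ v (dyadLen 0) * ENNReal.ofReal (dyadLen 0) * 2 := by
          rw [mul_assoc, h2, mul_one]
      _ ≤ (C * (CX * X.norm fun x => ‖G x‖ₑ)) * 2 := mul_le_mul_left (h1.trans hvint) _
      _ = _ := mul_comm _ _
  have hΦτ : AEMeasurable (fun x => Φ (τ x)) μ := (hΦm.comp hτ.measurable).aemeasurable
  have hτmem : ∀ᵐ x ∂μ, τ x ∈ Ioo (0 : ℝ) 1 :=
    hτ.quasiMeasurePreserving.ae (ae_restrict_mem measurableSet_Ioo)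
  have hT : ((rearr μ v (dyadLen 0)).toNNReal : ℝ≥0∞) = rearr μ v (dyadLen 0) :=
    ENNReal.coe_toNNReal (hrt 0)
  have hrm : AEMeasurable (fun x => rearr μ v (τ x)) μ :=
    ((measurable_rearr v).comp hτ.measurable).aemeasurable
  calc Y.norm v = Y.norm (fun x => rearr μ v (τ x)) :=
        Y.norm_eq_of_equimeasurable _ _ hvm hrm fun a =>
          ((Equimeasurable.comp_measurePreserving hτ (measurable_rearr v).aemeasurable a).trans
            (equimeasurable_rearr v a)).symm
    _ ≤ Y.norm (fun x => ((rearr μ v (dyadLen 0)).toNNReal : ℝ≥0∞) * 1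
          + ((12 * C : ℝ≥0) : ℝ≥0∞) * Φ (τ x)) := by
        refine Y.norm_mono _ _ hrm (aemeasurable_const.add (hΦτ.const_mul _)) ?_
        filter_upwards [hτmem] with x hx
        rw [hT, mul_one]
        push_cast
        exact hpt _ hx
    _ ≤ Y.norm (fun _ => ((rearr μ v (dyadLen 0)).toNNReal : ℝ≥0∞) * 1)
          + Y.norm (fun x => ((12 * C : ℝ≥0) : ℝ≥0∞) * Φ (τ x)) :=
        Y.norm_add_le _ _ aemeasurable_const (hΦτ.const_mul _)
    _ = rearr μ v (dyadLen 0) * Y.norm (fun _ => 1)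
          + ((12 * C : ℝ≥0) : ℝ≥0∞) * Y.norm (fun x => Φ (τ x)) := by
        rw [Y.norm_const_mul _ (fun _ => 1) aemeasurable_const, Y.norm_const_mul _ _ hΦτ, hT]
    _ ≤ 2 * (C * (CX * X.norm fun x => ‖G x‖ₑ)) * Y.norm (fun _ => 1)
          + ((12 * C : ℝ≥0) : ℝ≥0∞) * (cH * X.norm fun x => ‖G x‖ₑ) := by gcongr
    _ ≤ 2 * (C * (CX * X.norm fun x => ‖G x‖ₑ)) * Y.norm (fun _ => 1)
          + ((12 * C : ℝ≥0) : ℝ≥0∞) * (cH * X.norm fun x => ‖G x‖ₑ)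
          + X.norm fun x => ‖G x‖ₑ := le_self_add
    _ = _ := by
        push_cast
        rw [ENNReal.coe_toNNReal hY1]
        ring

end Symmetrization


/-! ### Lebesgue spaces as r.i. spaces. -/

section LebesgueSpace

variable {α : Type*} [MeasurableSpace α] {μ : Measure α} [IsProbabilityMeasure μ]

theorem lintegral_le_rpow_lintegral_rpow {q : ℝ} (hq : 1 ≤ q) {f : α → ℝ≥0∞}
    (hf : AEMeasurable f μ) : ∫⁻ x, f x ∂μ ≤ (∫⁻ x, f x ^ q ∂μ) ^ (1 / q) := by
  rcases hq.eq_or_lt with rfl | hq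
  · simp
  have := ENNReal.lintegral_mul_le_Lp_mul_Lq μ (Real.HolderConjugate.conjExponent hq) hf
    (aemeasurable_const (b := (1 : ℝ≥0∞)))
  simpa using this

/-- The Lebesgue space `L^q` of a probability measure. -/
noncomputable def lpSpace (μ : Measure α) [IsProbabilityMeasure μ] (q : ℝ) (hq : 1 ≤ q) :
    RISpace μ where
  norm f := (∫⁻ x, f x ^ q ∂μ) ^ (1 / q)
  norm_eq_zero_iff f hf := by
    have hq0 : 0 < q := zero_lt_one.trans_le hq
    rw [ENNReal.rpow_eq_zero_iff_of_pos (by positivity), lintegral_eq_zero_iff' (hf.pow_const q)]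
    refine eventually_congr (Eventually.of_forall fun x => ?_)
    simp [ENNReal.rpow_eq_zero_iff_of_pos hq0]
  norm_const_mul c f hf := by
    have hq0 : 0 < q := zero_lt_one.trans_le hq
    simp_rw [ENNReal.mul_rpow_of_nonneg _ _ hq0.le]
    rw [lintegral_const_mul' _ _ (ENNReal.rpow_ne_top_of_nonneg hq0.le ENNReal.coe_ne_top),
      ENNReal.mul_rpow_of_nonneg _ _ (by positivity), ← ENNReal.rpow_mul,
      mul_one_div_cancel hq0.ne', ENNReal.rpow_one]
  norm_add_le f g hf hg := ENNReal.lintegral_Lp_add_le hf hg hq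
  norm_mono f g _ _ h := by
    have hq0 : 0 < q := zero_lt_one.trans_le hq
    refine ENNReal.rpow_le_rpow (lintegral_mono_ae ?_) (by positivity)
    filter_upwards [h] with x hx
    exact ENNReal.rpow_le_rpow hx hq0.le
  norm_iSup f hf hmono := by
    have hq0 : 0 < q := zero_lt_one.trans_le hq
    have hq1 : 0 < 1 / q := by positivity
    have h1 : ∀ x, (⨆ k, f k x) ^ q = ⨆ k, f k x ^ q := fun x =>
      (ENNReal.orderIsoRpow q hq0).map_iSup _
    simp_rw [h1]
    rw [lintegral_iSup' (fun k => (hf k).pow_const q)]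
    · exact (ENNReal.orderIsoRpow (1 / q) hq1).map_iSup _
    · filter_upwards [hmono] with x hx i j hij
      exact ENNReal.rpow_le_rpow (hx hij) hq0.le
  norm_indicator_lt_top s _ _ := by
    have hq0 : 0 < q := zero_lt_one.trans_le hq
    refine ENNReal.rpow_lt_top_of_nonneg (by positivity) (ne_top_of_le_ne_top ENNReal.one_ne_top ?_)
    calc ∫⁻ x, s.indicator 1 x ^ q ∂μ ≤ ∫⁻ _, 1 ∂μ := by
          refine lintegral_mono fun x => ?_
          by_cases hx : x ∈ s <;> simp [hx, hq0]
      _ = 1 := by simp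
  setLIntegral_le s _ _ := ⟨1, fun f hf => by
    rw [ENNReal.coe_one, one_mul]
    exact (setLIntegral_le_lintegral _ _).trans (lintegral_le_rpow_lintegral_rpow hq hf)⟩
  norm_eq_of_equimeasurable f g hf hg h := by
    rw [h.lintegral_comp_eq hf hg (Φ := fun y => y ^ q) (measurable_id.pow_const q)]

theorem isLp_lpSpace (q : ℝ) (hq : 1 ≤ q) : (lpSpace μ q hq).IsLp q := fun _ _ => rfl

end LebesgueSpace

/-! ### Failure of the Muckenhoupt condition and of the Hardy inequality. -/

section Failure

theorem exists_lt_rpow_of_neg {e : ℝ} (he : e < 0) (K : ℝ) :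
    ∃ a ∈ Ioo (0 : ℝ) (1 / 2), K < a ^ e := by
  have h := tendsto_rpow_atTop (neg_pos.2 he)
  obtain ⟨x, hx1, hx2⟩ := ((h.eventually_gt_atTop K).and (eventually_gt_atTop 2)).exists
  have hx0 : 0 < x := by linarith
  refine ⟨x⁻¹, ⟨inv_pos.2 hx0, ?_⟩, ?_⟩
  · rw [one_div]
    exact inv_strictAnti₀ (by norm_num) hx2
  · rwa [Real.inv_rpow hx0.le, ← Real.rpow_neg hx0.le]

/-- The Muckenhoupt-type condition fails below the critical exponent. -/
theorem not_muckenhouptCondition {b t r : ℝ} (hb : 0 < b) (ht : 1 < t)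
    (he : 1 / r + (t - 1) / t - b < 0) : ¬ MuckenhouptCondition b t r := by
  rintro ⟨K, hK⟩
  obtain ⟨a, ha, haK⟩ := exists_lt_rpow_of_neg he (2 ^ b * K)
  have ht0 : 0 < t := by linarith
  have ht1 : 0 < t - 1 := by linarith
  have h1 := hK a ⟨ha.1, by linarith [ha.2]⟩
  have h2a : 2 * a ≤ 1 := by linarith [ha.2]
  have ha0 := ha.1
  have hcont : ContinuousOn (fun u : ℝ => (u ^ (b * t)) ^ (-1 / (t - 1))) (Icc a 1) := by
    intro u hu
    have hu0 : 0 < u := ha0.trans_le hu.1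
    exact ((Real.continuousAt_rpow_const u _ (Or.inl hu0.ne')).rpow_const
      (Or.inl (by positivity))).continuousWithinAt
  have hint1 : IntervalIntegrable (fun u : ℝ => (u ^ (b * t)) ^ (-1 / (t - 1))) volume a (2 * a) :=
    (hcont.mono (Icc_subset_Icc_right h2a)).intervalIntegrable_of_Icc (by linarith)
  have hint2 : IntervalIntegrable (fun u : ℝ => (u ^ (b * t)) ^ (-1 / (t - 1))) volume (2 * a) 1 :=
    (hcont.mono (Icc_subset_Icc_left (by linarith))).intervalIntegrable_of_Icc h2a
  -- Only [a, 2a] is kept, which is why a < 1/2 was chosen. The product then scales like a to the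
  -- power 1/r + (t-1)/t - b, which is unbounded as a tends to 0.
  have hlow : a * (2 * a) ^ (-(b * t / (t - 1))) ≤ ∫ u in a..1, (u ^ (b * t)) ^ (-1 / (t - 1)) := by
    rw [← intervalIntegral.integral_add_adjacent_intervals hint1 hint2]
    have hA : a * (2 * a) ^ (-(b * t / (t - 1)))
        ≤ ∫ u in a..(2 * a), (u ^ (b * t)) ^ (-1 / (t - 1)) := by
      have hc : ∫ _u in a..(2 * a), (2 * a) ^ (-(b * t / (t - 1)))
          = a * (2 * a) ^ (-(b * t / (t - 1))) := by
        rw [intervalIntegral.integral_const, smul_eq_mul]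
        ring
      rw [← hc]
      refine intervalIntegral.integral_mono_on (by linarith) (by simp) hint1 fun u hu => ?_
      have hu0 : 0 < u := ha0.trans_le hu.1
      rw [← Real.rpow_mul hu0.le]
      have : b * t * (-1 / (t - 1)) = -(b * t / (t - 1)) := by ring
      rw [this]
      refine Real.rpow_le_rpow_of_nonpos hu0 hu.2 ?_
      rw [neg_nonpos]
      positivity
    have hB : 0 ≤ ∫ u in (2 * a)..1, (u ^ (b * t)) ^ (-1 / (t - 1)) :=
      intervalIntegral.integral_nonneg h2a fun u hu => by
        have : 0 ≤ u := by linarith [hu.1]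
        positivity
    linarith
  have hI : ∫ _u in (0 : ℝ)..a, (1 : ℝ) = a := by simp
  rw [hI] at h1
  have h3 : a ^ (1 / r) * (a * (2 * a) ^ (-(b * t / (t - 1)))) ^ ((t - 1) / t) ≤ K := by
    refine le_trans ?_ h1
    gcongr
  have h4 : a ^ (1 / r) * (a * (2 * a) ^ (-(b * t / (t - 1)))) ^ ((t - 1) / t)
      = 2 ^ (-b) * a ^ (1 / r + (t - 1) / t - b) := by
    rw [Real.mul_rpow ha0.le (by positivity), ← Real.rpow_mul (by positivity)]
    have : -(b * t / (t - 1)) * ((t - 1) / t) = -b := by field_simp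
    rw [this, Real.mul_rpow (by norm_num) ha0.le,
      show 1 / r + (t - 1) / t - b = 1 / r + (t - 1) / t + -b by ring, Real.rpow_add ha0,
      Real.rpow_add ha0]
    ring
  rw [h4, Real.rpow_neg (by norm_num), inv_mul_le_iff₀ (by positivity)] at h3
  linarith

/-- The Hardy operator is unbounded from `L^t` to `L^r` above the critical exponent. -/
theorem not_hardyBounded_of_isLp {α : Type*} [MeasurableSpace α] {μ : Measure α}
    {τ : α → ℝ} (hτ : MeasurePreserving τ μ unitMeasure) {X Y : RISpace μ} {p t r : ℝ}
    (hp : 1 ≤ p) (ht : 0 < t) (hr : 0 < r) (hX : X.IsLp t) (hY : Y.IsLp r)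
    (he : 1 + 1 / r - 1 / p - 1 / t < 0) : ¬ HardyBounded p X Y := by
  rintro ⟨c, hc⟩
  obtain ⟨a, ha, haK⟩ := exists_lt_rpow_of_neg he (2 ^ (1 + 1 / r) * c)
  have ha0 := ha.1
  have hp0 : 0 < p := zero_lt_one.trans_le hp
  let w : ℝ → ℝ≥0∞ := (Ioc 0 a).indicator 1
  have hw : Measurable w := measurable_one.indicator measurableSet_Ioc
  have hw1 : ∀ s, w s ≤ 1 := fun s => indicator_le_self _ _ _
  have hunit : ∀ b ∈ Ioo (0 : ℝ) 1, unitMeasure (Ioc 0 b) = ENNReal.ofReal b := by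
    intro b hb
    rw [Measure.restrict_apply measurableSet_Ioc, inter_eq_left.2, Real.volume_Ioc, sub_zero]
    exact fun x hx => ⟨hx.1, hx.2.trans_lt hb.2⟩
  have hint : ∫⁻ s, w s ∂unitMeasure ≠ ⊤ :=
    ne_top_of_le_ne_top ENNReal.one_ne_top ((lintegral_mono hw1).trans_eq (by simp))
  have hXw : X.norm (fun x => w (τ x)) = ENNReal.ofReal (a ^ (1 / t)) := by
    rw [hX (fun x => w (τ x)) (hw.comp hτ.measurable).aemeasurable]
    have e1 : ∫⁻ x, w (τ x) ^ t ∂μ = ∫⁻ s, w s ^ t ∂unitMeasure :=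
      hτ.lintegral_comp (hw.pow_const t)
    have e2 : (fun s => w s ^ t) = (Ioc 0 a).indicator 1 := by
      ext s
      by_cases hs : s ∈ Ioc 0 a
      · simp [w, indicator_of_mem hs]
      · simp [w, indicator_of_notMem hs, ht]
    rw [e1, e2, lintegral_indicator_one measurableSet_Ioc, hunit a ⟨ha0, by linarith [ha.2]⟩,
      ENNReal.ofReal_rpow_of_pos ha0]
  have key := HardyBounded.norm_le hp hτ hc hw
    (fun s => ne_top_of_le_ne_top ENNReal.one_ne_top (hw1 s)) hint (hXw ▸ ENNReal.ofReal_lt_top)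
  rw [hXw] at key
  set Φ : ℝ → ℝ≥0∞ := fun s => ∫⁻ u in Ioc s 1, ENNReal.ofReal (u ^ (1 - 1 / p) / u) * w u with hΦ
  have hΦm : Measurable Φ := measurable_hardy p w
  -- For s ≤ a/2 the transform of the indicator of (0, a] is at least the integral of u^{-1/p} over
  -- (a/2, a], hence at least κ.
  set κ := a / 2 * a ^ (-(1 / p)) with hκ
  have hκ0 : 0 < κ := by positivity
  have hΦlow : ∀ s ∈ Ioc 0 (a / 2), ENNReal.ofReal κ ≤ Φ s := by
    intro s hs
    calc ENNReal.ofReal κ = ∫⁻ _ in Ioc (a / 2) a, ENNReal.ofReal (a ^ (-(1 / p))) := by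
          rw [setLIntegral_const, Real.volume_Ioc, ← ENNReal.ofReal_mul (by positivity)]
          congr 1
          rw [hκ]; ring
      _ ≤ ∫⁻ u in Ioc (a / 2) a, ENNReal.ofReal (u ^ (1 - 1 / p) / u) * w u := by
          refine setLIntegral_mono' measurableSet_Ioc fun u hu => ?_
          have hu0 : 0 < u := by linarith [hu.1]
          have hwu : w u = 1 := by
            simp only [w]
            rw [indicator_of_mem (show u ∈ Ioc 0 a from ⟨hu0, hu.2⟩)]
            rfl
          rw [hwu, mul_one, ← Real.rpow_sub_one hu0.ne']
          refine ENNReal.ofReal_le_ofReal ?_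
          rw [show 1 - 1 / p - 1 = -(1 / p) by ring]
          refine Real.rpow_le_rpow_of_nonpos hu0 hu.2 ?_
          rw [neg_nonpos]
          positivity
      _ ≤ Φ s := lintegral_mono_set fun u hu => ⟨hs.2.trans_lt hu.1, by linarith [hu.2, ha.2]⟩
  have hYlow : ENNReal.ofReal (κ * (a / 2) ^ (1 / r)) ≤ Y.norm (fun x => Φ (τ x)) := by
    rw [hY (fun x => Φ (τ x)) (hΦm.comp hτ.measurable).aemeasurable]
    have e1 : ∫⁻ x, Φ (τ x) ^ r ∂μ = ∫⁻ s, Φ s ^ r ∂unitMeasure :=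
      hτ.lintegral_comp (hΦm.pow_const r)
    rw [e1]
    have e2 : ENNReal.ofReal κ ^ r * ENNReal.ofReal (a / 2) ≤ ∫⁻ s, Φ s ^ r ∂unitMeasure := by
      rw [← hunit (a / 2) ⟨by positivity, by linarith [ha.2]⟩, ← setLIntegral_const]
      refine (setLIntegral_mono' measurableSet_Ioc fun s hs => ?_).trans
        (setLIntegral_le_lintegral (Ioc 0 (a / 2)) _)
      exact ENNReal.rpow_le_rpow (hΦlow s hs) hr.le
    refine le_trans (le_of_eq ?_) (ENNReal.rpow_le_rpow e2 (by positivity : 0 ≤ 1 / r))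
    rw [ENNReal.mul_rpow_of_nonneg _ _ (by positivity), ← ENNReal.rpow_mul,
      mul_one_div_cancel hr.ne', ENNReal.rpow_one, ENNReal.ofReal_rpow_of_pos (by positivity),
      ← ENNReal.ofReal_mul hκ0.le]
  have hfin := hYlow.trans key
  rw [← ENNReal.ofReal_coe_nnreal, ← ENNReal.ofReal_mul c.coe_nonneg,
    ENNReal.ofReal_le_ofReal_iff (by positivity)] at hfin
  have e3 : κ * (a / 2) ^ (1 / r)
      = 2 ^ (-(1 + 1 / r)) * a ^ (1 + 1 / r - 1 / p - 1 / t) * a ^ (1 / t) := by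
    have e4 : a ^ (1 + 1 / r - 1 / p - 1 / t) * a ^ (1 / t) = a * a ^ (-(1 / p)) * a ^ (1 / r) := by
      rw [← Real.rpow_add ha0,
        show 1 + 1 / r - 1 / p - 1 / t + 1 / t = 1 + (-(1 / p)) + 1 / r by ring,
        Real.rpow_add ha0, Real.rpow_add ha0, Real.rpow_one]
    rw [mul_assoc ((2 : ℝ) ^ (-(1 + 1 / r))), e4, hκ, Real.div_rpow ha0.le (by norm_num), neg_add,
      Real.rpow_add (by norm_num), Real.rpow_neg_one,
      Real.rpow_neg (by norm_num : (0 : ℝ) ≤ 2)]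
    ring
  rw [e3] at hfin
  have hfin2 := le_of_mul_le_mul_right hfin (by positivity)
  rw [Real.rpow_neg (by norm_num), inv_mul_le_iff₀ (by positivity)] at hfin2
  exact absurd haK (not_lt.2 hfin2)

end Failure


/-! ### The L¹ Poincaré inequality on convex sets and balls. -/

section Poincare

variable {n : ℕ} {Ω : Set (E n)} {f : E n → ℝ} {G : E n → E n}

theorem lintegral_comp_smul_add {H : E n → ℝ≥0∞} (hH : Measurable H) {a : ℝ} (ha : a ≠ 0)
    (b : E n) : ∫⁻ x, H (a • x + b) = ENNReal.ofReal |(a ^ n)⁻¹| * ∫⁻ x, H x := by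
  have h1 : ∫⁻ x, H (a • x + b) = ∫⁻ y, H (y + b) ∂((volume : Measure (E n)).map (a • ·)) :=
    (lintegral_map (f := fun y => H (y + b)) (hH.comp (measurable_id.add_const b))
      (measurable_const_smul a)).symm
  rw [h1, Measure.map_addHaar_smul _ ha, lintegral_smul_measure, lintegral_add_right_eq_self,
    finrank_euclideanSpace_fin, smul_eq_mul]

/-- The contraction towards y maps K into itself with Jacobian (1-s)^n, which is at least 2^{-n} for
s ≤ 1/2. -/
theorem setLIntegral_comp_convexComb_le {K : Set (E n)} (hK : Convex ℝ K)
    (hKm : MeasurableSet K) {H : E n → ℝ≥0∞} (hH : Measurable H) {y : E n} (hy : y ∈ K) {s : ℝ}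
    (hs0 : 0 ≤ s) (hs : s ≤ 1 / 2) :
    ∫⁻ x in K, H ((1 - s) • x + s • y) ≤ 2 ^ n * ∫⁻ z in K, H z := by
  have h1 : 0 < 1 - s := by linarith
  calc ∫⁻ x in K, H ((1 - s) • x + s • y)
      = ∫⁻ x, K.indicator (fun x => H ((1 - s) • x + s • y)) x :=
        (lintegral_indicator hKm _).symm
    _ ≤ ∫⁻ x, K.indicator H ((1 - s) • x + s • y) := by
        refine lintegral_mono fun x => ?_
        by_cases hx : x ∈ K
        · rw [indicator_of_mem hx, indicator_of_mem (hK hx hy h1.le hs0 (by ring))]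
        · simp [indicator_of_notMem hx]
    _ = ENNReal.ofReal |((1 - s) ^ n)⁻¹| * ∫⁻ z, K.indicator H z :=
        lintegral_comp_smul_add (hH.indicator hKm) h1.ne' _
    _ ≤ 2 ^ n * ∫⁻ z in K, H z := by
        rw [lintegral_indicator hKm]
        refine mul_le_mul_left ?_ _
        rw [abs_of_pos (by positivity), ← inv_pow, ENNReal.ofReal_pow (by positivity)]
        refine pow_le_pow_left₀ zero_le ?_ n
        rw [← ENNReal.ofReal_ofNat 2]
        refine ENNReal.ofReal_le_ofReal ?_
        rw [inv_le_comm₀ h1 (by norm_num)]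
        linarith

theorem enorm_sub_le_lintegral_fderiv {u : E n → ℝ} (hu : ContDiff ℝ 1 u) (x y : E n) :
    ‖u x - u y‖ₑ ≤ ∫⁻ s in Ioc (0 : ℝ) 1, ‖fderiv ℝ u ((1 - s) • x + s • y)‖ₑ * ‖y - x‖ₑ := by
  have hd : ∀ s : ℝ, HasDerivAt (fun s : ℝ => u ((1 - s) • x + s • y))
      (fderiv ℝ u ((1 - s) • x + s • y) (y - x)) s := by
    intro s
    have h1 : HasDerivAt (fun s : ℝ => (1 - s) • x + s • y) (y - x) s := by
      have := (((hasDerivAt_id s).const_sub 1).smul_const x).add ((hasDerivAt_id s).smul_const y)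
      refine this.congr_deriv ?_
      simp [sub_eq_add_neg, add_comm]
    exact ((hu.differentiable (by simp) _).hasFDerivAt).comp_hasDerivAt s h1
  have hc : Continuous fun s : ℝ => fderiv ℝ u ((1 - s) • x + s • y) (y - x) :=
    ((hu.continuous_fderiv (by simp)).comp (by fun_prop)).clm_apply continuous_const
  have hFTC := intervalIntegral.integral_eq_sub_of_hasDerivAt (a := 0) (b := 1)
    (fun s _ => hd s) (hc.intervalIntegrable _ _)
  simp only [sub_self, zero_smul, one_smul, zero_add, sub_zero, add_zero] at hFTC
  rw [← enorm_neg, neg_sub, ← hFTC, intervalIntegral.integral_of_le zero_le_one]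
  refine (enorm_integral_le_lintegral_enorm _).trans (lintegral_mono fun s => ?_)
  exact ContinuousLinearMap.le_opENorm _ _

/-- The Poincaré inequality for a `C¹` function on a convex set. -/
theorem poincare_contDiff {u : E n → ℝ} (hu : ContDiff ℝ 1 u) {K : Set (E n)} (hK : Convex ℝ K)
    (hKm : MeasurableSet K) {d : ℝ≥0∞} (hdt : d ≠ ⊤) (hd : ∀ x ∈ K, ∀ y ∈ K, ‖y - x‖ₑ ≤ d) :
    ∫⁻ x in K, ∫⁻ y in K, ‖u x - u y‖ₑ
      ≤ 2 ^ n * d * volume K * ∫⁻ z in K, ‖fderiv ℝ u z‖ₑ := by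
  set H : E n → ℝ≥0∞ := fun z => ‖fderiv ℝ u z‖ₑ with hH
  have hHc : Continuous H := (hu.continuous_fderiv (by simp)).enorm
  have hHm : Measurable H := hHc.measurable
  have hS : ∀ s ∈ Ioc (0 : ℝ) 1, ∫⁻ x in K, ∫⁻ y in K, H ((1 - s) • x + s • y)
      ≤ 2 ^ n * volume K * ∫⁻ z in K, H z := by
    intro s hs
    -- The change of variables is made in whichever of x and y has coefficient at least 1/2, so the
    -- Jacobian never degenerates.
    rcases le_total s (1 / 2) with h | h
    · rw [lintegral_lintegral_swap]
      · calc _ ≤ ∫⁻ _ in K, 2 ^ n * ∫⁻ z in K, H z :=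
              setLIntegral_mono' hKm fun y hy =>
                setLIntegral_comp_convexComb_le hK hKm hHm hy hs.1.le h
          _ = _ := by rw [setLIntegral_const]; ring
      · refine Continuous.aemeasurable ?_
        exact hHc.comp (by fun_prop)
    · calc _ ≤ ∫⁻ _ in K, 2 ^ n * ∫⁻ z in K, H z := by
              refine setLIntegral_mono' hKm fun x hx => ?_
              have := setLIntegral_comp_convexComb_le hK hKm hHm hx (s := 1 - s)
                (by linarith [hs.2]) (by linarith)
              simp only [sub_sub_cancel] at this
              simpa only [add_comm] using this
        _ = _ := by rw [setLIntegral_const]; ring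
  calc ∫⁻ x in K, ∫⁻ y in K, ‖u x - u y‖ₑ
      ≤ ∫⁻ x in K, ∫⁻ y in K, ∫⁻ s in Ioc (0 : ℝ) 1, H ((1 - s) • x + s • y) * d := by
        refine setLIntegral_mono' hKm fun x hx => setLIntegral_mono' hKm fun y hy => ?_
        exact (enorm_sub_le_lintegral_fderiv hu x y).trans
          (lintegral_mono fun s => mul_le_mul_right (hd x hx y hy) _)
    _ = ∫⁻ x in K, ∫⁻ s in Ioc (0 : ℝ) 1, ∫⁻ y in K, H ((1 - s) • x + s • y) * d := by
        refine lintegral_congr fun x => lintegral_lintegral_swap ?_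
        refine Measurable.aemeasurable (Measurable.mul_const (Continuous.measurable ?_) d)
        exact hHc.comp (by fun_prop)
    _ = ∫⁻ s in Ioc (0 : ℝ) 1, ∫⁻ x in K, ∫⁻ y in K, H ((1 - s) • x + s • y) * d := by
        refine lintegral_lintegral_swap (Measurable.aemeasurable ?_)
        refine Measurable.lintegral_prod_right' (f := fun q : (E n × ℝ) × E n =>
          H ((1 - q.1.2) • q.1.1 + q.1.2 • q.2) * d) ?_
        refine Measurable.mul_const (Continuous.measurable ?_) d
        exact hHc.comp (by fun_prop)
    _ ≤ ∫⁻ _ in Ioc (0 : ℝ) 1, 2 ^ n * volume K * (∫⁻ z in K, H z) * d := by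
        refine setLIntegral_mono' measurableSet_Ioc fun s hs => ?_
        simp_rw [lintegral_mul_const' _ _ hdt]
        exact mul_le_mul_left (hS s hs) _
    _ = _ := by
        rw [setLIntegral_const, Real.volume_Ioc]
        simp only [sub_zero, ENNReal.ofReal_one, mul_one]
        ring

theorem aemeasurable_enorm_sub_prod {α : Type*} [MeasurableSpace α] {μ : Measure α} [SFinite μ]
    {f : α → ℝ} (hf : AEStronglyMeasurable f μ) :
    AEMeasurable (fun q : α × α => ‖f q.1 - f q.2‖ₑ) (μ.prod μ) :=
  (hf.comp_fst.sub hf.comp_snd).enorm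

/-- The Poincaré inequality on a compact convex subset of the domain. -/
theorem MemW11.poincare_of_isCompact (hΩ : IsOpen Ω) (h : MemW11 Ω f G) {K : Set (E n)}
    (hK : Convex ℝ K) (hKc : IsCompact K) (hKΩ : K ⊆ Ω) {d : ℝ≥0∞} (hdt : d ≠ ⊤)
    (hd : ∀ x ∈ K, ∀ y ∈ K, ‖y - x‖ₑ ≤ d) :
    ∫⁻ x in K, ∫⁻ y in K, ‖f x - f y‖ₑ ≤ 2 ^ n * d * volume K * ∫⁻ z in K, ‖G z‖ₑ := by
  have hKm := hKc.measurableSet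
  have hVt : volume K ≠ ⊤ := hKc.measure_lt_top.ne
  have hf : Integrable (Ω.indicator f) := (integrable_indicator_iff hΩ.measurableSet).2 h.integrable
  have hG : Integrable (Ω.indicator G) :=
    (integrable_indicator_iff hΩ.measurableSet).2 h.integrable_grad
  set F := Ω.indicator f
  set I := Ω.indicator G
  let fk : ℕ → E n → ℝ := fun k => mollify (bumpSeq (E n) k) F
  let Gk : ℕ → E n → E n := fun k => mollify (bumpSeq (E n) k) I
  let ε : ℕ → ℝ≥0∞ := fun k => ∫⁻ x, ‖fk k x - F x‖ₑ
  let δ : ℕ → ℝ≥0∞ := fun k => ∫⁻ x, ‖Gk k x - I x‖ₑ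
  have hε : Tendsto ε atTop (𝓝 0) := tendsto_lintegral_enorm_mollify_sub hf
  have hδ : Tendsto δ atTop (𝓝 0) := tendsto_lintegral_enorm_mollify_sub hG
  set A := 2 ^ n * d * volume K with hA
  have hAt : A ≠ ⊤ := ENNReal.mul_ne_top (ENNReal.mul_ne_top (by simp) hdt) hVt
  -- Replacing f by its mollification costs the L¹ error once for each variable, each time
  -- multiplied by the volume of K; the gradient costs one more error term.
  have hev : ∀ᶠ k in atTop, ∫⁻ x in K, ∫⁻ y in K, ‖f x - f y‖ₑ
      ≤ volume K * ε k + A * ((∫⁻ z in K, ‖G z‖ₑ) + δ k) + volume K * ε k := by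
    filter_upwards [eventually_closedBall_bumpSeq_subset hΩ hKc hKΩ] with k hk
    have hfk : ContDiff ℝ 1 (fk k) := contDiff_mollify _ hf
    have hm1 : AEMeasurable (fun x => ‖fk k x - F x‖ₑ) volume :=
      (hfk.continuous.aestronglyMeasurable.sub hf.aestronglyMeasurable).enorm
    have hd2 : ∀ x, Measurable fun y => ‖fk k x - fk k y‖ₑ := fun x =>
      (continuous_const.sub hfk.continuous).enorm.measurable
    have hsm := poincare_contDiff hfk hK hKm hdt hd
    have hgrad : ∫⁻ z in K, ‖fderiv ℝ (fk k) z‖ₑ ≤ (∫⁻ z in K, ‖G z‖ₑ) + δ k := by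
      calc ∫⁻ z in K, ‖fderiv ℝ (fk k) z‖ₑ ≤ ∫⁻ z in K, (‖G z‖ₑ + ‖Gk k z - I z‖ₑ) := by
            refine setLIntegral_mono' hKm fun z hz => ?_
            have h1 : ‖fderiv ℝ (fk k) z‖ ≤ ‖Gk k z‖ := by
              refine ContinuousLinearMap.opNorm_le_bound _ (norm_nonneg _) fun v => ?_
              rw [h.fderiv_mollify hΩ _ (hk z hz) v]
              exact norm_inner_le_norm _ _
            have h2 : ‖Gk k z‖ₑ ≤ ‖G z‖ₑ + ‖Gk k z - I z‖ₑ := by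
              have : I z = G z := indicator_of_mem (hKΩ hz) G
              calc ‖Gk k z‖ₑ = ‖G z + (Gk k z - I z)‖ₑ := by rw [this]; congr 1; abel
                _ ≤ _ := enorm_add_le _ _
            exact (enorm_le_iff_norm_le.2 h1).trans h2
        _ = (∫⁻ z in K, ‖G z‖ₑ) + ∫⁻ z in K, ‖Gk k z - I z‖ₑ :=
            lintegral_add_left' (h.integrable_grad.mono_set hKΩ).aestronglyMeasurable.enorm _
        _ ≤ _ := add_le_add_right (setLIntegral_le_lintegral _ _) _
    have hFK : ∀ x ∈ K, F x = f x := fun x hx => indicator_of_mem (hKΩ hx) f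
    calc ∫⁻ x in K, ∫⁻ y in K, ‖f x - f y‖ₑ
        ≤ ∫⁻ x in K, ∫⁻ y in K, (‖fk k x - F x‖ₑ + (‖fk k x - fk k y‖ₑ + ‖fk k y - F y‖ₑ)) := by
          refine setLIntegral_mono' hKm fun x hx => setLIntegral_mono' hKm fun y hy => ?_
          rw [← hFK x hx, ← hFK y hy]
          calc ‖F x - F y‖ₑ = ‖-(fk k x - F x) + ((fk k x - fk k y) + (fk k y - F y))‖ₑ := by
                congr 1; ring
            _ ≤ ‖-(fk k x - F x)‖ₑ + ‖(fk k x - fk k y) + (fk k y - F y)‖ₑ := enorm_add_le _ _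
            _ ≤ _ := by
                rw [enorm_neg]
                exact add_le_add_right (enorm_add_le _ _) _
      _ = ∫⁻ x in K, (volume K * ‖fk k x - F x‖ₑ
            + ((∫⁻ y in K, ‖fk k x - fk k y‖ₑ) + ∫⁻ y in K, ‖fk k y - F y‖ₑ)) := by
          refine lintegral_congr fun x => ?_
          rw [lintegral_add_left measurable_const, setLIntegral_const, mul_comm,
            lintegral_add_left (hd2 x)]
      _ = volume K * (∫⁻ x in K, ‖fk k x - F x‖ₑ)
            + ((∫⁻ x in K, ∫⁻ y in K, ‖fk k x - fk k y‖ₑ)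
              + volume K * ∫⁻ y in K, ‖fk k y - F y‖ₑ) := by
          rw [lintegral_add_left' (hm1.restrict.const_mul _), lintegral_const_mul' _ _ hVt,
            lintegral_add_right _ measurable_const, setLIntegral_const, mul_comm (volume K)
              (∫⁻ y in K, ‖fk k y - F y‖ₑ)]
      _ ≤ volume K * ε k + (A * ((∫⁻ z in K, ‖G z‖ₑ) + δ k) + volume K * ε k) := by
          gcongr
          · exact setLIntegral_le_lintegral _ _
          · exact hsm.trans (mul_le_mul_right hgrad _)
          · exact setLIntegral_le_lintegral _ _
      _ = _ := (add_assoc _ _ _).symm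
  have hlim : Tendsto (fun k => volume K * ε k + A * ((∫⁻ z in K, ‖G z‖ₑ) + δ k) + volume K * ε k)
      atTop (𝓝 (volume K * 0 + A * ((∫⁻ z in K, ‖G z‖ₑ) + 0) + volume K * 0)) := by
    have h1 := ENNReal.Tendsto.const_mul hε (Or.inr hVt)
    have h2 := ENNReal.Tendsto.const_mul (tendsto_const_nhds.add hδ) (Or.inr hAt)
      (m := fun k => (∫⁻ z in K, ‖G z‖ₑ) + δ k)
    exact (h1.add h2).add h1
  have := ge_of_tendsto hlim hev
  simpa using this

/-- The Poincaré inequality on an open ball contained in the domain. -/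
theorem MemW11.poincare_ball (hΩ : IsOpen Ω) (h : MemW11 Ω f G) {c : E n} {r : ℝ} (hr : 0 < r)
    (hB : ball c r ⊆ Ω) :
    ∫⁻ x in ball c r, ∫⁻ y in ball c r, ‖f x - f y‖ₑ
      ≤ 2 ^ n * ENNReal.ofReal (2 * r) * volume (ball c r) * ∫⁻ z in ball c r, ‖G z‖ₑ := by
  -- The open ball may touch the boundary of Ω, so it is exhausted by concentric closed balls, to
  -- which the compact case applies.
  let ρ : ℕ → ℝ := fun m => r * (1 - 1 / (m + 1))
  have hρr : ∀ m, ρ m < r := fun m => by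
    have : (0 : ℝ) < 1 / (m + 1) := by positivity
    simp only [ρ]
    nlinarith
  have hρm : Monotone ρ := fun a b hab => by
    simp only [ρ]
    gcongr
  have hU : ball c r = ⋃ m, closedBall c (ρ m) := by
    ext x
    simp only [mem_ball, mem_iUnion, mem_closedBall]
    constructor
    · intro hx
      have hlim : Tendsto ρ atTop (𝓝 (r * (1 - 0))) :=
        (tendsto_const_nhds.sub tendsto_one_div_add_atTop_nhds_zero_nat).const_mul r
      rw [sub_zero, mul_one] at hlim
      obtain ⟨m, hm⟩ := (hlim.eventually (lt_mem_nhds hx)).exists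
      exact ⟨m, hm.le⟩
    · rintro ⟨m, hm⟩
      exact hm.trans_lt (hρr m)
  have hsub : ∀ m, closedBall c (ρ m) ⊆ ball c r := fun m => closedBall_subset_ball (hρr m)
  have hfB : AEStronglyMeasurable f (volume.restrict (ball c r)) :=
    (h.integrable.mono_set hB).aestronglyMeasurable
  have hprod : ∀ s ⊆ ball c r, ∫⁻ x in s, ∫⁻ y in s, ‖f x - f y‖ₑ
      = ∫⁻ q in s ×ˢ s, ‖f q.1 - f q.2‖ₑ ∂(volume.prod volume) := by
    intro s hs
    rw [← Measure.prod_restrict, lintegral_prod]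
    exact aemeasurable_enorm_sub_prod (hfB.mono_measure (Measure.restrict_mono hs le_rfl))
  have hUU : ball c r ×ˢ ball c r = ⋃ m, closedBall c (ρ m) ×ˢ closedBall c (ρ m) := by
    rw [iUnion_prod_of_monotone (fun a b hab => closedBall_subset_closedBall (hρm hab))
      (fun a b hab => closedBall_subset_closedBall (hρm hab)), ← hU]
  rw [hprod _ subset_rfl, hUU, setLIntegral_iUnion_of_directed]
  · refine iSup_le fun m => ?_
    rw [← hprod _ (hsub m)]
    refine (h.poincare_of_isCompact hΩ (convex_closedBall _ _) (isCompact_closedBall _ _)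
      ((hsub m).trans hB) (d := ENNReal.ofReal (2 * r)) ENNReal.ofReal_ne_top ?_).trans ?_
    · intro x hx y hy
      rw [← ofReal_norm]
      refine ENNReal.ofReal_le_ofReal ?_
      rw [← dist_eq_norm]
      have h1 := mem_ball.1 (hsub m hx)
      have h2 := mem_ball.1 (hsub m hy)
      linarith [dist_triangle_right y x c]
    · have := hsub m
      gcongr
  · exact Monotone.directed_le fun a b hab => prod_mono
      (closedBall_subset_closedBall (hρm hab)) (closedBall_subset_closedBall (hρm hab))

theorem enorm_sub_average_le {α : Type*} [MeasurableSpace α] {ν : Measure α} [IsFiniteMeasure ν]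
    (hν : ν ≠ 0) {f : α → ℝ} (hf : Integrable f ν) (c : ℝ) :
    ‖c - ⨍ x, f x ∂ν‖ₑ ≤ (ν univ)⁻¹ * ∫⁻ x, ‖c - f x‖ₑ ∂ν := by
  have : NeZero ν := ⟨hν⟩
  have hne : ν univ ≠ 0 := by simpa using hν
  have e : c - ⨍ x, f x ∂ν = ∫ x, (c - f x) ∂(ν univ)⁻¹ • ν := by
    rw [integral_sub (integrable_const c) (hf.smul_measure (ENNReal.inv_ne_top.2 hne))]
    congr 1
    have : IsProbabilityMeasure ((ν univ)⁻¹ • ν) := isProbabilityMeasureSMul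
    simp
  rw [e]
  refine (enorm_integral_le_lintegral_enorm _).trans_eq ?_
  rw [lintegral_smul_measure, smul_eq_mul]

/-- Comparison of the averages over two nested balls. -/
theorem MemW11.enorm_average_sub_average_le (hΩ : IsOpen Ω) (h : MemW11 Ω f G) {c c' : E n}
    {r r' : ℝ} (hr : 0 < r) (hr' : 0 < r') (hB : ball c r ⊆ Ω) (hB' : ball c' r' ⊆ ball c r) :
    ‖(⨍ x in ball c' r', f x) - ⨍ x in ball c r, f x‖ₑ
      ≤ (volume (ball c' r'))⁻¹ * (2 ^ n * ENNReal.ofReal (2 * r)) * ∫⁻ z in ball c r, ‖G z‖ₑ := by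
  have hV : volume (ball c r) ≠ 0 := (measure_ball_pos _ _ hr).ne'
  have hVt : volume (ball c r) ≠ ⊤ := measure_ball_lt_top.ne
  have hV' : volume (ball c' r') ≠ 0 := (measure_ball_pos _ _ hr').ne'
  have hfin : IsFiniteMeasure (volume.restrict (ball c r)) :=
    isFiniteMeasure_restrict.2 measure_ball_lt_top.ne
  have hfin' : IsFiniteMeasure (volume.restrict (ball c' r')) :=
    isFiniteMeasure_restrict.2 measure_ball_lt_top.ne
  have hi := h.integrable.mono_set hB
  have hi' := hi.mono_set hB'
  rw [← enorm_neg, neg_sub]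
  have h1 := enorm_sub_average_le (by simpa using hV') hi' (⨍ x in ball c r, f x)
  have h2 : ∀ x, ‖(⨍ x in ball c r, f x) - f x‖ₑ
      ≤ (volume (ball c r))⁻¹ * ∫⁻ y in ball c r, ‖f x - f y‖ₑ := fun x => by
    have := enorm_sub_average_le (by simpa using hV) hi (f x)
    rw [← enorm_neg, neg_sub] at this
    simpa only [Measure.restrict_apply_univ] using this
  rw [Measure.restrict_apply_univ] at h1
  calc _ ≤ (volume (ball c' r'))⁻¹ * ∫⁻ x in ball c' r', ‖(⨍ x in ball c r, f x) - f x‖ₑ := h1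
    _ ≤ (volume (ball c' r'))⁻¹ * ∫⁻ x in ball c' r',
          (volume (ball c r))⁻¹ * ∫⁻ y in ball c r, ‖f x - f y‖ₑ :=
        mul_le_mul_right (lintegral_mono h2) _
    _ ≤ (volume (ball c' r'))⁻¹ * ∫⁻ x in ball c r,
          (volume (ball c r))⁻¹ * ∫⁻ y in ball c r, ‖f x - f y‖ₑ :=
        mul_le_mul_right (lintegral_mono_set hB') _
    _ = (volume (ball c' r'))⁻¹ * ((volume (ball c r))⁻¹ * ∫⁻ x in ball c r,
          ∫⁻ y in ball c r, ‖f x - f y‖ₑ) := by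
        rw [lintegral_const_mul' _ _ (ENNReal.inv_ne_top.2 hV)]
    _ ≤ (volume (ball c' r'))⁻¹ * ((volume (ball c r))⁻¹ * (2 ^ n * ENNReal.ofReal (2 * r)
          * volume (ball c r) * ∫⁻ z in ball c r, ‖G z‖ₑ)) := by
        gcongr
        exact h.poincare_ball hΩ hr hB
    _ = (volume (ball c' r'))⁻¹ * (((volume (ball c r))⁻¹ * volume (ball c r)) *
          (2 ^ n * ENNReal.ofReal (2 * r) * ∫⁻ z in ball c r, ‖G z‖ₑ)) := by ring
    _ = _ := by
        rw [ENNReal.inv_mul_cancel hV hVt, one_mul, ← mul_assoc]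

end Poincare


/-! ### Integration over balls of fixed radius as an operator from L^t to L^q. -/

section BallMean

variable {α : Type*} [PseudoMetricSpace α] [SecondCountableTopology α] [MeasurableSpace α]
  [OpensMeasurableSpace α] {μ : Measure α} [SFinite μ]

theorem aemeasurable_indicator_dist_lt {g : α → ℝ≥0∞} (hg : AEMeasurable g μ) (ρ : ℝ) :
    AEMeasurable ({q : α × α | dist q.2 q.1 < ρ}.indicator fun q => g q.2) (μ.prod μ) :=
  hg.comp_snd.indicator
    (isOpen_lt (continuous_snd.dist continuous_fst) continuous_const).measurableSet

theorem setLIntegral_ball_eq (g : α → ℝ≥0∞) (ρ : ℝ) (x : α) :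
    ∫⁻ y in ball x ρ, g y ∂μ
      = ∫⁻ y, {q : α × α | dist q.2 q.1 < ρ}.indicator (fun q => g q.2) (x, y) ∂μ := by
  rw [← lintegral_indicator measurableSet_ball]
  rfl

theorem aemeasurable_setLIntegral_ball {g : α → ℝ≥0∞} (hg : AEMeasurable g μ) (ρ : ℝ) :
    AEMeasurable (fun x => ∫⁻ y in ball x ρ, g y ∂μ) μ := by
  simp_rw [setLIntegral_ball_eq]
  exact (aemeasurable_indicator_dist_lt hg ρ).lintegral_prod_right'

theorem lintegral_setLIntegral_ball_le {g : α → ℝ≥0∞} (hg : AEMeasurable g μ) {ρ : ℝ} {V : ℝ≥0∞}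
    (hV : ∀ x, μ (ball x ρ) ≤ V) :
    ∫⁻ x, ∫⁻ y in ball x ρ, g y ∂μ ∂μ ≤ V * ∫⁻ y, g y ∂μ := by
  simp_rw [setLIntegral_ball_eq]
  rw [lintegral_lintegral_swap (f := fun x y =>
    {q : α × α | dist q.2 q.1 < ρ}.indicator (fun q => g q.2) (x, y))
    (aemeasurable_indicator_dist_lt hg ρ)]
  calc ∫⁻ y, ∫⁻ x, {q : α × α | dist q.2 q.1 < ρ}.indicator (fun q => g q.2) (x, y) ∂μ ∂μ
      ≤ ∫⁻ y, V * g y ∂μ := by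
        refine lintegral_mono fun y => ?_
        calc ∫⁻ x, {q : α × α | dist q.2 q.1 < ρ}.indicator (fun q => g q.2) (x, y) ∂μ
            = ∫⁻ x, (ball y ρ).indicator (fun _ => g y) x ∂μ := by
              refine lintegral_congr fun x => ?_
              simp only [indicator, mem_ball, dist_comm x y]
              rfl
          _ = g y * μ (ball y ρ) := lintegral_indicator_const measurableSet_ball _
          _ ≤ V * g y := by rw [mul_comm]; exact mul_le_mul_left (hV y) _
    _ = V * ∫⁻ y, g y ∂μ := lintegral_const_mul'' _ hg

/-- The operator of integration over balls of a fixed radius maps `L^t` to `L^q`, `t ≤ q`. -/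
theorem rpow_lintegral_setLIntegral_ball_le {g : α → ℝ≥0∞} (hg : AEMeasurable g μ) {ρ : ℝ}
    {V : ℝ≥0∞} (hV : ∀ x, μ (ball x ρ) ≤ V) {t q : ℝ} (ht : 1 ≤ t) (htq : t ≤ q) :
    (∫⁻ x, (∫⁻ y in ball x ρ, g y ∂μ) ^ q ∂μ) ^ (1 / q)
      ≤ V ^ (1 - 1 / t + 1 / q) * (∫⁻ y, g y ^ t ∂μ) ^ (1 / t) := by
  have ht0 : 0 < t := by linarith
  have hq0 : 0 < q := by linarith
  have h1t : 0 ≤ 1 - 1 / t := by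
    rw [sub_nonneg, div_le_one ht0]
    exact ht
  have hqt : 0 ≤ q / t - 1 := by
    rw [sub_nonneg, one_le_div ht0]
    exact htq
  set A := ∫⁻ y, g y ^ t ∂μ with hA
  -- Hölder's inequality on the ball, after which the power q/t of the local integral is split: q/t
  -- - 1 factors are bounded by the global integral, and one is kept for Tonelli.
  have hH : ∀ x, (∫⁻ y in ball x ρ, g y ∂μ) ^ q
      ≤ V ^ ((1 - 1 / t) * q) * A ^ (q / t - 1) * ∫⁻ y in ball x ρ, g y ^ t ∂μ := by
    intro x
    have h := eLpNorm'_le_eLpNorm'_mul_rpow_measure_univ (μ := μ.restrict (ball x ρ)) one_pos ht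
      (hg.restrict (s := ball x ρ)).aestronglyMeasurable
    simp only [eLpNorm', enorm_eq_self, ENNReal.rpow_one, div_one, Measure.restrict_apply_univ] at h
    set I := ∫⁻ y in ball x ρ, g y ^ t ∂μ with hI
    have hIA : I ≤ A := setLIntegral_le_lintegral _ _
    calc (∫⁻ y in ball x ρ, g y ∂μ) ^ q
        ≤ (I ^ (1 / t) * V ^ (1 - 1 / t)) ^ q := by
          refine ENNReal.rpow_le_rpow (h.trans ?_) hq0.le
          exact mul_le_mul_right (ENNReal.rpow_le_rpow (hV x) h1t) _
      _ = I ^ (q / t - 1 + 1) * V ^ ((1 - 1 / t) * q) := by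
          rw [ENNReal.mul_rpow_of_nonneg _ _ hq0.le, ← ENNReal.rpow_mul, ← ENNReal.rpow_mul]
          congr 2
          ring
      _ = V ^ ((1 - 1 / t) * q) * I ^ (q / t - 1) * I := by
          rw [ENNReal.rpow_add_of_nonneg _ _ hqt zero_le_one, ENNReal.rpow_one]
          ring
      _ ≤ _ := by
          refine mul_le_mul_left (mul_le_mul_right ?_ _) _
          exact ENNReal.rpow_le_rpow hIA hqt
  have hgt : AEMeasurable (fun y => g y ^ t) μ := hg.pow_const t
  calc (∫⁻ x, (∫⁻ y in ball x ρ, g y ∂μ) ^ q ∂μ) ^ (1 / q)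
      ≤ (V ^ ((1 - 1 / t) * q) * A ^ (q / t - 1) * (V * A)) ^ (1 / q) := by
        refine ENNReal.rpow_le_rpow ?_ (by positivity)
        refine (lintegral_mono hH).trans ?_
        rw [lintegral_const_mul'' _ (aemeasurable_setLIntegral_ball hgt ρ)]
        exact mul_le_mul_right (lintegral_setLIntegral_ball_le hgt hV) _
    _ = (V ^ ((1 - 1 / t) * q + 1) * A ^ (q / t - 1 + 1)) ^ (1 / q) := by
        rw [ENNReal.rpow_add_of_nonneg _ _ hqt zero_le_one,
          ENNReal.rpow_add_of_nonneg _ _ (by positivity) zero_le_one, ENNReal.rpow_one,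
          ENNReal.rpow_one]
        ring_nf
    _ = V ^ (1 - 1 / t + 1 / q) * A ^ (1 / t) := by
        rw [ENNReal.mul_rpow_of_nonneg _ _ (by positivity), ← ENNReal.rpow_mul,
          ← ENNReal.rpow_mul]
        congr 2 <;> field_simp
        ring

end BallMean

/-! ### The subcritical Sobolev–Poincaré inequality on a ball. -/

section Ball

variable {n : ℕ} {f : E n → ℝ} {G : E n → E n}

theorem volume_ball_mul (x : E n) {l R : ℝ} (hl : 0 < l) (h1 : volume (ball (0 : E n) R) = 1) :
    volume (ball x (l * R)) = ENNReal.ofReal (l ^ n) := by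
  rw [Measure.addHaar_ball_mul_of_pos _ _ hl, finrank_euclideanSpace_fin, h1, mul_one]

/-- These balls are images of B(0, R) under the homotheties with centre x and ratio l. They are
nested and stay in B(0, R) however close x is to the boundary. -/
theorem ball_convexComb_subset {R l l' : ℝ} {x : E n} (hx : x ∈ ball (0 : E n) R)
    (hll : l' ≤ l) :
    ball ((1 - l') • x) (l' * R) ⊆ ball ((1 - l) • x) (l * R) := by
  refine ball_subset_ball' ?_
  rw [dist_eq_norm, ← sub_smul, norm_smul, Real.norm_of_nonneg (by linarith)]
  rw [mem_ball_zero_iff] at hx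
  nlinarith

theorem ball_convexComb_subset_ball {R l : ℝ} (hl0 : 0 < l) {x : E n}
    (hx : x ∈ ball (0 : E n) R) : ball ((1 - l) • x) (l * R) ⊆ ball x (2 * (l * R)) := by
  refine ball_subset_ball' ?_
  rw [dist_eq_norm, sub_smul, one_smul, sub_sub_cancel_left, norm_neg, norm_smul,
    Real.norm_of_nonneg hl0.le]
  rw [mem_ball_zero_iff] at hx
  nlinarith

/-- The balls are not centred at x, but x is within one radius of their centres, which Lebesgue
differentiation for a doubling measure allows. -/
theorem ae_tendsto_average_ball_convexComb (hn : 0 < n) {R : ℝ} (hR : 0 < R)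
    (hf : IntegrableOn f (ball (0 : E n) R)) {l : ℕ → ℝ} (hl0 : ∀ k, 0 < l k) (hl1 : ∀ k, l k ≤ 1)
    (hl : Tendsto l atTop (𝓝 0)) :
    ∀ᵐ x ∂(volume.restrict (ball (0 : E n) R)),
      Tendsto (fun k => ⨍ y in ball ((1 - l k) • x) (l k * R), f y) atTop (𝓝 (f x)) := by
  have : Nonempty (Fin n) := ⟨⟨0, hn⟩⟩
  have hF : Integrable ((ball (0 : E n) R).indicator f) :=
    (integrable_indicator_iff measurableSet_ball).2 hf
  have h := IsUnifLocDoublingMeasure.ae_tendsto_average (μ := (volume : Measure (E n)))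
    hF.locallyIntegrable 1
  rw [ae_restrict_iff' measurableSet_ball]
  filter_upwards [h] with x hx hxR
  have hδ : Tendsto (fun k => l k * R) atTop (𝓝[>] 0) := by
    refine tendsto_nhdsWithin_iff.2 ⟨by simpa using hl.mul_const R, ?_⟩
    exact Eventually.of_forall fun k => mul_pos (hl0 k) hR
  have h2 := hx (fun k => (1 - l k) • x) (fun k => l k * R) hδ (by
    refine Eventually.of_forall fun k => ?_
    rw [one_mul, mem_closedBall, dist_eq_norm, sub_smul, one_smul, sub_sub_cancel, norm_smul,
      Real.norm_of_nonneg (hl0 k).le]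
    rw [mem_ball_zero_iff] at hxR
    exact mul_le_mul_of_nonneg_left hxR.le (hl0 k).le)
  rw [indicator_of_mem hxR] at h2
  refine h2.congr fun k => ?_
  have h3 : closedBall ((1 - l k) • x) (l k * R) =ᵐ[volume] ball ((1 - l k) • x) (l k * R) :=
    (ae_eq_of_subset_of_measure_ge ball_subset_closedBall
      (Measure.addHaar_closedBall_eq_addHaar_ball _ _ _).le
      measurableSet_ball.nullMeasurableSet measure_closedBall_lt_top.ne).symm
  rw [setAverage_congr h3]
  refine setAverage_congr_fun measurableSet_ball (Eventually.of_forall fun y hy => ?_)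
  refine indicator_of_mem ?_ _
  simpa using ball_convexComb_subset hxR (hl1 k) hy

/-- Pointwise estimate of `f - f_Ω` on a ball by integrals of the gradient over small balls. -/
theorem MemW11.ae_enorm_sub_average_le_tsum (hn : 0 < n) {R : ℝ} (hR : 0 < R)
    (h1 : volume (ball (0 : E n) R) = 1) (h : MemW11 (ball (0 : E n) R) f G) :
    ∀ᵐ x ∂(volume.restrict (ball (0 : E n) R)),
      ‖f x - ⨍ y in ball (0 : E n) R, f y‖ₑ ≤ ∑' k : ℕ,
        ENNReal.ofReal (4 ^ n * (2 * R) * (2 ^ k) ^ ((n : ℝ) - 1)) *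
          ∫⁻ y in ball x (2 * ((2 ^ k)⁻¹ * R)), ‖G y‖ₑ ∂(volume.restrict (ball (0 : E n) R)) := by
  have hl0 : ∀ k : ℕ, (0 : ℝ) < (2 ^ k)⁻¹ := fun k => by positivity
  have hl1 : ∀ k : ℕ, ((2 : ℝ) ^ k)⁻¹ ≤ 1 := fun k =>
    inv_le_one_of_one_le₀ (one_le_pow₀ (by norm_num))
  have hl : Tendsto (fun k : ℕ => ((2 : ℝ) ^ k)⁻¹) atTop (𝓝 0) := by
    simp_rw [← inv_pow]
    exact tendsto_pow_atTop_nhds_zero_of_lt_one (by norm_num) (by norm_num)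
  filter_upwards [ae_tendsto_average_ball_convexComb hn hR h.integrable hl0 hl1 hl,
    ae_restrict_mem measurableSet_ball] with x hx hxR
  have hB : ∀ k : ℕ, ball ((1 - ((2 : ℝ) ^ k)⁻¹) • x) ((2 ^ k)⁻¹ * R) ⊆ ball (0 : E n) R :=
    fun k => by simpa using ball_convexComb_subset hxR (hl1 k)
  -- Telescoping over the ratios 2^{-k}: the ball with k = 0 is the whole domain, and the averages
  -- converge to f(x).
  have key := edist_le_tsum_of_edist_le_of_tendsto₀ (f := fun k : ℕ =>
    ⨍ y in ball ((1 - ((2 : ℝ) ^ k)⁻¹) • x) ((2 ^ k)⁻¹ * R), f y)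
    (fun k : ℕ => ENNReal.ofReal (4 ^ n * (2 * R) * (2 ^ k) ^ ((n : ℝ) - 1)) *
          ∫⁻ y in ball x (2 * ((2 ^ k)⁻¹ * R)), ‖G y‖ₑ ∂(volume.restrict (ball (0 : E n) R)))
    (fun k => ?_) hx
  · simp only [pow_zero, inv_one, sub_self, zero_smul, one_mul] at key
    rw [edist_comm, edist_eq_enorm_sub] at key
    simpa using key
  · rw [edist_comm, edist_eq_enorm_sub]
    have hle : ((2 : ℝ) ^ (k + 1))⁻¹ ≤ (2 ^ k)⁻¹ :=
      inv_anti₀ (by positivity) (pow_le_pow_right₀ (by norm_num) (Nat.le_succ k))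
    refine (h.enorm_average_sub_average_le isOpen_ball (mul_pos (hl0 k) hR)
      (mul_pos (hl0 (k + 1)) hR) (hB k)
      (ball_convexComb_subset hxR hle)).trans ?_
    refine mul_le_mul' (le_of_eq ?_) ?_
    · rw [volume_ball_mul _ (hl0 _) h1, ← ENNReal.ofReal_inv_of_pos (by positivity),
        ← ENNReal.ofReal_ofNat 2, ← ENNReal.ofReal_pow (by norm_num),
        ← ENNReal.ofReal_mul (by positivity), ← ENNReal.ofReal_mul (by positivity)]
      congr 1
      rw [Real.rpow_sub_one (by positivity), Real.rpow_natCast, pow_succ, inv_pow, inv_inv,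
        mul_pow, show (4 : ℝ) = 2 * 2 by norm_num, mul_pow]
      field_simp
    · rw [Measure.restrict_restrict measurableSet_ball]
      exact lintegral_mono_set (subset_inter (ball_convexComb_subset_ball (hl0 k) hxR) (hB k))

/-- The subcritical Sobolev-Poincaré inequality on a ball of measure one. -/
theorem sobolevPoincareRI_ball (hn : 0 < n) {R : ℝ} (hR : 0 < R)
    (h1 : volume (ball (0 : E n) R) = 1) {t q : ℝ} (ht : 1 ≤ t) (htq : t ≤ q)
    (hβ : 0 < 1 - n / t + n / q) {X Y : RISpace (volume.restrict (ball (0 : E n) R))}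
    (hX : X.IsLp t) (hY : Y.IsLp q) : SobolevPoincareRI (ball (0 : E n) R) X Y := by
  have ht0 : 0 < t := by linarith
  have hq0 : 0 < q := by linarith
  set θ : ℝ := 1 - 1 / t + 1 / q with hθ
  have hθ0 : 0 ≤ θ := by
    have : 1 / t ≤ 1 := by
      rw [div_le_one ht0]
      exact ht
    have : 0 < 1 / q := by positivity
    linarith
  set c : ℕ → ℝ := fun k => 4 ^ n * (2 * R) * (2 ^ k) ^ ((n : ℝ) - 1) with hc
  set V : ℕ → ℝ≥0∞ := fun k => volume (ball (0 : E n) (2 * ((2 ^ k)⁻¹ * R))) with hV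
  set K : ℝ := 4 ^ n * (2 * R) * (2 ^ n) ^ θ with hK
  set b : ℝ := 2 ^ (-(1 - n / t + n / q)) with hb
  -- The coefficient grows like 2^{k(n-1)} and the operator norm decays like 2^{-knθ}; n - 1 - nθ =
  -- -(1 - n/t + n/q), so subcriticality is exactly b < 1.
  have hcV : ∀ k, ENNReal.ofReal (c k) * V k ^ θ = ENNReal.ofReal K * ENNReal.ofReal b ^ k := by
    intro k
    have h2 : (0 : ℝ) < 2 * (2 ^ k)⁻¹ := by positivity
    rw [hV]
    simp only
    rw [← mul_assoc, volume_ball_mul _ h2 h1, ENNReal.ofReal_rpow_of_pos (by positivity),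
      ← ENNReal.ofReal_mul (by positivity), ← ENNReal.ofReal_pow (by positivity),
      ← ENNReal.ofReal_mul (by positivity)]
    congr 1
    have h3 : ((2 * ((2 : ℝ) ^ k)⁻¹) ^ n) ^ θ = (2 ^ n) ^ θ * (2 ^ k) ^ (-(n * θ)) := by
      rw [mul_pow, Real.mul_rpow (by positivity) (by positivity), inv_pow,
        Real.inv_rpow (by positivity), ← Real.rpow_natCast (2 ^ k) n, ← Real.rpow_mul
        (by positivity), Real.rpow_neg (by positivity)]
    have h4 : b ^ k = (2 ^ k) ^ ((n : ℝ) - 1) * (2 ^ k) ^ (-(n * θ)) := by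
      rw [← Real.rpow_add (by positivity), hb, ← Real.rpow_natCast, ← Real.rpow_natCast,
        ← Real.rpow_mul (by norm_num), ← Real.rpow_mul (by norm_num)]
      congr 1
      rw [hθ]
      ring
    rw [h3, h4]
    ring
  set S : ℝ≥0∞ := ∑' k, ENNReal.ofReal (c k) * V k ^ θ with hS
  have hSt : S ≠ ⊤ := by
    rw [hS]
    simp_rw [hcV]
    rw [ENNReal.tsum_mul_left, ENNReal.tsum_geometric]
    refine ENNReal.mul_ne_top ENNReal.ofReal_ne_top (ENNReal.inv_ne_top.2 ?_)
    have : ENNReal.ofReal b < 1 := by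
      rw [ENNReal.ofReal_lt_one]
      exact Real.rpow_lt_one_of_one_lt_of_neg (by norm_num) (by linarith)
    exact (tsub_pos_of_lt this).ne'
  refine ⟨S.toNNReal, fun f G h => ?_⟩
  rw [ENNReal.coe_toNNReal hSt]
  have hG : AEMeasurable (fun x => ‖G x‖ₑ) (volume.restrict (ball (0 : E n) R)) :=
    h.integrable_grad.aestronglyMeasurable.enorm
  set J : ℕ → E n → ℝ≥0∞ := fun k x =>
    ∫⁻ y in ball x (2 * ((2 ^ k)⁻¹ * R)), ‖G y‖ₑ ∂(volume.restrict (ball (0 : E n) R)) with hJ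
  have hJm : ∀ k, AEMeasurable (J k) (volume.restrict (ball (0 : E n) R)) :=
    fun k => aemeasurable_setLIntegral_ball hG _
  have hcJm : ∀ k, AEMeasurable (fun x => ENNReal.ofReal (c k) * J k x)
      (volume.restrict (ball (0 : E n) R)) := fun k => (hJm k).const_mul _
  have hfm : AEMeasurable (fun x => ‖f x - ⨍ y in ball (0 : E n) R, f y‖ₑ)
      (volume.restrict (ball (0 : E n) R)) :=
    (h.integrable.aestronglyMeasurable.sub aestronglyMeasurable_const).enorm
  have hJn : ∀ k, Y.norm (J k) ≤ V k ^ θ * X.norm fun x => ‖G x‖ₑ := by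
    intro k
    rw [hY _ (hJm k), hX (fun x => ‖G x‖ₑ) hG]
    refine rpow_lintegral_setLIntegral_ball_le hG (fun x => ?_) ht htq
    refine (Measure.restrict_apply_le _ _).trans ?_
    exact (Measure.addHaar_ball_center volume x _).le
  calc Y.norm (fun x => ‖f x - ⨍ y in ball (0 : E n) R, f y‖ₑ)
      ≤ Y.norm (fun x => ∑' k, ENNReal.ofReal (c k) * J k x) :=
        Y.norm_mono _ _ hfm (AEMeasurable.tsum hcJm)
          (h.ae_enorm_sub_average_le_tsum hn hR h1)
    _ ≤ ∑' k, Y.norm (fun x => ENNReal.ofReal (c k) * J k x) := Y.norm_tsum_le hcJm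
    _ = ∑' k, ENNReal.ofReal (c k) * Y.norm (J k) :=
        tsum_congr fun k => Y.norm_const_mul _ _ (hJm k)
    _ ≤ ∑' k, ENNReal.ofReal (c k) * V k ^ θ * X.norm fun x => ‖G x‖ₑ :=
        ENNReal.tsum_le_tsum fun k => by
          rw [mul_assoc]
          exact mul_le_mul_right (hJn k) _
    _ = S * X.norm fun x => ‖G x‖ₑ := ENNReal.tsum_mul_right

theorem sobolevPoincare_ball (hn : 0 < n) {R : ℝ} (hR : 0 < R)
    (h1 : volume (ball (0 : E n) R) = 1) {p : ℝ} (hp : 1 ≤ p) (hβ : 0 < 1 - n + n / p) :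
    SobolevPoincare (ball (0 : E n) R) p := by
  have : IsProbabilityMeasure (volume.restrict (ball (0 : E n) R)) :=
    ⟨by rw [Measure.restrict_apply_univ, h1]⟩
  obtain ⟨C, hC⟩ := sobolevPoincareRI_ball hn hR h1 le_rfl hp (by rwa [div_one])
    (isLp_lpSpace (μ := volume.restrict (ball (0 : E n) R)) 1 le_rfl) (isLp_lpSpace p hp)
  refine ⟨C, fun f G h => ?_⟩
  have h2 := hC f G h
  rw [isLp_lpSpace p hp (fun x => ‖f x - ⨍ y in ball (0 : E n) R, f y‖ₑ)
      (h.integrable.aestronglyMeasurable.sub aestronglyMeasurable_const).enorm,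
    isLp_lpSpace 1 le_rfl (fun x => ‖G x‖ₑ) h.integrable_grad.aestronglyMeasurable.enorm] at h2
  simpa only [ENNReal.rpow_one, div_one] using h2

end Ball


/-! ### The unit-measure ball as an s-John domain. -/

section Domain

theorem hasUnitSpeedOn_of_edist_eq {F : Type*} [PseudoEMetricSpace F] {γ : ℝ → F}
    (h : ∀ a b, edist (γ a) (γ b) = edist a b) (s : Set ℝ) : HasUnitSpeedOn γ s := by
  intro a ha b hb
  have h1 : eVariationOn γ (s ∩ Icc a b) = eVariationOn id (s ∩ Icc a b) := by
    simp only [eVariationOn, h, id]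
  rw [NNReal.coe_one, one_mul, h1]
  rcases le_total a b with hab | hab
  · exact eVariationOn_id ha hb
  · rw [ENNReal.ofReal_of_nonpos (by linarith)]
    refine eVariationOn.subsingleton _ ?_
    exact (subsingleton_Icc_of_ge hab).anti inter_subset_right

variable {n : ℕ}

theorem exists_volume_ball_eq_one (hn : 0 < n) :
    ∃ R : ℝ, 0 < R ∧ volume (ball (0 : E n) R) = 1 := by
  set m := (volume (ball (0 : E n) 1)).toReal with hm
  have hm0 : 0 < m :=
    ENNReal.toReal_pos (measure_ball_pos _ _ one_pos).ne' measure_ball_lt_top.ne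
  refine ⟨m ^ (-(1 / n : ℝ)), by positivity, ?_⟩
  have h := Measure.addHaar_ball_mul_of_pos (volume : Measure (E n)) 0
    (r := m ^ (-(1 / n : ℝ))) (by positivity) 1
  rw [mul_one] at h
  rw [h, finrank_euclideanSpace_fin, ← Real.rpow_natCast, ← Real.rpow_mul hm0.le,
    show -(1 / n : ℝ) * n = -1 by field_simp, Real.rpow_neg_one,
    ← ENNReal.ofReal_toReal (measure_ball_lt_top (μ := (volume : Measure (E n)))
      (x := 0) (r := 1)).ne, ← hm, ← ENNReal.ofReal_mul (by positivity),
    inv_mul_cancel₀ hm0.ne', ENNReal.ofReal_one]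

theorem isUnitDomain_ball {R : ℝ} (hR : 0 < R) (h1 : volume (ball (0 : E n) R) = 1) :
    IsUnitDomain (ball (0 : E n) R) :=
  ⟨isOpen_ball, (convex_ball 0 R).isConnected ⟨0, mem_ball_self hR⟩, h1⟩

/-- Along the radial segment to the centre the distance to the sphere at arc length τ is at least τ,
and R^{1-s} τ^s ≤ τ because τ ≤ R and s ≥ 1. -/
theorem isJohnDomain_ball (hn : 0 < n) {R s : ℝ} (hR : 0 < R) (hs : 1 ≤ s) :
    IsJohnDomain s (ball (0 : E n) R) := by
  have : Nonempty (Fin n) := ⟨⟨0, hn⟩⟩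
  refine ⟨isOpen_ball, (convex_ball 0 R).isConnected ⟨0, mem_ball_self hR⟩, isBounded_ball,
    0, mem_ball_self hR, R ^ (1 - s), by positivity, fun x hx => ?_⟩
  rw [mem_ball_zero_iff] at hx
  -- The inward unit direction at x; at the centre any unit vector will do.
  obtain ⟨v, hv, hxv⟩ : ∃ v : E n, ‖v‖ = 1 ∧ -(‖x‖ • v) = x := by
    rcases eq_or_ne x 0 with rfl | h0
    · obtain ⟨v, hv⟩ := exists_norm_eq (E n) zero_le_one
      exact ⟨v, hv, by simp⟩
    · have : ‖x‖ ≠ 0 := norm_ne_zero_iff.2 h0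
      refine ⟨-(‖x‖⁻¹ • x), by rw [norm_neg, norm_smul, norm_inv, norm_norm, inv_mul_cancel₀ this],
        ?_⟩
      rw [smul_neg, neg_neg, smul_smul, mul_inv_cancel₀ this, one_smul]
  have hγ : ∀ τ ∈ Icc 0 ‖x‖, ‖(τ - ‖x‖) • v‖ = ‖x‖ - τ := by
    intro τ hτ
    rw [norm_smul, hv, mul_one, Real.norm_of_nonpos (by linarith [hτ.2]), neg_sub]
  refine ⟨‖x‖, fun τ => (τ - ‖x‖) • v, norm_nonneg x, ?_, ?_, by simpa using hxv, by simp, ?_⟩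
  · refine hasUnitSpeedOn_of_edist_eq (fun a b => ?_) _
    rw [edist_eq_enorm_sub, edist_eq_enorm_sub, ← sub_smul, sub_sub_sub_cancel_right, enorm_smul,
      ← ofReal_norm v, hv, ENNReal.ofReal_one, mul_one]
  · intro τ hτ
    rw [mem_ball_zero_iff, hγ τ hτ]
    linarith [hτ.1]
  · intro τ hτ
    have hle : R ^ (1 - s) * τ ^ s ≤ τ := by
      rcases hτ.1.eq_or_lt with rfl | h0
      · simp [Real.zero_rpow (by linarith : s ≠ 0)]
      · have h3 : τ ^ s = τ * τ ^ (s - 1) := by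
          rw [Real.rpow_sub_one h0.ne']
          field_simp
        have h4 : τ ^ (s - 1) ≤ R ^ (s - 1) :=
          Real.rpow_le_rpow h0.le (by linarith [hτ.2]) (by linarith)
        calc R ^ (1 - s) * τ ^ s ≤ R ^ (1 - s) * (τ * R ^ (s - 1)) := by rw [h3]; gcongr
          _ = τ * R ^ ((1 - s) + (s - 1)) := by rw [Real.rpow_add hR]; ring
          _ = τ := by simp
    refine hle.trans ?_
    rw [frontier_ball _ hR.ne', le_infDist (NormedSpace.sphere_nonempty.2 hR.le)]
    intro y hy
    rw [mem_sphere_zero_iff_norm] at hy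
    have h5 := dist_triangle_left 0 y ((τ - ‖x‖) • v)
    rw [dist_zero_left, dist_zero_right, hy, hγ τ hτ] at h5
    linarith

end Domain

end SobPoin

/-! ### The theorem: choice of exponents on the ball. -/

theorem mainTheorem6 (n : ℕ) (hn : 2 ≤ n) :
    -- (i) boundedness of the Hardy operator implies the Sobolev-Poincaré inequality
    (∀ (p : ℝ), 1 ≤ p → p ≤ n / (n - 1) →
      ∀ (Ω : Set (SobPoin.E n)), SobPoin.IsUnitDomain Ω → SobPoin.SobolevPoincare Ω p →
      ∀ X Y : SobPoin.RISpace (volume.restrict Ω),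
        SobPoin.HardyBounded p X Y → SobPoin.SobolevPoincareRI Ω X Y) ∧
    -- (ii) the converse fails for every `p ≠ n / (n - 1)`
    (∀ (p : ℝ), 1 ≤ p → p ≤ n / (n - 1) → p ≠ n / (n - 1) →
      ∃ Ω : Set (SobPoin.E n), SobPoin.IsUnitDomain Ω ∧ SobPoin.SobolevPoincare Ω p ∧
      ∃ X Y : SobPoin.RISpace (volume.restrict Ω),
        SobPoin.SobolevPoincareRI Ω X Y ∧ ¬ SobPoin.HardyBounded p X Y) ∧
    -- the counterexamples on `s`-John domains, with `X = L^t` and `Y = L^r`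
    (∀ (s t p r : ℝ), 1 < s → s < n / (n - 1) → 1 < t → (t - 1) / (n - 1) < s →
      p = n / ((n - 1) * s) → r = n * t / ((n - 1) * s + (1 - t)) →
      ¬ SobPoin.MuckenhouptCondition ((n - 1) * s / n) t r ∧
      ∃ Ω : Set (SobPoin.E n), SobPoin.IsUnitDomain Ω ∧ SobPoin.IsJohnDomain s Ω ∧
      SobPoin.SobolevPoincare Ω p ∧
      ∃ X Y : SobPoin.RISpace (volume.restrict Ω), X.IsLp t ∧ Y.IsLp r ∧
        SobPoin.SobolevPoincareRI Ω X Y ∧ ¬ SobPoin.HardyBounded p X Y) := by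

  have hn0 : 0 < n := by lia
  have hN : (1 : ℝ) < n := by exact_mod_cast hn
  obtain ⟨R, hR, h1⟩ := SobPoin.exists_volume_ball_eq_one hn0
  have hΩ := SobPoin.isUnitDomain_ball hR h1
  have hprob : IsProbabilityMeasure (volume.restrict (ball (0 : SobPoin.E n) R)) :=
    ⟨by rw [Measure.restrict_apply_univ, h1]⟩
  obtain ⟨τ, hτ⟩ := SobPoin.exists_measurePreserving_unitMeasure hn0 h1
  refine ⟨fun p hp _ Ω hΩ hP X Y => SobPoin.sobolevPoincareRI_of_hardyBounded hn0 hp hΩ hP X Y,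
    fun p hp hp1 hp2 => ?_, fun s t p r hs hs1 ht hts hp hr => ?_⟩
  · obtain ⟨q, hpq, hq⟩ := exists_between (lt_of_le_of_ne hp1 hp2)
    have hq1 : 1 ≤ q := hp.trans hpq.le
    have hsub : ∀ u : ℝ, 1 ≤ u → u < n / (n - 1) → 0 < 1 - (n : ℝ) + n / u := by
      intro u hu1 hu
      rw [lt_div_iff₀ (by linarith)] at hu
      have : (n - 1 : ℝ) < n / u := by
        rw [lt_div_iff₀ (by linarith)]
        linarith
      linarith
    refine ⟨_, hΩ, SobPoin.sobolevPoincare_ball hn0 hR h1 hp (hsub p hp (hpq.trans hq)),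
      SobPoin.lpSpace _ 1 le_rfl, SobPoin.lpSpace _ q hq1, ?_, ?_⟩
    · exact SobPoin.sobolevPoincareRI_ball hn0 hR h1 le_rfl hq1
        (by rw [div_one]; exact hsub q hq1 hq) (SobPoin.isLp_lpSpace 1 le_rfl)
        (SobPoin.isLp_lpSpace q hq1)
    · refine SobPoin.not_hardyBounded_of_isLp hτ hp one_pos (by linarith)
        (SobPoin.isLp_lpSpace 1 le_rfl) (SobPoin.isLp_lpSpace q hq1) ?_
      have := one_div_lt_one_div_of_lt (by linarith) hpq
      linarith
  · have hn1 : (0 : ℝ) < n - 1 := by linarith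
    have ht0 : 0 < t := by linarith
    rw [div_lt_iff₀ hn1] at hts
    rw [lt_div_iff₀ hn1] at hs1
    have hD : 0 < (n - 1) * s + (1 - t) := by linarith
    have hr1 : 1 / (r : ℝ) = ((n - 1) * s + (1 - t)) / (n * t) := by rw [hr, one_div_div]
    have hp1 : 1 / p = (n - 1) * s / n := by rw [hp, one_div_div]
    have hr0 : 0 < r := by rw [hr]; positivity
    have htr : t ≤ r := by
      rw [hr, le_div_iff₀ hD]
      nlinarith
    have hpge : 1 ≤ p := by
      rw [hp, one_le_div (by positivity)]
      linarith
    have hms : (n - 1 : ℝ) < (n - 1) * s := by nlinarith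
    have hβp : 0 < 1 - (n : ℝ) + n / p := by
      rw [hp, div_div_cancel₀ (by linarith)]
      linarith
    -- This quantity and the next one show where s > 1 enters: it makes the pair (t, r) strictly
    -- subcritical for the ball and strictly supercritical for the Hardy operator with 1/p =
    -- (n-1)s/n.
    have hβ : 0 < 1 - n / t + n / r := by
      have : 1 - n / t + n / r = (n - 1) * (s - 1) / t := by
        rw [div_eq_mul_one_div (n : ℝ) r, hr1]
        field_simp
        ring
      rw [this]
      exact div_pos (mul_pos hn1 (by linarith)) ht0
    have he : 1 / r + (t - 1) / t - (n - 1) * s / n < 0 := by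
      have : 1 / r + (t - 1) / t - (n - 1) * s / n = -((t - 1) * (n - 1) * (s - 1) / (n * t)) := by
        rw [hr1]
        field_simp
        ring
      rw [this, neg_lt_zero]
      exact div_pos (mul_pos (mul_pos (by linarith) hn1) (by linarith)) (by positivity)
    refine ⟨SobPoin.not_muckenhouptCondition (by positivity) ht he, _, hΩ,
      SobPoin.isJohnDomain_ball hn0 hR hs.le, SobPoin.sobolevPoincare_ball hn0 hR h1 hpge hβp,
      SobPoin.lpSpace _ t ht.le, SobPoin.lpSpace _ r (ht.le.trans htr), SobPoin.isLp_lpSpace _ _,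
      SobPoin.isLp_lpSpace _ _, ?_, ?_⟩
    · exact SobPoin.sobolevPoincareRI_ball hn0 hR h1 ht.le htr hβ (SobPoin.isLp_lpSpace _ _)
        (SobPoin.isLp_lpSpace _ _)
    · refine SobPoin.not_hardyBounded_of_isLp hτ hpge ht0 hr0 (SobPoin.isLp_lpSpace _ _)
        (SobPoin.isLp_lpSpace _ _) ?_
      rw [hp1]
      have : (t - 1) / t = 1 - 1 / t := by rw [sub_div, div_self ht0.ne']
      linarith
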